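/- An $\ell$-path of an undirected graph $G$ is a path in $G$ (a subgraph, not necessarily induced) with exactly $\ell$ vertices. In the 4-path vertex cover problem, the input is a finite simple undirected graph $G$ and an integer $k \ge 0$, and the goal is to decide whether there is a set $S$ of at most $k$ vertices of $G$ such that every 4-path of $G$ contains at least one vertex of $S$. Theorem. The 4-path vertex cover problem can be decided in $O^*(2.619^k)$ time. That is, there are a deterministic algorithm and a polynomial $p$ such that, for every graph $G$ with $n$ vertices and every integer $k \ge 0$, the algorithm halts on the input $(G,k)$ after at most $p(n)\cdot 2.619^k$ steps and correctly answers whether $G$ has such a set $S$. (Steps are counted in the following model: first-order recursive programs over binary trees, where reading a variable, creating a pair, testing a value for being empty and reading the components of a pair, binding a local variable, and calling a procedure each cost one step; up to polynomial factors, this agrees with Turing machines and random access machines. The graph is given by its adjacency matrix, and $k$ in unary.) -/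

import Mathlib

/-! ### The problem -/

/-- `S` is an `l`-path vertex cover of `G`: every path of `G` with `l` vertices
(as a subgraph, not necessarily induced) contains a vertex of `S`. -/
def IsPathVertexCover {V : Type*} (G : SimpleGraph V) (l : ℕ) (S : Finset V) : Prop :=
  ∀ (u v : V) (w : G.Walk u v), w.IsPath → w.support.length = l → ∃ x ∈ w.support, x ∈ S

/-- `(G, k)` is a yes-instance of the `l`-path vertex cover problem. -/
def HasPathVertexCover {V : Type*} (G : SimpleGraph V) (l k : ℕ) : Prop :=
  ∃ S : Finset V, S.card ≤ k ∧ IsPathVertexCover G l S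

/-! ### The model of computation

First-order recursive programs over binary trees ("pure LISP"). A value is a binary tree; the
elementary operations are reading a variable, the constant `nil`, building a pair, branching on
whether a value is `nil` or a pair (and, in the second case, reading its two components), binding
a local variable, and calling a procedure of the program. Each of them costs one step. On a random
access machine that represents trees by pointers, each is a constant number of instructions; in
particular no operation compares, copies or does arithmetic on whole trees. Up to polynomial
factors, running times are those of Turing machines and random access machines. -/

namespace TreeProg

/-- The values: finite binary trees. -/
inductive Data : Type
  | nil : Data
  | cons : Data → Data → Data

/-- The code of a truth value: `nil` is "no". -/
def Data.ofBool : Bool → Data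
  | false => .nil
  | true => .cons .nil .nil

/-- The code of a natural number, in unary. -/
def Data.ofNat : ℕ → Data
  | 0 => .nil
  | m + 1 => .cons .nil (Data.ofNat m)

/-- The code of a finite list of values. -/
def Data.ofList : List Data → Data
  | [] => .nil
  | d :: ds => .cons d (Data.ofList ds)

/-- The terms of the language; variables are de Bruijn indices.
* `var i`: the `i`-th entry of the current environment;
* `nil`, `cons a b`: the empty tree, a pair;
* `matchOn a b c`: evaluate `a`; if the result is `nil`, continue with `b`, and if it is a pair
  `cons x y`, continue with `c`, where `x` is variable `0` and `y` is variable `1`;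
* `letIn a b`: evaluate `a` and continue with `b`, where the result is variable `0`;
* `call f a`: apply the procedure with number `f` to the value of `a`. -/
inductive Term : Type
  | var (i : ℕ) : Term
  | nil : Term
  | cons (a b : Term) : Term
  | matchOn (a b c : Term) : Term
  | letIn (a b : Term) : Term
  | call (f : ℕ) (a : Term) : Term

/-- `Eval procs env a v t`: with the procedure bodies `procs` and the environment `env`, the term
`a` evaluates to `v` in exactly `t` steps (call by value). A procedure body is evaluated in the
environment that consists of the argument only; procedures may be mutually recursive. -/
inductive Eval (procs : List Term) : List Data → Term → Data → ℕ → Prop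
  | var {env : List Data} {i : ℕ} {v : Data} (h : env[i]? = some v) :
      Eval procs env (.var i) v 1
  | nil {env : List Data} :
      Eval procs env .nil .nil 1
  | cons {env : List Data} {a b : Term} {x y : Data} {s t : ℕ}
      (ha : Eval procs env a x s) (hb : Eval procs env b y t) :
      Eval procs env (.cons a b) (.cons x y) (s + t + 1)
  | matchNil {env : List Data} {a b c : Term} {v : Data} {s t : ℕ}
      (ha : Eval procs env a .nil s) (hb : Eval procs env b v t) :
      Eval procs env (.matchOn a b c) v (s + t + 1)
  | matchCons {env : List Data} {a b c : Term} {x y v : Data} {s t : ℕ}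
      (ha : Eval procs env a (.cons x y) s) (hc : Eval procs (x :: y :: env) c v t) :
      Eval procs env (.matchOn a b c) v (s + t + 1)
  | letIn {env : List Data} {a b : Term} {x v : Data} {s t : ℕ}
      (ha : Eval procs env a x s) (hb : Eval procs (x :: env) b v t) :
      Eval procs env (.letIn a b) v (s + t + 1)
  | call {env : List Data} {f : ℕ} {a body : Term} {x v : Data} {s t : ℕ}
      (ha : Eval procs env a x s) (hf : procs[f]? = some body) (hb : Eval procs [x] body v t) :
      Eval procs env (.call f a) v (s + t + 1)

/-- A program: finitely many procedures and a main term. -/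
structure Program where
  procs : List Term
  main : Term

/-- On input `d`, the program halts with output `v` after exactly `t` steps. -/
def Program.HaltsWith (P : Program) (d v : Data) (t : ℕ) : Prop :=
  Eval P.procs [d] P.main v t

/-- Evaluation is deterministic: the result and the number of steps are determined. -/
theorem Eval.deterministic {procs : List Term} {env : List Data} {a : Term} {v : Data} {t : ℕ}
    (h : Eval procs env a v t) :
    ∀ {v' : Data} {t' : ℕ}, Eval procs env a v' t' → v = v' ∧ t = t' := by
  induction h with
  | var h => intro v' t' h'; cases h' with | var h2 => simp_all
  | nil => intro v' t' h'; cases h'; simp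
  | cons ha hb iha ihb =>
    intro v' t' h'
    cases h' with
    | cons ha' hb' =>
      obtain ⟨rfl, rfl⟩ := iha ha'
      obtain ⟨rfl, rfl⟩ := ihb hb'
      simp
  | matchNil ha hb iha ihb =>
    intro v' t' h'
    cases h' with
    | matchNil ha' hb' =>
      obtain ⟨_, rfl⟩ := iha ha'
      obtain ⟨rfl, rfl⟩ := ihb hb'
      simp
    | matchCons ha' hb' => exact absurd (iha ha').1 (by simp)
  | matchCons ha hb iha ihb =>
    intro v' t' h'
    cases h' with
    | matchNil ha' hb' => exact absurd (iha ha').1 (by simp)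
    | matchCons ha' hb' =>
      obtain ⟨hxy, rfl⟩ := iha ha'
      cases hxy
      obtain ⟨rfl, rfl⟩ := ihb hb'
      simp
  | letIn ha hb iha ihb =>
    intro v' t' h'
    cases h' with
    | letIn ha' hb' =>
      obtain ⟨rfl, rfl⟩ := iha ha'
      obtain ⟨rfl, rfl⟩ := ihb hb'
      simp
  | call ha hf hb iha ihb =>
    intro v' t' h'
    cases h' with
    | call ha' hf' hb' =>
      obtain ⟨rfl, rfl⟩ := iha ha'
      rw [hf] at hf'
      cases hf'
      obtain ⟨rfl, rfl⟩ := ihb hb'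
      simp

/-- The code of a graph on the vertices `0, …, n - 1`: its adjacency matrix, the list of the `n`
rows, each the list of its `n` bits. -/
def encodeGraph {n : ℕ} (G : SimpleGraph (Fin n)) [DecidableRel G.Adj] : Data :=
  Data.ofList (List.ofFn fun i : Fin n =>
    Data.ofList (List.ofFn fun j : Fin n => Data.ofBool (decide (G.Adj i j))))

/-- The code of an instance `(G, k)`. -/
def encodeInstance {n : ℕ} (G : SimpleGraph (Fin n)) [DecidableRel G.Adj] (k : ℕ) : Data :=
  .cons (encodeGraph G) (Data.ofNat k)

end TreeProg

/-! The algorithm is iterative compression. Vertices are added one at a time while a cover of size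
at most `k` of the graph seen so far is maintained; if some stage has no such cover, neither has
`G`. At each stage the old cover and the new vertex form a set U of at most `k + 1` vertices, and
the remaining vertices B induce no 4-path. Each vertex of U is either deleted or kept for good, and
the kept ones form A. With the measure (budget + |U|), deleting costs 2 and keeping costs 1, so the
branching number is the golden ratio φ. The measure starts at no more than `2k + 1`, and φ² < 2.619.

When U is exhausted, A and B both induce 4-path-free graphs and only B may be deleted from. Every
remaining 4-path meets A, so it has at most three vertices in B: the task is to hit all conflicts,
sets of at most three vertices of B that complete a 4-path with A. The basic tool is an exchange
(`Sol.exchange`): a vertex `z` of a solution may be traded for others as long as its essential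
conflicts stay hit, those that remain no conflict when `z` is removed. This justifies the rule that
moves `z` to A when one vertex meets all its essential conflicts, and the branchings `Sol.branch`,
`Sol.threePaired` and `Sol.twoPaired`. Their branching vectors (1,2), (4,1,3) and (3,3,3,3) have
branching number at most φ; for the first two it is exactly φ.

If no rule applies, the instance is rigid. A vertex of A with a neighbor in B has no neighbor in A
(`not_adj_adj`); B contains no triangle (`no_triangle`), so its components are stars; centers of
stars with at least two leaves have no neighbor in A; conflicts of two vertices form a matching
(`pair_unique`). Each center has two leaves outside this matching (`exists_unpaired`). All centers
together with one vertex of each matched pair are a solution, and a counting argument shows that it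
is optimal (`exists_sol_mem`). Hence centers and paired vertices can be deleted without branching.

For the running time in the tree language, every rule is a first-order condition on a labelled graph
with a fixed number of quantifiers. One model checker, verified once (`eval_formula`), evaluates all
of them in polynomial time, and `solves_of_node` bounds the search tree for all rules alike. -/

namespace FourPath

/-! ### Conflicts, solutions and exchanges. -/

variable {V : Type*} (G : SimpleGraph V)

/-- `p, q, r, s` is a path of `G` with four vertices. -/
def IsP4 (p q r s : V) : Prop :=
  G.Adj p q ∧ G.Adj q r ∧ G.Adj r s ∧ p ≠ r ∧ p ≠ s ∧ q ≠ s

/-- `G` has no 4-path inside `X`. -/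
def P4Free (X : Set V) : Prop :=
  ∀ p q r s, p ∈ X → q ∈ X → r ∈ X → s ∈ X → ¬ IsP4 G p q r s

/-- `G` has a 4-path inside `A ∪ {x, y, z}`. -/
def Conf (A : Set V) (x y z : V) : Prop :=
  ∃ p q r s, IsP4 G p q r s ∧ (p ∈ A ∨ p = x ∨ p = y ∨ p = z) ∧ (q ∈ A ∨ q = x ∨ q = y ∨ q = z) ∧
    (r ∈ A ∨ r = x ∨ r = y ∨ r = z) ∧ (s ∈ A ∨ s = x ∨ s = y ∨ s = z)

/-- The vertex `z` is essential for the conflict `z, p, q`. -/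
def Ess (A B : Set V) (z p q : V) : Prop :=
  p ∈ B ∧ q ∈ B ∧ p ≠ z ∧ q ≠ z ∧ Conf G A z p q ∧ ¬ Conf G A p p q

/-- In a solution, `y` may be exchanged for `x`. -/
def Dominates (A B : Set V) (x y : V) : Prop :=
  ∀ p q, Ess G A B y p q → p = x ∨ q = x ∨ Conf G A x p q

/-- Deleting `S` leaves no 4-path in `A ∪ B`. -/
def Sol (A B : Set V) (S : Finset V) : Prop :=
  P4Free G {v | v ∈ A ∨ (v ∈ B ∧ v ∉ S)}

/-- Every essential conflict of `u` contains `c` or `v`. -/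
def Swap (A B : Set V) (c u v : V) : Prop :=
  ∀ p q, Ess G A B u p q → p = c ∨ q = c ∨ p = v ∨ q = v

/-- Three leaves `u₁, u₂, u₃` of a star with center `c` have partners `v₁, v₂, v₃`. -/
def ThreePaired (A B : Set V) (c u₁ u₂ u₃ v₁ v₂ v₃ : V) : Prop :=
  [c, u₁, u₂, u₃, v₁, v₂, v₃].Nodup ∧ Conf G A u₁ v₁ v₁ ∧ Conf G A u₂ v₂ v₂ ∧ Conf G A u₃ v₃ v₃ ∧
    Conf G A c u₁ u₂ ∧ Conf G A c u₁ u₃ ∧ Swap G A B c u₂ v₂ ∧ Swap G A B c u₃ v₃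

/-- Two of the three leaves `u₁, u₂, l` of a star with center `c` have partners `v₁, v₂`. -/
def TwoPaired (A B : Set V) (c u₁ u₂ l v₁ v₂ b : V) : Prop :=
  [c, u₁, u₂, l, v₁, v₂, b].Nodup ∧ Conf G A u₁ v₁ v₁ ∧ Conf G A u₂ v₂ v₂ ∧
    Conf G A c l u₁ ∧ Conf G A c l u₂ ∧ Conf G A c l b ∧ Conf G A c u₁ u₂ ∧ Swap G A B c u₁ v₁ ∧
    ∀ p q, Ess G A B u₂ p q →
      p = v₂ ∨ q = v₂ ∨ ((p = c ∨ q = c) ∧ (p = u₁ ∨ q = u₁ ∨ p = l ∨ q = l))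

variable {G} {A B : Set V}

theorem IsP4.reverse {p q r s : V} (h : IsP4 G p q r s) : IsP4 G s r q p := by
  obtain ⟨h1, h2, h3, h4, h5, h6⟩ := h
  exact ⟨h3.symm, h2.symm, h1.symm, h6.symm, h5.symm, h4.symm⟩

theorem Conf.mono {x y z x' y' z' : V} (h : Conf G A x y z)
    (hx : x = x' ∨ x = y' ∨ x = z') (hy : y = x' ∨ y = y' ∨ y = z')
    (hz : z = x' ∨ z = y' ∨ z = z') : Conf G A x' y' z' := by
  obtain ⟨p, q, r, s, h, hp, hq, hr, hs⟩ := h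
  refine ⟨p, q, r, s, h, ?_, ?_, ?_, ?_⟩ <;> grind

theorem P4Free.mono {X Y : Set V} (h : P4Free G Y) (hXY : X ⊆ Y) : P4Free G X :=
  fun p q r s hp hq hr hs => h p q r s (hXY hp) (hXY hq) (hXY hr) (hXY hs)

theorem Sol.free_left {S : Finset V} (h : Sol G A B S) : P4Free G A :=
  h.mono fun _ hv => Or.inl hv

theorem Sol.hits {S : Finset V} (h : Sol G A B S) {x y z : V} (hx : x ∈ B) (hy : y ∈ B)
    (hz : z ∈ B) (hc : Conf G A x y z) : x ∈ S ∨ y ∈ S ∨ z ∈ S := by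
  by_contra! hn
  obtain ⟨p, q, r, s, hP, hp, hq, hr, hs⟩ := hc
  refine h p q r s ?_ ?_ ?_ ?_ hP <;> simp only [Set.mem_ofPred_eq] <;> grind

/-- Since B has no 4-path of its own, every 4-path uses a vertex of A, so at most three of its
vertices lie in B and one triple of B captures it. This is why conflicts of at most three vertices
suffice. -/
theorem sol_of_hits (hA : P4Free G A) (hB : P4Free G B) {S : Finset V}
    (h : ∀ x y z, x ∈ B → y ∈ B → z ∈ B → x ∉ S → y ∉ S → z ∉ S → ¬ Conf G A x y z) :
    Sol G A B S := by
  intro p q r s hp hq hr hs hP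
  simp only [Set.mem_ofPred_eq] at hp hq hr hs
  have key : ∀ x y z, x ∈ B → y ∈ B → z ∈ B → x ∉ S → y ∉ S → z ∉ S →
      (p ∈ A ∨ p = x ∨ p = y ∨ p = z) → (q ∈ A ∨ q = x ∨ q = y ∨ q = z) →
      (r ∈ A ∨ r = x ∨ r = y ∨ r = z) → (s ∈ A ∨ s = x ∨ s = y ∨ s = z) → False :=
    fun x y z hx hy hz hx' hy' hz' h1 h2 h3 h4 =>
      h x y z hx hy hz hx' hy' hz' ⟨p, q, r, s, hP, h1, h2, h3, h4⟩
  clear h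
  -- A triple may need padding when fewer than three path vertices lie in B; `d` is the filler. It
  -- exists because otherwise the path would lie in A.
  obtain ⟨d, hd, hd'⟩ : ∃ d, d ∈ B ∧ d ∉ S := by
    by_contra! hn
    refine hA p q r s ?_ ?_ ?_ ?_ hP <;> grind
  have hf : ∀ v, (v ∈ A ∨ (v ∈ B ∧ v ∉ S)) → ∃ w, w ∈ B ∧ w ∉ S ∧ (v ∈ A ∨ v = w) := by
    rintro v (hv | ⟨hv, hv'⟩)
    · exact ⟨d, hd, hd', Or.inl hv⟩
    · exact ⟨v, hv, hv', Or.inr rfl⟩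
  obtain ⟨p', hp1, hp2, hp3⟩ := hf p hp
  obtain ⟨q', hq1, hq2, hq3⟩ := hf q hq
  obtain ⟨r', hr1, hr2, hr3⟩ := hf r hr
  obtain ⟨s', hs1, hs2, hs3⟩ := hf s hs
  have hsome : p ∈ A ∨ q ∈ A ∨ r ∈ A ∨ s ∈ A := by
    by_contra! hn
    refine hB p q r s ?_ ?_ ?_ ?_ hP <;> grind
  rcases hsome with h | h | h | h
  · exact key q' r' s' hq1 hr1 hs1 hq2 hr2 hs2 (by grind) (by grind) (by grind) (by grind)
  · exact key p' r' s' hp1 hr1 hs1 hp2 hr2 hs2 (by grind) (by grind) (by grind) (by grind)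
  · exact key p' q' s' hp1 hq1 hs1 hp2 hq2 hs2 (by grind) (by grind) (by grind) (by grind)
  · exact key p' q' r' hp1 hq1 hr1 hp2 hq2 hr2 (by grind) (by grind) (by grind) (by grind)

/-- Only conflicts through `z` can become unhit. If such a conflict is not essential, its other
vertices are already a conflict, which `S` hits at a vertex other than `z`, and that vertex survives
in `S'`. -/
theorem Sol.exchange (hB : P4Free G B) {S S' : Finset V} (h : Sol G A B S) {z : V}
    (hz : ¬ Conf G A z z z) (hS : ∀ v ∈ S, v ≠ z → v ∈ S')
    (hE : ∀ p q, Ess G A B z p q → p ∈ S' ∨ q ∈ S') : Sol G A B S' := by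
  have hn : ∀ v, v ∉ S' → v ≠ z → v ∉ S := fun v hv hvz hvS => hv (hS v hvS hvz)
  have key : ∀ p q, p ∈ B → q ∈ B → p ∉ S' → q ∉ S' → ¬ Conf G A z p q := by
    intro p q hp hq hp' hq' hc
    by_cases hpz : p = z
    · by_cases hqz : q = z
      · subst hpz; subst hqz; exact hz hc
      · have hc' : Conf G A z q q := hc.mono (by simp) (by simp [hpz]) (by simp)
        refine (hE q q ⟨hq, hq, hqz, hqz, hc', fun hcc => ?_⟩).elim hq' hq'
        rcases h.hits hq hq hq hcc with h1 | h1 | h1 <;> exact hn q hq' hqz h1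
    · by_cases hqz : q = z
      · have hc' : Conf G A z p p := hc.mono (by simp) (by simp) (by simp [hqz])
        refine (hE p p ⟨hp, hp, hpz, hpz, hc', fun hcc => ?_⟩).elim hp' hp'
        rcases h.hits hp hp hp hcc with h1 | h1 | h1 <;> exact hn p hp' hpz h1
      · refine (hE p q ⟨hp, hq, hpz, hqz, hc, fun hcc => ?_⟩).elim hp' hq'
        rcases h.hits hp hp hq hcc with h1 | h1 | h1
        · exact hn p hp' hpz h1
        · exact hn p hp' hpz h1
        · exact hn q hq' hqz h1
  refine sol_of_hits h.free_left hB ?_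
  intro x y w hx hy hw hx' hy' hw' hc
  by_cases hxz : x = z
  · subst hxz; exact key y w hy hw hy' hw' hc
  by_cases hyz : y = z
  · subst hyz; exact key x w hx hw hx' hw' (hc.mono (by simp) (by simp) (by simp))
  by_cases hwz : w = z
  · subst hwz; exact key x y hx hy hx' hy' (hc.mono (by simp) (by simp) (by simp))
  rcases h.hits hx hy hw hc with h1 | h1 | h1
  · exact hn x hx' hxz h1
  · exact hn y hy' hyz h1
  · exact hn w hw' hwz h1

/-! ### Soundness of the reduction and branching rules. -/

section Rules

variable [DecidableEq V]

/-- Exchanging `z` for `t` in a solution. -/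
theorem Sol.exchange_insert (hB : P4Free G B) {S : Finset V} (h : Sol G A B S) {z t : V}
    (hz : ¬ Conf G A z z z) (hzS : z ∈ S)
    (hE : ∀ p q, Ess G A B z p q → p = t ∨ q = t ∨ (p ∈ S ∧ p ≠ z) ∨ (q ∈ S ∧ q ≠ z)) :
    Sol G A B (insert t (S.erase z)) ∧ (insert t (S.erase z)).card ≤ S.card := by
  refine ⟨h.exchange hB hz (fun v hv hvz => by simp [hv, hvz]) fun p q hpq => ?_, ?_⟩
  · have := hE p q hpq
    simp only [Finset.mem_insert, Finset.mem_erase]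
    tauto
  · refine (Finset.card_insert_le _ _).trans ?_
    rw [Finset.card_erase_add_one hzS]

/-- If `t` meets all essential conflicts of `z`, deleting `t` is at least as good as deleting `z`.
In the case `t = z` there are no essential conflicts at all, and `z` is simply dropped. -/
theorem Sol.keep (hB : P4Free G B) {S : Finset V} (h : Sol G A B S) {z t : V}
    (hz : ¬ Conf G A z z z) (hE : ∀ p q, Ess G A B z p q → p = t ∨ q = t) :
    ∃ S' : Finset V, Sol G A B S' ∧ S'.card ≤ S.card ∧ z ∉ S' := by
  by_cases hzS : z ∈ S
  · by_cases htz : t = z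
    · refine ⟨S.erase z, h.exchange hB hz (fun v hv hvz => by simp [hv, hvz]) fun p q hpq => ?_,
        Finset.card_erase_le, by simp⟩
      have h1 := hE p q hpq
      obtain ⟨-, -, h2, h3, -⟩ := hpq
      grind
    · obtain ⟨h1, h2⟩ := h.exchange_insert hB hz hzS (t := t) fun p q hpq => by
        have := hE p q hpq; tauto
      exact ⟨_, h1, h2, by simp [Ne.symm htz]⟩
  · exact ⟨S, h, le_rfl, hzS⟩

/-- A solution with `y` but without `x` can trade `y` for `x`: for an essential conflict `y, p, q`
domination gives the conflict `x, p, q`, which is hit in `p` or `q`. If both `x` and `y` stay, `b₁`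
and `b₂` are forced. The case `x = y` is allowed and yields the uniqueness of partners. -/
theorem Sol.branch (hB : P4Free G B) {S : Finset V} (h : Sol G A B S) {x y b₁ b₂ : V}
    (hx : x ∈ B) (hy : y ∈ B) (hb₁ : b₁ ∈ B) (hb₂ : b₂ ∈ B) (hyy : ¬ Conf G A y y y)
    (hd : Dominates G A B x y) (h₁ : Conf G A x y b₁) (h₂ : Conf G A x y b₂) :
    ∃ S' : Finset V, Sol G A B S' ∧ S'.card ≤ S.card ∧ (x ∈ S' ∨ (b₁ ∈ S' ∧ b₂ ∈ S')) := by
  by_cases hxS : x ∈ S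
  · exact ⟨S, h, le_rfl, Or.inl hxS⟩
  by_cases hyS : y ∈ S
  · obtain ⟨h1, h2⟩ := h.exchange_insert hB hyy hyS (t := x) fun p q hpq => by
      have h3 := hd p q hpq
      obtain ⟨hp, hq, hpy, hqy, -, -⟩ := hpq
      rcases h3 with h3 | h3 | h3
      · exact Or.inl h3
      · exact Or.inr (Or.inl h3)
      · rcases h.hits hx hp hq h3 with h4 | h4 | h4
        · exact absurd h4 hxS
        · exact Or.inr (Or.inr (Or.inl ⟨h4, hpy⟩))
        · exact Or.inr (Or.inr (Or.inr ⟨h4, hqy⟩))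
    exact ⟨_, h1, h2, Or.inl (by simp)⟩
  · refine ⟨S, h, le_rfl, Or.inr ⟨?_, ?_⟩⟩
    · have := h.hits hx hy hb₁ h₁; tauto
    · have := h.hits hx hy hb₂ h₂; tauto

/-- If `c` is deleted, then the partner `v` of `u` may be deleted instead of `u`. -/
theorem Sol.swap (hB : P4Free G B) {S : Finset V} (h : Sol G A B S) {c u v : V}
    (hu : u ∈ B) (hv : v ∈ B) (huu : ¬ Conf G A u u u) (hc : c ∈ S) (hcu : c ≠ u)
    (huv : Conf G A u v v) (hs : Swap G A B c u v) :
    ∃ S' : Finset V, Sol G A B S' ∧ S'.card ≤ S.card ∧ v ∈ S' ∧ ∀ w ∈ S, w ≠ u → w ∈ S' := by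
  by_cases hvS : v ∈ S
  · exact ⟨S, h, le_rfl, hvS, fun w hw _ => hw⟩
  have huS : u ∈ S := by have := h.hits hu hv hv huv; tauto
  obtain ⟨h1, h2⟩ := h.exchange_insert hB huu huS (t := v) fun p q hpq => by
    have h3 := hs p q hpq
    obtain ⟨hp, hq, hpy, hqy, -, -⟩ := hpq
    rcases h3 with rfl | rfl | h3 | h3
    · exact Or.inr (Or.inr (Or.inl ⟨hc, hpy⟩))
    · exact Or.inr (Or.inr (Or.inr ⟨hc, hqy⟩))
    · exact Or.inl h3
    · exact Or.inr (Or.inl h3)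
  exact ⟨_, h1, h2, by simp, fun w hw hwu => by simp [hw, hwu]⟩

/-- Branch on `u₁`. If it stays, `v₁` is forced. If moreover `c` is deleted, `u₂` and `u₃` may be
exchanged for their partners; otherwise the conflicts `c, u₁, u₂` and `c, u₁, u₃` force `u₂` and
`u₃`. The vector (4,1,3) is exactly golden: φ⁻³ + φ⁻⁴ = φ⁻². -/
theorem Sol.threePaired (hB : P4Free G B) (h1 : ∀ x ∈ B, ¬ Conf G A x x x) {S : Finset V}
    (h : Sol G A B S) {c u₁ u₂ u₃ v₁ v₂ v₃ : V}
    (hc : c ∈ B) (hu₁ : u₁ ∈ B) (hu₂ : u₂ ∈ B) (hu₃ : u₃ ∈ B) (hv₁ : v₁ ∈ B) (hv₂ : v₂ ∈ B)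
    (hv₃ : v₃ ∈ B) (hT : ThreePaired G A B c u₁ u₂ u₃ v₁ v₂ v₃) :
    ∃ S' : Finset V, Sol G A B S' ∧ S'.card ≤ S.card ∧
      ((c ∈ S' ∧ v₁ ∈ S' ∧ v₂ ∈ S' ∧ v₃ ∈ S') ∨ u₁ ∈ S' ∨ (u₂ ∈ S' ∧ u₃ ∈ S' ∧ v₁ ∈ S')) := by
  obtain ⟨hN, p1, p2, p3, q2, q3, s2, s3⟩ := hT
  simp only [List.nodup_cons, List.mem_cons, List.not_mem_nil, or_false, not_or] at hN
  obtain ⟨⟨-, n1, n2, -, -, -⟩, -, ⟨-, n3, -, -⟩, ⟨n4, n5, -⟩, -⟩ := hN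
  by_cases hu₁S : u₁ ∈ S
  · exact ⟨S, h, le_rfl, Or.inr (Or.inl hu₁S)⟩
  have hv₁S : v₁ ∈ S := by have := h.hits hu₁ hv₁ hv₁ p1; tauto
  by_cases hcS : c ∈ S
  · obtain ⟨S₂, hS₂, hc₂, hm₂, hk₂⟩ := h.swap hB hu₂ hv₂ (h1 _ hu₂) hcS n1 p2 s2
    have hcS₂ : c ∈ S₂ := hk₂ c hcS n1
    obtain ⟨S₃, hS₃, hc₃, hm₃, hk₃⟩ := hS₂.swap hB hu₃ hv₃ (h1 _ hu₃) hcS₂ n2 p3 s3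
    refine ⟨S₃, hS₃, hc₃.trans hc₂, Or.inl ⟨hk₃ c hcS₂ n2, ?_, ?_, hm₃⟩⟩
    · exact hk₃ v₁ (hk₂ v₁ hv₁S (Ne.symm n3)) (Ne.symm n4)
    · exact hk₃ v₂ hm₂ (Ne.symm n5)
  · have h2 := h.hits hc hu₁ hu₂ q2
    have h3 := h.hits hc hu₁ hu₃ q3
    exact ⟨S, h, le_rfl, Or.inr (Or.inr ⟨by tauto, by tauto, hv₁S⟩)⟩

/-- If `l` stays, either `c` is deleted and both leaves are exchanged for their partners, or three
conflicts through `c, l` force `u₁, u₂, b`. If `l` is deleted, one vertex of each pair is deleted as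
well. Deleting both `u₁` and `u₂` is not needed, because `u₂` can be traded for `v₂`, and deleting
neither forces `c`, which is the first branch. -/
theorem Sol.twoPaired (hB : P4Free G B) (h1 : ∀ x ∈ B, ¬ Conf G A x x x) {S : Finset V}
    (h : Sol G A B S) {c u₁ u₂ l v₁ v₂ b : V}
    (hc : c ∈ B) (hu₁ : u₁ ∈ B) (hu₂ : u₂ ∈ B) (hl : l ∈ B) (hv₁ : v₁ ∈ B) (hv₂ : v₂ ∈ B)
    (hb : b ∈ B) (hT : TwoPaired G A B c u₁ u₂ l v₁ v₂ b) :
    ∃ S' : Finset V, Sol G A B S' ∧ S'.card ≤ S.card ∧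
      ((c ∈ S' ∧ v₁ ∈ S' ∧ v₂ ∈ S') ∨ (u₁ ∈ S' ∧ u₂ ∈ S' ∧ b ∈ S') ∨
        (u₁ ∈ S' ∧ v₂ ∈ S' ∧ l ∈ S') ∨ (v₁ ∈ S' ∧ u₂ ∈ S' ∧ l ∈ S')) := by
  obtain ⟨hN, p1, p2, q1, q2, q3, q4, s1, s2⟩ := hT
  simp only [List.nodup_cons, List.mem_cons, List.not_mem_nil, or_false, not_or] at hN
  obtain ⟨⟨n1, n2, -, -, -, -⟩, ⟨n3, -⟩, ⟨n4, n5, -⟩, -⟩ := hN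
  have a1 : u₁ ∈ S ∨ v₁ ∈ S := by simpa using h.hits hu₁ hv₁ hv₁ p1
  have a2 : u₂ ∈ S ∨ v₂ ∈ S := by simpa using h.hits hu₂ hv₂ hv₂ p2
  by_cases hlS : l ∈ S
  · by_cases hu₁S : u₁ ∈ S
    · rcases a2 with hu₂S | hv₂S
      -- An essential conflict of `u₂` that avoids `v₂` contains `u₁` or `l`, and both are in `S`.
      · obtain ⟨h3, h4⟩ := h.exchange_insert hB (h1 _ hu₂) hu₂S (t := v₂) fun p q hpq => by
          have h3 := s2 p q hpq
          obtain ⟨hp, hq, hpy, hqy, -, -⟩ := hpq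
          clear a1 s1 s2 h1 h p1 p2 q1 q2 q3 q4 hB
          grind
        exact ⟨_, h3, h4, Or.inr (Or.inr (Or.inl
          ⟨Finset.mem_insert_of_mem (Finset.mem_erase.2 ⟨n3, hu₁S⟩), by simp,
            Finset.mem_insert_of_mem (Finset.mem_erase.2 ⟨Ne.symm n4, hlS⟩)⟩))⟩
      · exact ⟨S, h, le_rfl, Or.inr (Or.inr (Or.inl ⟨hu₁S, hv₂S, hlS⟩))⟩
    · have hv₁S : v₁ ∈ S := a1.resolve_left hu₁S
      by_cases hu₂S : u₂ ∈ S
      · exact ⟨S, h, le_rfl, Or.inr (Or.inr (Or.inr ⟨hv₁S, hu₂S, hlS⟩))⟩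
      · have hcS : c ∈ S := by simpa [hu₁S, hu₂S] using h.hits hc hu₁ hu₂ q4
        exact ⟨S, h, le_rfl, Or.inl ⟨hcS, hv₁S, a2.resolve_left hu₂S⟩⟩
  · by_cases hcS : c ∈ S
    · have s2' : Swap G A B c u₂ v₂ := fun p q hpq => by
        rcases s2 p q hpq with h | h | ⟨h | h, -⟩ <;> simp [h]
      obtain ⟨S₂, hS₂, hc₂, hm₂, hk₂⟩ := h.swap hB hu₁ hv₁ (h1 _ hu₁) hcS n1 p1 s1
      have hcS₂ : c ∈ S₂ := hk₂ c hcS n1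
      obtain ⟨S₃, hS₃, hc₃, hm₃, hk₃⟩ := hS₂.swap hB hu₂ hv₂ (h1 _ hu₂) hcS₂ n2 p2 s2'
      exact ⟨S₃, hS₃, hc₃.trans hc₂,
        Or.inl ⟨hk₃ c hcS₂ n2, hk₃ v₁ hm₂ (Ne.symm n5), hm₃⟩⟩
    · exact ⟨S, h, le_rfl, Or.inr (Or.inl
        ⟨by simpa [hcS, hlS] using h.hits hc hl hu₁ q1,
          by simpa [hcS, hlS] using h.hits hc hl hu₂ q2,
          by simpa [hcS, hlS] using h.hits hc hl hb q3⟩)⟩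

end Rules

end FourPath

/-! ### Structure of irreducible instances: adjacency between A and B. -/

namespace FourPath

variable {V : Type*} (G : SimpleGraph V) (A B : Set V)

/-- None of the reduction and branching rules applies. -/
structure Irreducible : Prop where
  disj : ∀ v ∈ A, v ∉ B
  freeA : P4Free G A
  freeB : P4Free G B
  single : ∀ x ∈ B, ¬ Conf G A x x x
  avoid : ∀ z ∈ B, ∀ t ∈ B, ∃ p q, Ess G A B z p q ∧ p ≠ t ∧ q ≠ t
  branch : ∀ x ∈ B, ∀ y ∈ B, ∀ b₁ ∈ B, ∀ b₂ ∈ B, Dominates G A B x y → Conf G A x y b₁ →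
    Conf G A x y b₂ → b₁ = b₂
  noThree : ∀ c ∈ B, ∀ u₁ ∈ B, ∀ u₂ ∈ B, ∀ u₃ ∈ B, ∀ v₁ ∈ B, ∀ v₂ ∈ B, ∀ v₃ ∈ B,
    ¬ ThreePaired G A B c u₁ u₂ u₃ v₁ v₂ v₃
  noTwo : ∀ c ∈ B, ∀ u₁ ∈ B, ∀ u₂ ∈ B, ∀ l ∈ B, ∀ v₁ ∈ B, ∀ v₂ ∈ B, ∀ b ∈ B,
    ¬ TwoPaired G A B c u₁ u₂ l v₁ v₂ b

/-- `c` has two neighbors in `B`. -/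
def Center (c : V) : Prop := ∃ y ∈ B, ∃ z ∈ B, y ≠ z ∧ G.Adj c y ∧ G.Adj c z

/-- `u` has a partner, a vertex that together with `u` is a conflict. -/
def Paired (u : V) : Prop := ∃ v ∈ B, v ≠ u ∧ Conf G A u v v

variable {G} {A B}

/-- The path must visit `z`, since otherwise `p, q` alone would be a conflict. Up to reversal, `z`
is its first or second vertex. -/
theorem Ess.path {z p q : V} (h : Ess G A B z p q) :
    (∃ a b c, IsP4 G z a b c ∧ (a ∈ A ∨ a = p ∨ a = q) ∧ (b ∈ A ∨ b = p ∨ b = q) ∧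
      (c ∈ A ∨ c = p ∨ c = q)) ∨
    (∃ a b c, IsP4 G a z b c ∧ (a ∈ A ∨ a = p ∨ a = q) ∧ (b ∈ A ∨ b = p ∨ b = q) ∧
      (c ∈ A ∨ c = p ∨ c = q)) := by
  obtain ⟨-, -, -, -, ⟨w₁, w₂, w₃, w₄, hP, h1, h2, h3, h4⟩, hn⟩ := h
  have n1 := hP.1.ne
  have n2 := hP.2.1.ne
  have n3 := hP.2.2.1.ne
  obtain ⟨-, -, -, n4, n5, n6⟩ := id hP
  have hd : ∀ {w}, (w ∈ A ∨ w = z ∨ w = p ∨ w = q) → w ≠ z → (w ∈ A ∨ w = p ∨ w = q) :=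
    fun h hw => h.imp_right fun h => h.resolve_left hw
  have hz : w₁ = z ∨ w₂ = z ∨ w₃ = z ∨ w₄ = z := by
    by_contra! hz
    exact hn ⟨w₁, w₂, w₃, w₄, hP, by simpa using hd h1 hz.1, by simpa using hd h2 hz.2.1,
      by simpa using hd h3 hz.2.2.1, by simpa using hd h4 hz.2.2.2⟩
  rcases hz with rfl | rfl | rfl | rfl
  · exact Or.inl ⟨_, _, _, hP, hd h2 n1.symm, hd h3 n4.symm, hd h4 n5.symm⟩
  · exact Or.inr ⟨_, _, _, hP, hd h1 n1, hd h3 n2.symm, hd h4 n6.symm⟩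
  · exact Or.inr ⟨_, _, _, hP.reverse, hd h4 n3.symm, hd h2 n2, hd h1 n4⟩
  · exact Or.inl ⟨_, _, _, hP.reverse, hd h3 n3, hd h2 n6, hd h1 n5⟩

namespace Irreducible

variable (h : Irreducible G A B)
include h

theorem ne_of_mem {a b : V} (ha : a ∈ A) (hb : b ∈ B) : a ≠ b := by
  rintro rfl
  exact h.disj a ha hb

/-- A vertex dominates itself, so the branching rule with `x = y = u` would apply to two different
partners. -/
theorem pair_unique {u v w : V} (hu : u ∈ B) (hv : v ∈ B) (hw : w ∈ B)
    (h1 : Conf G A u v v) (h2 : Conf G A u w w) : v = w :=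
  h.branch u hu u hu v hv w hw (fun _ _ hE => Or.inr (Or.inr hE.2.2.2.2.1))
    (h1.mono (by simp) (by simp) (by simp)) (h2.mono (by simp) (by simp) (by simp))

/-- With `a'`, `a`, `b` in a row, every neighbor of `b` in B is a partner of `b`, and more generally
every essential conflict of `b` contains a partner. Partners are unique, so a single vertex would
meet all essential conflicts of `b`, against `avoid`. -/
theorem not_adj_adj {b a a' : V} (hb : b ∈ B) (ha : a ∈ A) (ha' : a' ∈ A) (h1 : G.Adj b a)
    (h2 : G.Adj a a') : False := by
  have hna := h.ne_of_mem ha hb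
  have hna' := h.ne_of_mem ha' hb
  -- a neighbor of `b` in `B` is a partner of `b`
  have hnbr : ∀ w ∈ B, G.Adj b w → Conf G A b w w := fun w hw hbw =>
    ⟨a', a, b, w, ⟨h2.symm, h1.symm, hbw, hna', h.ne_of_mem ha' hw, h.ne_of_mem ha hw⟩,
      Or.inl ha', Or.inl ha, by simp, by simp⟩
  have hAn : ∀ w ∈ A, G.Adj b w → w = a ∨ w = a' := by
    intro w hw hbw
    by_contra! hn
    exact h.single b hb ⟨a', a, b, w, ⟨h2.symm, h1.symm, hbw, hna', hn.2.symm, hn.1.symm⟩,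
      Or.inl ha', Or.inl ha, by simp, Or.inl hw⟩
  -- Suppose neither `p` nor `q` is a partner. Then the path leaves `b` only towards A. If `b` is
  -- its end, the next vertex is `a` or `a'`, and replacing `b` by the other of these two gives a
  -- 4-path without `b`, so the conflict is not essential. If `b` is second, both neighbors of `b`
  -- are in A and only the last vertex can be in B, which makes it a partner.
  have key : ∀ p q, Ess G A B b p q → Conf G A b p p ∨ Conf G A b q q := by
    intro p q hE
    by_contra! hn
    obtain ⟨hn1, hn2⟩ := hn
    obtain ⟨hp, hq, -, -, -, hpq⟩ := id hE
    rcases hE.path with ⟨w₂, w₃, w₄, hP, m2, m3, m4⟩ | ⟨w₁, w₃, w₄, hP, m1, m3, m4⟩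
    · have hw₂ : w₂ ∈ A := by
        rcases m2 with m2 | rfl | rfl
        · exact m2
        · exact absurd (hnbr _ hp hP.1) hn1
        · exact absurd (hnbr _ hq hP.1) hn2
      have h34 : (w₃ = p ∧ w₄ = q) ∨ (w₃ = q ∧ w₄ = p) := by
        by_contra hcon
        by_cases hpp : w₃ = p ∨ w₄ = p
        · refine hn1 ⟨b, w₂, w₃, w₄, hP, by simp, Or.inl hw₂, ?_, ?_⟩ <;> grind
        · refine hn2 ⟨b, w₂, w₃, w₄, hP, by simp, Or.inl hw₂, ?_, ?_⟩ <;> grind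
      have hm3 : w₃ ∈ B := by grind
      have hm4 : w₄ ∈ B := by grind
      rcases hAn w₂ hw₂ hP.1 with rfl | rfl
      · exact hpq ⟨a', w₂, w₃, w₄, ⟨h2.symm, hP.2.1, hP.2.2.1, h.ne_of_mem ha' hm3,
          h.ne_of_mem ha' hm4, hP.2.2.2.2.2⟩, Or.inl ha', Or.inl hw₂, by grind, by grind⟩
      · exact hpq ⟨a, w₂, w₃, w₄, ⟨h2, hP.2.1, hP.2.2.1, h.ne_of_mem ha hm3,
          h.ne_of_mem ha hm4, hP.2.2.2.2.2⟩, Or.inl ha, Or.inl hw₂, by grind, by grind⟩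
    · have hw₁ : w₁ ∈ A := by
        rcases m1 with m1 | rfl | rfl
        · exact m1
        · exact absurd (hnbr _ hp hP.1.symm) hn1
        · exact absurd (hnbr _ hq hP.1.symm) hn2
      have hw₃ : w₃ ∈ A := by
        rcases m3 with m1 | rfl | rfl
        · exact m1
        · exact absurd (hnbr _ hp hP.2.1) hn1
        · exact absurd (hnbr _ hq hP.2.1) hn2
      rcases m4 with m4 | rfl | rfl
      · exact hn1 ⟨_, _, _, _, hP, Or.inl hw₁, by simp, Or.inl hw₃, Or.inl m4⟩
      · exact hn1 ⟨_, _, _, _, hP, Or.inl hw₁, by simp, Or.inl hw₃, by simp⟩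
      · exact hn2 ⟨_, _, _, _, hP, Or.inl hw₁, by simp, Or.inl hw₃, by simp⟩
  by_cases ht : ∃ t ∈ B, Conf G A b t t
  · obtain ⟨t, htB, ht⟩ := ht
    obtain ⟨p, q, hE, hpt, hqt⟩ := h.avoid b hb t htB
    rcases key p q hE with hc | hc
    · exact hpt (h.pair_unique hb hE.1 htB hc ht)
    · exact hqt (h.pair_unique hb hE.2.1 htB hc ht)
  · obtain ⟨p, q, hE, -, -⟩ := h.avoid b hb b hb
    rcases key p q hE with hc | hc
    · exact ht ⟨p, hE.1, hc⟩
    · exact ht ⟨q, hE.2.1, hc⟩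

theorem nbr_mem {b a w : V} (hb : b ∈ B) (ha : a ∈ A) (h1 : G.Adj a b) (h2 : G.Adj a w)
    (hw : w ∈ A ∨ w ∈ B) : w ∈ B :=
  hw.resolve_left fun hw => h.not_adj_adj hb ha hw h1.symm h2

/-- Two adjacent inner vertices in A would force the outer ones into A by `not_adj_adj`, giving a
4-path in A. An inner edge between A and B makes the path alternate, and an inner edge in B makes it
`a, u, v, a'`. -/
theorem pair_path {u v : V} (hu : u ∈ B) (hv : v ∈ B) (hc : Conf G A u v v) :
    ∃ a ∈ A, ∃ a' ∈ A, a ≠ a' ∧ ((G.Adj u a ∧ G.Adj u a' ∧ G.Adj v a') ∨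
      (G.Adj v a ∧ G.Adj v a' ∧ G.Adj u a') ∨ (G.Adj u v ∧ G.Adj u a ∧ G.Adj v a')) := by
  obtain ⟨p, q, r, s, hP, hp, hq, hr, hs⟩ := hc
  obtain ⟨e1, e2, e3, n1, n2, n3⟩ := id hP
  have mem : ∀ {w}, (w ∈ A ∨ w = u ∨ w = v ∨ w = v) → w ∈ A ∨ w ∈ B := by
    rintro w (hw | rfl | rfl | rfl)
    exacts [Or.inl hw, Or.inr hu, Or.inr hv, Or.inr hv]
  have hAA : ¬ (q ∈ A ∧ r ∈ A) := by
    rintro ⟨hqA, hrA⟩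
    refine h.freeA p q r s ?_ hqA hrA ?_ hP
    · exact (mem hp).resolve_right fun hpB => h.not_adj_adj hpB hqA hrA e1 e2
    · exact (mem hs).resolve_right fun hsB => h.not_adj_adj hsB hrA hqA e3.symm e2.symm
  -- a vertex of `B` at `q` or `r` next to a vertex of `A`
  have first : ∀ {p q r s : V}, IsP4 G p q r s → (p ∈ A ∨ p = u ∨ p = v ∨ p = v) → q ∈ A →
      (r = u ∨ r = v) → (s ∈ A ∨ s = u ∨ s = v ∨ s = v) →
      (r = u ∧ p = v ∧ s ∈ A) ∨ (r = v ∧ p = u ∧ s ∈ A) := by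
    intro p q r s hP hp hq hr hs
    have hrB : r ∈ B := by rcases hr with rfl | rfl <;> assumption
    have hpB := h.nbr_mem hrB hq hP.2.1 hP.1.symm (mem hp)
    have hpA : p ∉ A := fun hpA => h.disj p hpA hpB
    have n3 := hP.2.2.1.ne
    have n4 := hP.2.2.2.1
    have n5 := hP.2.2.2.2.1
    have hp' : p = u ∨ p = v := by simpa using hp.resolve_left hpA
    rcases hr with rfl | rfl
    · obtain rfl := hp'.resolve_left n4
      refine Or.inl ⟨rfl, rfl, ?_⟩
      simpa [n3.symm, n5.symm] using hs
    · obtain rfl := hp'.resolve_right n4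
      refine Or.inr ⟨rfl, rfl, ?_⟩
      simpa [n3.symm, n5.symm] using hs
  by_cases hqA : q ∈ A
  · have hrB : r = u ∨ r = v := by simpa using hr.resolve_left fun hrA => hAA ⟨hqA, hrA⟩
    rcases first hP hp hqA hrB hs with ⟨rfl, rfl, hsA⟩ | ⟨rfl, rfl, hsA⟩
    · exact ⟨s, hsA, q, hqA, n3.symm, Or.inl ⟨e3, e2.symm, e1⟩⟩
    · exact ⟨s, hsA, q, hqA, n3.symm, Or.inr (Or.inl ⟨e3, e2.symm, e1⟩)⟩
  · have hqB : q = u ∨ q = v := by simpa using hq.resolve_left hqA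
    by_cases hrA : r ∈ A
    · rcases first hP.reverse hs hrA hqB hp with ⟨rfl, rfl, hpA⟩ | ⟨rfl, rfl, hpA⟩
      · exact ⟨p, hpA, r, hrA, n1, Or.inl ⟨e1.symm, e2, e3.symm⟩⟩
      · exact ⟨p, hpA, r, hrA, n1, Or.inr (Or.inl ⟨e1.symm, e2, e3.symm⟩)⟩
    · have hrB : r = u ∨ r = v := by simpa using hr.resolve_left hrA
      have m1 := e1.ne
      have m2 := e2.ne
      have m3 := e3.ne
      rcases hqB with rfl | rfl
      · obtain rfl : r = v := hrB.resolve_left m2.symm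
        have hpA : p ∈ A := by simpa [m1, n1] using hp
        have hsA : s ∈ A := by simpa [m3.symm, n3.symm] using hs
        exact ⟨p, hpA, s, hsA, n2, Or.inr (Or.inr ⟨e2, e1.symm, e3⟩)⟩
      · obtain rfl : r = u := hrB.resolve_right m2.symm
        have hpA : p ∈ A := by simpa [m1, n1] using hp
        have hsA : s ∈ A := by simpa [m3.symm, n3.symm] using hs
        exact ⟨s, hsA, p, hpA, n2.symm, Or.inr (Or.inr ⟨e2.symm, e3, e1.symm⟩)⟩

theorem pair_nbr {u v : V} (hu : u ∈ B) (hv : v ∈ B) (hc : Conf G A u v v) :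
    (∃ a ∈ A, G.Adj u a) ∧ ∃ a ∈ A, G.Adj v a := by
  obtain ⟨a, ha, a', ha', -, h1 | h1 | h1⟩ := h.pair_path hu hv hc
  · exact ⟨⟨a, ha, h1.1⟩, a', ha', h1.2.2⟩
  · exact ⟨⟨a', ha', h1.2.2⟩, a, ha, h1.1⟩
  · exact ⟨⟨a, ha, h1.2.1⟩, a', ha', h1.2.2⟩

/-- There is a conflict through `z` that avoids `t`. -/
theorem avoid_path {z t : V} (hz : z ∈ B) (ht : t ∈ B) :
    ∃ p q, Ess G A B z p q ∧ p ≠ t ∧ q ≠ t ∧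
      ((∃ a b c, IsP4 G z a b c ∧ (a ∈ A ∨ a = p ∨ a = q) ∧ (b ∈ A ∨ b = p ∨ b = q) ∧
        (c ∈ A ∨ c = p ∨ c = q)) ∨
      (∃ a b c, IsP4 G a z b c ∧ (a ∈ A ∨ a = p ∨ a = q) ∧ (b ∈ A ∨ b = p ∨ b = q) ∧
        (c ∈ A ∨ c = p ∨ c = q))) := by
  obtain ⟨p, q, hE, h1, h2⟩ := h.avoid z hz t ht
  exact ⟨p, q, hE, h1, h2, hE.path⟩

/-- Without a neighbor in A, every path through `z` would pass through `t`, so `t` would meet all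
essential conflicts of `z`. -/
theorem exists_nbr {z t : V} (hz : z ∈ B) (ht : t ∈ B) (hn : ∀ w ∈ B, G.Adj z w → w = t) :
    ∃ a ∈ A, G.Adj z a := by
  by_contra! hA
  obtain ⟨p, q, ⟨hp, hq, -⟩, hpt, hqt, ⟨a, b, c, hP, m, -⟩ | ⟨a, b, c, hP, m, -⟩⟩ :=
    h.avoid_path hz ht
  · rcases m with m | rfl | rfl
    · exact hA _ m hP.1
    · exact hpt (hn _ hp hP.1)
    · exact hqt (hn _ hq hP.1)
  · rcases m with m | rfl | rfl
    · exact hA _ m hP.1.symm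
    · exact hpt (hn _ hp hP.1.symm)
    · exact hqt (hn _ hq hP.1.symm)

/-- If the neighbors of `y` other than `x` are neighbors of `x`, then `x` can replace `y` on any
path that avoids `x`. -/
theorem dominates_of_nbrs {x y : V} (hx : x ∈ B)
    (hn : ∀ w, w ∈ A ∨ w ∈ B → G.Adj y w → w = x ∨ G.Adj x w) : Dominates G A B x y := by
  intro p q hE
  by_contra! hcon
  obtain ⟨hpx, hqx, hc⟩ := hcon
  have hp := hE.1
  have hq := hE.2.1
  have mem : ∀ {w}, (w ∈ A ∨ w = p ∨ w = q) → w ≠ x ∧ (w ∈ A ∨ w ∈ B) := by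
    rintro w (hw | rfl | rfl)
    · exact ⟨h.ne_of_mem hw hx, Or.inl hw⟩
    · exact ⟨hpx, Or.inr hp⟩
    · exact ⟨hqx, Or.inr hq⟩
  have adj : ∀ {w}, (w ∈ A ∨ w = p ∨ w = q) → G.Adj y w → G.Adj x w := fun hw hyw =>
    (hn _ (mem hw).2 hyw).resolve_left (mem hw).1
  rcases hE.path with ⟨a, b, c, ⟨e1, e2, e3, n1, n2, n3⟩, ma, mb, mc⟩ |
    ⟨a, b, c, ⟨e1, e2, e3, n1, n2, n3⟩, ma, mb, mc⟩
  · exact hc ⟨x, a, b, c, ⟨adj ma e1, e2, e3, (mem mb).1.symm, (mem mc).1.symm, n3⟩,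
      by simp, ma.imp_right Or.inr, mb.imp_right Or.inr, mc.imp_right Or.inr⟩
  · exact hc ⟨a, x, b, c, ⟨(adj ma e1.symm).symm, adj mb e2, e3, n1, n2, (mem mc).1.symm⟩,
      ma.imp_right Or.inr, by simp, mb.imp_right Or.inr, mc.imp_right Or.inr⟩

/-- Here `x` dominates `y`, so the branching rule leaves at most one `t` in a conflict with `x, y`.
An essential conflict of `y` avoiding `t` also avoids `x`, so its path runs `y, a, v, …`. Then `v,
a, x, y` is a 4-path, which forces `v = t`. -/
theorem not_pure {x y a : V} (hx : x ∈ B) (hy : y ∈ B) (hxy : G.Adj x y)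
    (hyB : ∀ w ∈ B, G.Adj y w → w = x) (ha : a ∈ A) (hxa : G.Adj x a) (hya : G.Adj y a)
    (hxA : ∀ w ∈ A, G.Adj x w → w = a) (hyA : ∀ w ∈ A, G.Adj y w → w = a) : False := by
  have hd : Dominates G A B x y := h.dominates_of_nbrs hx fun w hw hyw => by
    rcases hw with hw | hw
    · obtain rfl := hyA w hw hyw
      exact Or.inr hxa
    · exact Or.inl (hyB w hw hyw)
  -- When no such vertex exists, any member of B serves as `t`; `y` is chosen.
  obtain ⟨t, ht, huniq⟩ : ∃ t ∈ B, ∀ b ∈ B, Conf G A x y b → b = t := by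
    by_cases hb : ∃ b ∈ B, Conf G A x y b
    · obtain ⟨b, hb, hbc⟩ := hb
      exact ⟨b, hb, fun b' hb' hbc' => h.branch x hx y hy b' hb' b hb hd hbc' hbc⟩
    · exact ⟨y, hy, fun b hbB hbc => absurd ⟨b, hbB, hbc⟩ hb⟩
  obtain ⟨p, q, hE, hpt, hqt, hP⟩ := h.avoid_path hy ht
  obtain ⟨hp, hq, hpy, hqy, hc, -⟩ := hE
  by_cases hpx : p = x
  · subst hpx
    exact hqt (huniq q hq (hc.mono (by simp) (by simp) (by simp)))
  by_cases hqx : q = x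
  · subst hqx
    exact hpt (huniq p hp (hc.mono (by simp) (by simp) (by simp)))
  have nbr : ∀ {w}, (w ∈ A ∨ w = p ∨ w = q) → G.Adj y w → w = a := by
    rintro w (hw | rfl | rfl) hyw
    · exact hyA w hw hyw
    · exact absurd (hyB _ hp hyw) hpx
    · exact absurd (hyB _ hq hyw) hqx
  have mem : ∀ {w}, (w ∈ A ∨ w = p ∨ w = q) → w ∈ A ∨ w ∈ B := by
    rintro w (hw | rfl | rfl) <;> tauto
  rcases hP with ⟨u, v, w, hP, mu, mv, mw⟩ | ⟨u, v, w, hP, mu, mv, mw⟩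
  · obtain rfl := nbr mu hP.1
    have hv := h.nbr_mem hy ha hya.symm hP.2.1 (mem mv)
    have hvA : v ∉ A := fun hvA => h.disj v hvA hv
    have hvpq : v = p ∨ v = q := mv.resolve_left hvA
    have hvx : v ≠ x := by rcases hvpq with rfl | rfl <;> assumption
    have hvt : v ≠ t := by rcases hvpq with rfl | rfl <;> assumption
    exact hvt (huniq v hv ⟨v, u, x, y, ⟨hP.2.1.symm, hxa.symm, hxy, hvx, hP.2.2.2.1.symm,
      h.ne_of_mem ha hy⟩, by simp, Or.inl ha, by simp, by simp⟩)
  · exact hP.2.2.2.1 ((nbr mu hP.1.symm).trans (nbr mv hP.2.1).symm)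

/-- Different neighbors `a` of `x` and `a'` of `y` give the path `a, x, y, a'`. Otherwise `x` and
`y` share a single neighbor in A, which `not_pure` excludes. -/
theorem edge_pair {x y : V} (hx : x ∈ B) (hy : y ∈ B) (hxy : G.Adj x y)
    (hyB : ∀ w ∈ B, G.Adj y w → w = x) (hxA : ∃ a ∈ A, G.Adj x a) (hyA : ∃ a ∈ A, G.Adj y a) :
    Conf G A x y y := by
  by_contra hc
  have key : ∀ a ∈ A, ∀ a' ∈ A, G.Adj x a → G.Adj y a' → a = a' := by
    intro a ha a' ha' h1 h2
    by_contra hne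
    exact hc ⟨a, x, y, a', ⟨h1.symm, hxy, h2, h.ne_of_mem ha hy, hne, (h.ne_of_mem ha' hx).symm⟩,
      Or.inl ha, by simp, by simp, Or.inl ha'⟩
  obtain ⟨a, ha, h1⟩ := hxA
  obtain ⟨a', ha', h2⟩ := hyA
  obtain rfl := key a ha a' ha' h1 h2
  exact h.not_pure hx hy hxy hyB ha h1 h2 (fun w hw h3 => key w hw a ha h3 h2)
    (fun w hw h3 => (key a ha w hw h1 h3).symm)

/-! ### Triangles in B do not occur. -/

theorem triangle_nbr {x y z w : V} (hx : x ∈ B) (hy : y ∈ B) (hz : z ∈ B) (hw : w ∈ B)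
    (hxy : G.Adj x y) (hxz : G.Adj x z) (hyz : G.Adj y z) (hzw : G.Adj z w) : w = x ∨ w = y := by
  by_contra! hn
  exact h.freeB w z x y hw hz hx hy ⟨hzw.symm, hxz.symm, hxy, hn.1, hn.2, hyz.ne.symm⟩

/-- Two vertices of a triangle of `B` have a neighbor in `A`. -/
theorem triangle_one {x y z : V} (hx : x ∈ B) (hy : y ∈ B) (hz : z ∈ B)
    (hxy : G.Adj x y) (hxz : G.Adj x z) (hyz : G.Adj y z) :
    (∃ a ∈ A, G.Adj y a) ∨ ∃ a ∈ A, G.Adj z a := by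
  by_contra! hn
  obtain ⟨hyA, hzA⟩ := hn
  obtain ⟨p, q, ⟨hp, hq, -⟩, hpx, hqx, hP⟩ := h.avoid_path hz hx
  have nbr : ∀ {w}, (w ∈ A ∨ w = p ∨ w = q) → G.Adj z w → w = y := by
    rintro w (hw | rfl | rfl) hzw
    · exact absurd hzw (hzA w hw)
    · exact (h.triangle_nbr hx hy hz hp hxy hxz hyz hzw).resolve_left hpx
    · exact (h.triangle_nbr hx hy hz hq hxy hxz hyz hzw).resolve_left hqx
  have nbr' : ∀ {w}, (w ∈ A ∨ w = p ∨ w = q) → G.Adj y w → w = z := by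
    rintro w (hw | rfl | rfl) hyw
    · exact absurd hyw (hyA w hw)
    · exact (h.triangle_nbr hx hz hy hp hxz hxy hyz.symm hyw).resolve_left hpx
    · exact (h.triangle_nbr hx hz hy hq hxz hxy hyz.symm hyw).resolve_left hqx
  rcases hP with ⟨u, v, w, hP, mu, mv, mw⟩ | ⟨u, v, w, hP, mu, mv, mw⟩
  · obtain rfl := nbr mu hP.1
    exact hP.2.2.2.1 (nbr' mv hP.2.1).symm
  · exact hP.2.2.2.1 ((nbr mu hP.1.symm).trans (nbr mv hP.2.1).symm)

/-- If `a ≠ a'`, then `x, y` is a pair. Uniqueness of partners leaves `z` without a neighbor in A,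
so `x` dominates `z` and `y` is the only third vertex of a conflict with `x, z`. But an essential
conflict of `z` that avoids `y` must contain `x`. -/
theorem triangle_two {x y z a a' : V} (hx : x ∈ B) (hy : y ∈ B) (hz : z ∈ B)
    (hxy : G.Adj x y) (hxz : G.Adj x z) (hyz : G.Adj y z) (ha : a ∈ A) (ha' : a' ∈ A)
    (hxa : G.Adj x a) (hya : G.Adj y a') : a = a' := by
  by_contra hne
  have pair : ∀ {u v b b'}, u ∈ B → v ∈ B → b ∈ A → b' ∈ A → b ≠ b' → G.Adj u v → G.Adj u b →
      G.Adj v b' → Conf G A u v v := fun {u v b b'} hu hv hb hb' hn h1 h2 h3 =>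
    ⟨b, u, v, b', ⟨h2.symm, h1, h3, h.ne_of_mem hb hv, hn, (h.ne_of_mem hb' hu).symm⟩,
      Or.inl hb, by simp, by simp, Or.inl hb'⟩
  have hp := pair hx hy ha ha' hne hxy hxa hya
  have hp' := pair hy hx ha' ha (Ne.symm hne) hxy.symm hya hxa
  have hzA : ∀ w ∈ A, ¬ G.Adj z w := by
    intro w hw hzw
    by_cases hwa : w = a
    · subst hwa
      exact hxz.ne (h.pair_unique hy hx hz hp' (pair hy hz ha' hw (Ne.symm hne) hyz hya hzw))
    · exact hyz.ne (h.pair_unique hx hy hz hp (pair hx hz ha hw (Ne.symm hwa) hxz hxa hzw))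
  have hd : Dominates G A B x z := h.dominates_of_nbrs hx fun w hw hzw => by
    rcases hw with hw | hw
    · exact absurd hzw (hzA w hw)
    · rcases h.triangle_nbr hx hy hz hw hxy hxz hyz hzw with rfl | rfl
      · exact Or.inl rfl
      · exact Or.inr hxy
  have hxzy : Conf G A x z y := hp.mono (by simp) (by simp) (by simp)
  obtain ⟨p, q, ⟨hpB, hqB, -, -, hc, -⟩, hpy, hqy, hP⟩ := h.avoid_path hz hy
  have nbr : ∀ {w}, (w ∈ A ∨ w = p ∨ w = q) → G.Adj z w → p = x ∨ q = x := by
    rintro w (hw | rfl | rfl) hzw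
    · exact absurd hzw (hzA w hw)
    · exact Or.inl ((h.triangle_nbr hx hy hz hpB hxy hxz hyz hzw).resolve_right hpy)
    · exact Or.inr ((h.triangle_nbr hx hy hz hqB hxy hxz hyz hzw).resolve_right hqy)
  have hpq : p = x ∨ q = x := by
    rcases hP with ⟨u, v, w, hP, mu, mv, mw⟩ | ⟨u, v, w, hP, mu, mv, mw⟩
    · exact nbr mu hP.1
    · exact nbr mv hP.2.1
  rcases hpq with rfl | rfl
  · exact hqy (h.branch _ hx z hz q hqB y hy hd (hc.mono (by simp) (by simp) (by simp)) hxzy)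
  · exact hpy (h.branch _ hx z hz p hpB y hy hd (hc.mono (by simp) (by simp) (by simp)) hxzy)

/-- Again `x` dominates `z`, and `y` is the only third vertex of a conflict with `x, z`. A conflict
of `z` avoiding `y` has to leave the triangle through `a` to some `v` in B, and then `v, a, x, z`
contradicts this uniqueness. -/
theorem triangle_three {x y z a : V} (hx : x ∈ B) (hy : y ∈ B) (hz : z ∈ B)
    (hxy : G.Adj x y) (hxz : G.Adj x z) (hyz : G.Adj y z) (ha : a ∈ A)
    (hxa : G.Adj x a) (hya : G.Adj y a) : False := by
  have hzA : ∀ w ∈ A, G.Adj z w → w = a := fun w hw hzw =>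
    h.triangle_two hz hx hy hxz.symm hyz.symm hxy hw ha hzw hxa
  have hd : Dominates G A B x z := h.dominates_of_nbrs hx fun w hw hzw => by
    rcases hw with hw | hw
    · obtain rfl := hzA w hw hzw
      exact Or.inr hxa
    · rcases h.triangle_nbr hx hy hz hw hxy hxz hyz hzw with rfl | rfl
      · exact Or.inl rfl
      · exact Or.inr hxy
  have hxzy : Conf G A x z y := ⟨a, y, z, x, ⟨hya.symm, hyz, hxz.symm, h.ne_of_mem ha hz,
    h.ne_of_mem ha hx, hxy.ne.symm⟩, Or.inl ha, by simp, by simp, by simp⟩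
  obtain ⟨p, q, ⟨hpB, hqB, hpz, hqz, hc, -⟩, hpy, hqy, hP⟩ := h.avoid_path hz hy
  have uniq : ∀ b ∈ B, Conf G A x z b → b = y := fun b hb hb' =>
    h.branch _ hx z hz b hb y hy hd hb' hxzy
  by_cases hpx : p = x
  · subst hpx
    exact hqy (uniq q hqB (hc.mono (by simp) (by simp) (by simp)))
  by_cases hqx : q = x
  · subst hqx
    exact hpy (uniq p hpB (hc.mono (by simp) (by simp) (by simp)))
  have nbr : ∀ {w}, (w ∈ A ∨ w = p ∨ w = q) → G.Adj z w → w = a := by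
    rintro w (hw | rfl | rfl) hzw
    · exact hzA w hw hzw
    · rcases h.triangle_nbr hx hy hz hpB hxy hxz hyz hzw with h1 | h1
      · exact absurd h1 hpx
      · exact absurd h1 hpy
    · rcases h.triangle_nbr hx hy hz hqB hxy hxz hyz hzw with h1 | h1
      · exact absurd h1 hqx
      · exact absurd h1 hqy
  rcases hP with ⟨u, v, w, hP, mu, mv, mw⟩ | ⟨u, v, w, hP, mu, mv, mw⟩
  · obtain rfl := nbr mu hP.1
    have mv' : v ∈ A ∨ v ∈ B := by
      rcases mv with h1 | rfl | rfl
      exacts [Or.inl h1, Or.inr hpB, Or.inr hqB]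
    have hv := h.nbr_mem hz ha hP.1.symm hP.2.1 mv'
    have hvpq : v = p ∨ v = q := mv.resolve_left fun hvA => h.disj v hvA hv
    have hvx : v ≠ x := by rcases hvpq with rfl | rfl <;> assumption
    have hvy : v ≠ y := by rcases hvpq with rfl | rfl <;> assumption
    exact hvy (uniq v hv ⟨v, u, x, z, ⟨hP.2.1.symm, hxa.symm, hxz, hvx, hP.2.2.2.1.symm,
      h.ne_of_mem ha hz⟩, by simp, Or.inl ha, by simp, by simp⟩)
  · exact hP.2.2.2.1 ((nbr mu hP.1.symm).trans (nbr mv hP.2.1).symm)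

/-- By `triangle_one`, no two vertices of a triangle can both lack a neighbor in A, so two of them
have one. The two preceding lemmas exclude this. -/
theorem no_triangle {x y z : V} (hx : x ∈ B) (hy : y ∈ B) (hz : z ∈ B)
    (hxy : G.Adj x y) (hxz : G.Adj x z) (hyz : G.Adj y z) : False := by
  have key : ∀ {x y z : V}, x ∈ B → y ∈ B → z ∈ B → G.Adj x y → G.Adj x z → G.Adj y z →
      (∃ a ∈ A, G.Adj x a) → (∃ a ∈ A, G.Adj y a) → False := by
    rintro x y z hx hy hz hxy hxz hyz ⟨a, ha, hxa⟩ ⟨a', ha', hya⟩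
    obtain rfl := h.triangle_two hx hy hz hxy hxz hyz ha ha' hxa hya
    exact h.triangle_three hx hy hz hxy hxz hyz ha hxa hya
  have o1 := h.triangle_one hx hy hz hxy hxz hyz
  have o2 := h.triangle_one hy hx hz hxy.symm hyz hxz
  have o3 := h.triangle_one hz hx hy hxz.symm hyz.symm hxy
  have k1 := key hx hy hz hxy hxz hyz
  have k2 := key hx hz hy hxz hxy hyz.symm
  have k3 := key hy hz hx hyz hxy.symm hxz.symm
  rcases o1 with o1 | o1
  · rcases o2 with o2 | o2
    · exact k1 o2 o1
    · exact k3 o1 o2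
  · rcases o3 with o3 | o3
    · exact k2 o3 o1
    · exact k3 o3 o1

/-- The neighbors of a center are leaves. -/
theorem leaf_of_center {c l w : V} (hc : c ∈ B) (hC : Center G B c) (hl : l ∈ B)
    (hcl : G.Adj c l) (hw : w ∈ B) (hlw : G.Adj l w) : w = c := by
  by_contra hwc
  obtain ⟨y, hy, z, hz, hyz, hcy, hcz⟩ := hC
  obtain ⟨l', hl', hl'l, hcl'⟩ : ∃ l' ∈ B, l' ≠ l ∧ G.Adj c l' := by
    by_cases hyl : y = l
    · exact ⟨z, hz, by rintro rfl; exact hyz hyl, hcz⟩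
    · exact ⟨y, hy, hyl, hcy⟩
  by_cases hwl' : w = l'
  · subst hwl'
    exact h.no_triangle hc hl hw hcl hcl' hlw
  · exact h.freeB w l c l' hw hl hc hl' ⟨hlw.symm, hcl.symm, hcl', hwc, hwl', hl'l.symm⟩

theorem leaf_nbr {c l : V} (hc : c ∈ B) (hC : Center G B c) (hl : l ∈ B) (hcl : G.Adj c l) :
    ∃ a ∈ A, G.Adj l a :=
  h.exists_nbr hl hc fun _ hw hlw => h.leaf_of_center hc hC hl hcl hw hlw

/-- A neighbor of `c` in A would make every leaf a partner of `c` by `edge_pair`, while partners are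
unique. -/
theorem center_not_adj {c a : V} (hc : c ∈ B) (hC : Center G B c) (ha : a ∈ A) :
    ¬ G.Adj c a := by
  intro hca
  have pair : ∀ l ∈ B, G.Adj c l → Conf G A c l l := fun l hl hcl =>
    h.edge_pair hc hl hcl (fun _ hw hlw => h.leaf_of_center hc hC hl hcl hw hlw) ⟨a, ha, hca⟩
      (h.leaf_nbr hc hC hl hcl)
  obtain ⟨y, hy, z, hz, hyz, hcy, hcz⟩ := id hC
  exact hyz (h.pair_unique hc hy hz (pair y hy hcy) (pair z hz hcz))

/-- An edge without a center is a whole component of B. Both its ends then have neighbors in A, so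
it is a pair. -/
theorem edge_cases {q r : V} (hq : q ∈ B) (hr : r ∈ B) (hqr : G.Adj q r) :
    Center G B q ∨ Center G B r ∨ Conf G A q r r := by
  by_cases hCq : Center G B q
  · exact Or.inl hCq
  by_cases hCr : Center G B r
  · exact Or.inr (Or.inl hCr)
  have h1 : ∀ w ∈ B, G.Adj q w → w = r := fun w hw hqw => by
    by_contra hne
    exact hCq ⟨w, hw, r, hr, hne, hqw, hqr⟩
  have h2 : ∀ w ∈ B, G.Adj r w → w = q := fun w hw hqw => by
    by_contra hne
    exact hCr ⟨w, hw, q, hq, hne, hqw, hqr.symm⟩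
  exact Or.inr (Or.inr (h.edge_pair hq hr hqr h2 (h.exists_nbr hq hr h1) (h.exists_nbr hr hq h2)))

/-- Deleting all centers and one vertex of each pair is enough. -/
theorem sol_of_centers {S : Finset V} (hC : ∀ c ∈ B, Center G B c → c ∈ S)
    (hp : ∀ u ∈ B, ∀ v ∈ B, v ≠ u → Conf G A u v v → u ∈ S ∨ v ∈ S) : Sol G A B S := by
  intro p q r s mp mq mr ms hP
  simp only [Set.mem_ofPred_eq] at mp mq mr ms
  have mem : ∀ {w}, (w ∈ A ∨ (w ∈ B ∧ w ∉ S)) → w ∈ A ∨ w ∈ B := fun hw => hw.imp_right And.left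
  have notS : ∀ {w}, (w ∈ A ∨ (w ∈ B ∧ w ∉ S)) → w ∈ B → w ∉ S := fun {w} hw hwB =>
    (hw.resolve_left fun hwA => h.disj w hwA hwB).2
  have edge : ∀ {w w'}, w ∈ B → w' ∈ B → w ∉ S → w' ∉ S → ¬ G.Adj w w' := by
    intro w w' hw hw' hwS hwS' hadj
    rcases h.edge_cases hw hw' hadj with h1 | h1 | h1
    · exact hwS (hC w hw h1)
    · exact hwS' (hC w' hw' h1)
    · exact (hp w hw w' hw' hadj.ne.symm h1).elim hwS hwS'
  -- No edge inside B survives the deletion. A surviving path that starts in B therefore alternates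
  -- between B and A, so its two vertices of B form a pair.
  have alt : ∀ {p q r s}, (q ∈ A ∨ (q ∈ B ∧ q ∉ S)) → (r ∈ A ∨ (r ∈ B ∧ r ∉ S)) →
      (s ∈ A ∨ (s ∈ B ∧ s ∉ S)) → IsP4 G p q r s → p ∈ B → p ∉ S → False := by
    intro p q r s mq mr ms hP hpB hpS
    have hq : q ∈ A := mq.resolve_right fun hq => edge hpB hq.1 hpS hq.2 hP.1
    have hr : r ∈ B := h.nbr_mem hpB hq hP.1.symm hP.2.1 (mem mr)
    have hrS := notS mr hr
    have hs : s ∈ A := ms.resolve_right fun hs => edge hr hs.1 hrS hs.2 hP.2.2.1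
    refine (hp p hpB r hr hP.2.2.2.1.symm ⟨p, q, r, s, hP, by simp, Or.inl hq, by simp,
      Or.inl hs⟩).elim hpS hrS
  have hpA : p ∈ A := mp.resolve_right fun hp => alt mq mr ms hP hp.1 hp.2
  have hsA : s ∈ A := ms.resolve_right fun hs => alt mr mq mp hP.reverse hs.1 hs.2
  by_cases hqA : q ∈ A
  · have hrA : r ∈ A := (mem mr).resolve_right fun hr =>
      h.disj p hpA (h.nbr_mem hr hqA hP.2.1 hP.1.symm (Or.inl hpA))
    exact h.freeA p q r s hpA hqA hrA hsA hP
  · have hq := mq.resolve_left hqA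
    have hrA : r ∈ A := mr.resolve_right fun hr => edge hq.1 hr.1 hq.2 hr.2 hP.2.1
    exact h.disj s hsA (h.nbr_mem hq.1 hrA hP.2.1.symm hP.2.2.1 (Or.inl hsA))

end Irreducible

end FourPath

/-! ### Pairs and stars in irreducible instances. -/

namespace FourPath

variable {V : Type*} {G : SimpleGraph V} {A B : Set V}

namespace Irreducible

variable (h : Irreducible G A B)
include h

theorem pair_symm {u v : V} (hu : u ∈ B) (hv : v ∈ B) (hc : Conf G A u v v) :
    Conf G A v u u := by
  obtain ⟨a, ha, a', ha', hne, ⟨h1, h2, h3⟩ | ⟨h1, h2, h3⟩ | ⟨h1, h2, h3⟩⟩ := h.pair_path hu hv hc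
  · by_cases huv : u = v
    · subst huv; exact hc
    exact ⟨a, u, a', v, ⟨h1.symm, h2, h3.symm, hne, h.ne_of_mem ha hv, huv⟩, Or.inl ha, by simp,
      Or.inl ha', by simp⟩
  · by_cases huv : u = v
    · subst huv; exact hc
    exact ⟨a, v, a', u, ⟨h1.symm, h2, h3.symm, hne, h.ne_of_mem ha hu, Ne.symm huv⟩, Or.inl ha,
      by simp, Or.inl ha', by simp⟩
  · exact ⟨a, u, v, a', ⟨h2.symm, h1, h3, h.ne_of_mem ha hv, hne, (h.ne_of_mem ha' hu).symm⟩,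
      Or.inl ha, by simp, by simp, Or.inl ha'⟩

/-- The neighborhoods in `A` of a non-adjacent pair are private. -/
theorem pair_private {u v α b : V} (hu : u ∈ B) (hv : v ∈ B) (hc : Conf G A u v v)
    (hadj : ¬ G.Adj u v) (hα : α ∈ A) (huα : G.Adj u α ∨ G.Adj v α) (hb : b ∈ B)
    (hbα : G.Adj b α) : b = u ∨ b = v := by
  have key : ∀ {u v a a'}, u ∈ B → v ∈ B → Conf G A u v v → Conf G A v u u → a ∈ A → a' ∈ A →
      -- Another neighbor `b` of `α` in B would be a second partner: `β, w, α, b` is a 4-path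
      -- whenever `w` in the pair is adjacent to `α` and to some further `β` in A.
      a ≠ a' → G.Adj u a → G.Adj u a' → G.Adj v a' → (G.Adj u α ∨ G.Adj v α) → b = u ∨ b = v := by
    intro u v a a' hu hv huv hvu ha ha' hne h1 h2 h3 hα'
    have step : ∀ {w β}, w ∈ B → β ∈ A → β ≠ α → G.Adj w β → G.Adj w α → b ≠ w →
        Conf G A w b b := fun {w β} hw hβ hβα h1 h2 hbw =>
      ⟨β, w, α, b, ⟨h1.symm, h2, hbα.symm, hβα, h.ne_of_mem hβ hb, hbw.symm⟩, Or.inl hβ, by simp,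
        Or.inl hα, by simp⟩
    by_contra! hn
    by_cases huα : G.Adj u α
    · obtain ⟨β, hβ, hβα, huβ⟩ : ∃ β ∈ A, β ≠ α ∧ G.Adj u β := by
        by_cases haα : a = α
        · subst haα; exact ⟨a', ha', hne.symm, h2⟩
        · exact ⟨a, ha, haα, h1⟩
      exact hn.2 (h.pair_unique hu hb hv (step hu hβ hβα huβ huα hn.1) huv)
    · have hvα := hα'.resolve_left huα
      have hne' : a' ≠ α := by rintro rfl; exact huα h2
      exact hn.1 (h.pair_unique hv hb hu (step hv ha' hne' h3 hvα hn.2) hvu)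
  have hc' := h.pair_symm hu hv hc
  obtain ⟨a, ha, a', ha', hne, ⟨h1, h2, h3⟩ | ⟨h1, h2, h3⟩ | ⟨h1, h2, h3⟩⟩ := h.pair_path hu hv hc
  · exact key hu hv hc hc' ha ha' hne h1 h2 h3 huα
  · exact (key hv hu hc' hc ha ha' hne h1 h2 h3 huα.symm).symm
  · exact absurd h1 hadj

section Leaf

variable {c u v : V} (hc : c ∈ B) (hC : Center G B c) (hu : u ∈ B) (hcu : G.Adj c u)
include hc hC hu hcu

theorem leaf_conf {l : V} (hl : l ∈ B) (hcl : G.Adj c l) (hlu : l ≠ u) : Conf G A c u l := by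
  obtain ⟨α, hα, huα⟩ := h.leaf_nbr hc hC hu hcu
  exact ⟨α, u, c, l, ⟨huα.symm, hcu.symm, hcl, h.ne_of_mem hα hc, h.ne_of_mem hα hl, hlu.symm⟩,
    Or.inl hα, by simp, by simp, by simp⟩

/-- An essential conflict of `u` that avoids `c` can leave `u` only through A, and the next vertex
of its path lies in B again. -/
theorem exists_external : ∃ α ∈ A, ∃ b ∈ B, G.Adj u α ∧ G.Adj b α ∧ b ≠ u := by
  obtain ⟨p, q, ⟨hp, hq, -⟩, hpc, hqc, hP⟩ := h.avoid_path hu hc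
  have mem : ∀ {w}, (w ∈ A ∨ w = p ∨ w = q) → w ∈ A ∨ w ∈ B := by
    rintro w (hw | rfl | rfl)
    exacts [Or.inl hw, Or.inr hp, Or.inr hq]
  have nbr : ∀ {w}, (w ∈ A ∨ w = p ∨ w = q) → G.Adj u w → w ∈ A := by
    rintro w (hw | rfl | rfl) huw
    · exact hw
    · exact absurd (h.leaf_of_center hc hC hu hcu hp huw) hpc
    · exact absurd (h.leaf_of_center hc hC hu hcu hq huw) hqc
  rcases hP with ⟨x, y, z, hP, mx, my, mz⟩ | ⟨x, y, z, hP, mx, my, mz⟩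
  · have hx := nbr mx hP.1
    exact ⟨x, hx, y, h.nbr_mem hu hx hP.1.symm hP.2.1 (mem my), hP.1, hP.2.1.symm,
      hP.2.2.2.1.symm⟩
  · have hy := nbr my hP.2.1
    exact ⟨y, hy, z, h.nbr_mem hu hy hP.2.1.symm hP.2.2.1 (mem mz), hP.2.1, hP.2.2.1.symm,
      hP.2.2.2.2.2.symm⟩

variable (hv : v ∈ B) (hp : Conf G A u v v)
include hv hp

theorem partner_ne_center : v ≠ c := by
  rintro rfl
  obtain ⟨-, a, ha, hva⟩ := h.pair_nbr hu hv hp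
  exact h.center_not_adj hc hC ha hva

theorem partner_not_adj : ¬ G.Adj u v := fun huv =>
  h.partner_ne_center hc hC hu hcu hv hp (h.leaf_of_center hc hC hu hcu hv huv)

/-- A path leaves the leaf `u` either through A, where its neighbors are private to the pair and
lead only to `v`, or through `c`, which has no neighbor in A and so leads to another leaf. -/
theorem ess_of_paired {p q : V} (hE : Ess G A B u p q) :
    p = v ∨ q = v ∨ ((p = c ∨ q = c) ∧ ∃ l ∈ B, G.Adj c l ∧ l ≠ u ∧ (p = l ∨ q = l)) := by
  have hpB := hE.1
  have hqB := hE.2.1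
  have mem : ∀ {w}, (w ∈ A ∨ w = p ∨ w = q) → w ∈ A ∨ w ∈ B := by
    rintro w (hw | rfl | rfl)
    exacts [Or.inl hw, Or.inr hpB, Or.inr hqB]
  have inpq : ∀ {w}, (w ∈ A ∨ w = p ∨ w = q) → w ∈ B → p = w ∨ q = w := fun {w} hw hwB =>
    (hw.resolve_left fun hwA => h.disj w hwA hwB).imp Eq.symm Eq.symm
  have viaA : ∀ {x y}, (y ∈ A ∨ y = p ∨ y = q) → x ∈ A → G.Adj u x → G.Adj x y → u ≠ y →
      p = v ∨ q = v := by
    intro x y my hx h1 h2 hne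
    have hy := h.nbr_mem hu hx h1.symm h2 (mem my)
    rcases h.pair_private hu hv hp (h.partner_not_adj hc hC hu hcu hv hp) hx (Or.inl h1) hy
      h2.symm with h3 | h3
    · exact absurd h3.symm hne
    · subst h3; exact inpq my hy
  have viaB : ∀ {x y}, (x ∈ A ∨ x = p ∨ x = q) → (y ∈ A ∨ y = p ∨ y = q) → x ∉ A → G.Adj u x →
      G.Adj x y → u ≠ y → ((p = c ∨ q = c) ∧ ∃ l ∈ B, G.Adj c l ∧ l ≠ u ∧ (p = l ∨ q = l)) := by
    intro x y mx my hx h1 h2 hne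
    have hxB := (mem mx).resolve_left hx
    obtain rfl := h.leaf_of_center hc hC hu hcu hxB h1
    have hyB : y ∈ B := (mem my).resolve_left fun hy => h.center_not_adj hc hC hy h2
    exact ⟨inpq mx hxB, y, hyB, h2, hne.symm, inpq my hyB⟩
  rw [← or_assoc]
  rcases hE.path with ⟨x, y, z, hP, mx, my, mz⟩ | ⟨x, y, z, hP, mx, my, mz⟩
  · by_cases hx : x ∈ A
    · exact Or.inl (viaA my hx hP.1 hP.2.1 hP.2.2.2.1)
    · exact Or.inr (viaB mx my hx hP.1 hP.2.1 hP.2.2.2.1)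
  · by_cases hy : y ∈ A
    · exact Or.inl (viaA mz hy hP.2.1 hP.2.2.1 hP.2.2.2.2.2)
    · exact Or.inr (viaB my mz hy hP.2.1 hP.2.2.1 hP.2.2.2.2.2)

theorem swap_of_paired : Swap G A B c u v := by
  intro p q hE
  rcases h.ess_of_paired hc hC hu hcu hv hp hE with h1 | h1 | ⟨h1 | h1, -⟩ <;> simp [h1]

/-- If both `u` and `v` were leaves of `c`, then `u` would dominate `v`: replace `v` by `u` in
conflicts through `c` and another leaf. The branching rule with `b₁ = u`, `b₂ = v` would then apply.
-/
theorem center_not_adj_partner (huv : u ≠ v) : ¬ G.Adj c v := by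
  intro hcv
  have hp' := h.pair_symm hu hv hp
  have hd : Dominates G A B u v := by
    intro p q hE
    rcases h.ess_of_paired hc hC hv hcv hu hp' hE with h1 | h1 | ⟨h1, l, hl, hcl, hlv, h2⟩
    · exact Or.inl h1
    · exact Or.inr (Or.inl h1)
    · by_cases hlu : l = u
      · subst hlu; exact h2.imp id Or.inl
      · have hlc : l ≠ c := hcl.ne.symm
        have hcon := h.leaf_conf hc hC hu hcu hl hcl hlu
        refine Or.inr (Or.inr (hcon.mono ?_ (by simp) ?_))
        · rcases h1 with rfl | rfl <;> simp
        · rcases h2 with rfl | rfl <;> simp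
  have hb : ∀ b, Conf G A u v b := fun b => hp.mono (by simp) (by simp) (by simp)
  exact huv (h.branch u hu v hv u hu v hv hd (hb u) (hb v))

/-- If `u` and `l` were the only leaves, a conflict of `c` avoiding `l` would run through `u` and,
by privacy, on to `v`. It contains the pair `u, v`, so it is not essential. -/
theorem exists_third {l : V} (hl : l ∈ B) (hlu : l ≠ u) (hcl : G.Adj c l) (huv : u ≠ v) :
    ∃ l' ∈ B, G.Adj c l' ∧ l' ≠ u ∧ l' ≠ l := by
  by_contra! hn
  obtain ⟨p, q, ⟨hpB, hqB, hpc, hqc, -, hpq⟩, hpl, hql, hP⟩ := h.avoid_path hc hl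
  have mem : ∀ {w}, (w ∈ A ∨ w = p ∨ w = q) → w ∈ A ∨ w ∈ B := by
    rintro w (hw | rfl | rfl)
    exacts [Or.inl hw, Or.inr hpB, Or.inr hqB]
  have inpq : ∀ {w}, (w ∈ A ∨ w = p ∨ w = q) → w ∈ B → w = p ∨ w = q := fun {w} hw hwB =>
    hw.resolve_left fun hwA => h.disj w hwA hwB
  have nbr : ∀ {w}, (w ∈ A ∨ w = p ∨ w = q) → G.Adj c w → w = u := by
    intro w mw hcw
    have hwB := (mem mw).resolve_left fun hw => h.center_not_adj hc hC hw hcw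
    by_contra hwu
    have hwl := hn w hwB hcw hwu
    subst hwl
    rcases inpq mw hwB with rfl | rfl
    · exact hpl rfl
    · exact hql rfl
  rcases hP with ⟨x, y, z, hP, mx, my, mz⟩ | ⟨x, y, z, hP, mx, my, mz⟩
  · obtain rfl := nbr mx hP.1
    have hyA : y ∈ A := by
      by_contra hyA
      exact hP.2.2.2.1 (h.leaf_of_center hc hC hu hcu ((mem my).resolve_left hyA) hP.2.1).symm
    have hzB := h.nbr_mem hu hyA hP.2.1.symm hP.2.2.1 (mem mz)
    have hzv : z = v := (h.pair_private hu hv hp (h.partner_not_adj hc hC hu hcu hv hp) hyA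
      (Or.inl hP.2.1) hzB hP.2.2.1.symm).resolve_left hP.2.2.2.2.2.symm
    subst hzv
    apply hpq
    rcases inpq mx hu with rfl | rfl <;> rcases inpq mz hzB with rfl | rfl
    · exact absurd rfl huv
    · exact hp.mono (by simp) (by simp) (by simp)
    · exact hp.mono (by simp) (by simp) (by simp)
    · exact absurd rfl huv
  · exact hP.2.2.2.1 ((nbr mx hP.1.symm).trans (nbr my hP.2.1).symm)

end Leaf

/-! ### Paired and unpaired leaves of a star. -/

theorem not_three_paired {c u₁ u₂ u₃ : V} (hc : c ∈ B) (hC : Center G B c)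
    (hu₁ : u₁ ∈ B) (hu₂ : u₂ ∈ B) (hu₃ : u₃ ∈ B) (h₁ : G.Adj c u₁) (h₂ : G.Adj c u₂)
    (h₃ : G.Adj c u₃) (h₁₂ : u₁ ≠ u₂) (h₁₃ : u₁ ≠ u₃) (h₂₃ : u₂ ≠ u₃)
    (p₁ : Paired G A B u₁) (p₂ : Paired G A B u₂) (p₃ : Paired G A B u₃) : False := by
  obtain ⟨v₁, hv₁, n₁, p₁⟩ := p₁
  obtain ⟨v₂, hv₂, n₂, p₂⟩ := p₂
  obtain ⟨v₃, hv₃, n₃, p₃⟩ := p₃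
  have a₁ := h.center_not_adj_partner hc hC hu₁ h₁ hv₁ p₁ n₁.symm
  have a₂ := h.center_not_adj_partner hc hC hu₂ h₂ hv₂ p₂ n₂.symm
  have a₃ := h.center_not_adj_partner hc hC hu₃ h₃ hv₃ p₃ n₃.symm
  have c₁ := h.partner_ne_center hc hC hu₁ h₁ hv₁ p₁
  have c₂ := h.partner_ne_center hc hC hu₂ h₂ hv₂ p₂
  have c₃ := h.partner_ne_center hc hC hu₃ h₃ hv₃ p₃
  have ne : ∀ {u v}, G.Adj c u → ¬ G.Adj c v → u ≠ v := by
    rintro u v hu hv rfl; exact hv hu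
  have inj : ∀ {u u' v v'}, u ∈ B → u' ∈ B → v ∈ B → v' ∈ B → Conf G A u v v →
      Conf G A u' v' v' → u ≠ u' → v ≠ v' := by
    rintro u u' v v' hu hu' hv hv' h1 h2 hne rfl
    exact hne (h.pair_unique hv hu hu' (h.pair_symm hu hv h1) (h.pair_symm hu' hv h2))
  refine h.noThree c hc u₁ hu₁ u₂ hu₂ u₃ hu₃ v₁ hv₁ v₂ hv₂ v₃ hv₃ ⟨?_, p₁, p₂, p₃,
    h.leaf_conf hc hC hu₁ h₁ hu₂ h₂ h₁₂.symm, h.leaf_conf hc hC hu₁ h₁ hu₃ h₃ h₁₃.symm,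
    h.swap_of_paired hc hC hu₂ h₂ hv₂ p₂, h.swap_of_paired hc hC hu₃ h₃ hv₃ p₃⟩
  simp only [List.nodup_cons, List.mem_cons, List.not_mem_nil, or_false, not_or,
    not_false_eq_true, List.nodup_nil, and_true]
  exact ⟨⟨h₁.ne, h₂.ne, h₃.ne, c₁.symm, c₂.symm, c₃.symm⟩,
    ⟨h₁₂, h₁₃, ne h₁ a₁, ne h₁ a₂, ne h₁ a₃⟩, ⟨h₂₃, ne h₂ a₁, ne h₂ a₂, ne h₂ a₃⟩,
    ⟨ne h₃ a₁, ne h₃ a₂, ne h₃ a₃⟩, ⟨inj hu₁ hu₂ hv₁ hv₂ p₁ p₂ h₁₂, inj hu₁ hu₃ hv₁ hv₃ p₁ p₃ h₁₃⟩,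
    inj hu₂ hu₃ hv₂ hv₃ p₂ p₃ h₂₃⟩

theorem not_two_paired {c u₁ u₂ l : V} (hc : c ∈ B) (hC : Center G B c)
    (hu₁ : u₁ ∈ B) (hu₂ : u₂ ∈ B) (hl : l ∈ B) (h₁ : G.Adj c u₁) (h₂ : G.Adj c u₂)
    (h₃ : G.Adj c l) (h₁₂ : u₁ ≠ u₂) (h₁₃ : u₁ ≠ l) (h₂₃ : u₂ ≠ l)
    (p₁ : Paired G A B u₁) (p₂ : Paired G A B u₂)
    (hall : ∀ w ∈ B, G.Adj c w → w = u₁ ∨ w = u₂ ∨ w = l) : False := by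
  obtain ⟨v₁, hv₁, n₁, p₁⟩ := p₁
  obtain ⟨v₂, hv₂, n₂, p₂⟩ := p₂
  have a₁ := h.center_not_adj_partner hc hC hu₁ h₁ hv₁ p₁ n₁.symm
  have a₂ := h.center_not_adj_partner hc hC hu₂ h₂ hv₂ p₂ n₂.symm
  have c₁ := h.partner_ne_center hc hC hu₁ h₁ hv₁ p₁
  have c₂ := h.partner_ne_center hc hC hu₂ h₂ hv₂ p₂
  have ne : ∀ {u v}, G.Adj c u → ¬ G.Adj c v → u ≠ v := by
    rintro u v hu hv rfl; exact hv hu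
  have hv : v₁ ≠ v₂ := by
    rintro rfl
    exact h₁₂ (h.pair_unique hv₁ hu₁ hu₂ (h.pair_symm hu₁ hv₁ p₁) (h.pair_symm hu₂ hv₁ p₂))
  -- The third conflict through `c, l` required by the rule comes from the path `c, l, α, b` outside
  -- the star. Privacy of the pairs keeps `b` distinct from their members.
  obtain ⟨α, hα, b, hb, hlα, hbα, hbl⟩ := h.exists_external hc hC hl h₃
  have hbc : b ≠ c := by rintro rfl; exact h.center_not_adj hc hC hα hbα
  have hcb : Conf G A c l b := ⟨c, l, α, b, ⟨h₃, hlα, hbα.symm, (h.ne_of_mem hα hc).symm, hbc.symm,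
    hbl.symm⟩, by simp, by simp, Or.inl hα, by simp⟩
  have hb' : ∀ {u v}, u ∈ B → v ∈ B → G.Adj c u → ¬ G.Adj c v → u ≠ l → Conf G A u v v →
      b ≠ u ∧ b ≠ v := by
    intro u v hu hv hcu hcv hul huv
    have hadj := h.partner_not_adj hc hC hu hcu hv huv
    have hlv := ne h₃ hcv
    constructor
    · rintro rfl
      rcases h.pair_private hu hv huv hadj hα (Or.inl hbα) hl hlα with h1 | h1
      exacts [hul h1.symm, hlv h1]
    · rintro rfl
      rcases h.pair_private hu hv huv hadj hα (Or.inr hbα) hl hlα with h1 | h1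
      exacts [hul h1.symm, hlv h1]
  obtain ⟨b1, b2⟩ := hb' hu₁ hv₁ h₁ a₁ h₁₃ p₁
  obtain ⟨b3, b4⟩ := hb' hu₂ hv₂ h₂ a₂ h₂₃ p₂
  refine h.noTwo c hc u₁ hu₁ u₂ hu₂ l hl v₁ hv₁ v₂ hv₂ b hb ⟨?_, p₁, p₂,
    h.leaf_conf hc hC hl h₃ hu₁ h₁ h₁₃, h.leaf_conf hc hC hl h₃ hu₂ h₂ h₂₃, hcb,
    h.leaf_conf hc hC hu₁ h₁ hu₂ h₂ h₁₂.symm, h.swap_of_paired hc hC hu₁ h₁ hv₁ p₁, ?_⟩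
  · simp only [List.nodup_cons, List.mem_cons, List.not_mem_nil, or_false, not_or,
      not_false_eq_true, List.nodup_nil, and_true]
    exact ⟨⟨h₁.ne, h₂.ne, h₃.ne, c₁.symm, c₂.symm, hbc.symm⟩,
      ⟨h₁₂, h₁₃, ne h₁ a₁, ne h₁ a₂, b1.symm⟩, ⟨h₂₃, ne h₂ a₁, ne h₂ a₂, b3.symm⟩,
      ⟨ne h₃ a₁, ne h₃ a₂, hbl.symm⟩, ⟨hv, b2.symm⟩, b4.symm⟩
  · intro p q hE
    rcases h.ess_of_paired hc hC hu₂ h₂ hv₂ p₂ hE with h1 | h1 | ⟨h1, l', hl', hcl', hlu, h2⟩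
    · exact Or.inl h1
    · exact Or.inr (Or.inl h1)
    · refine Or.inr (Or.inr ⟨h1, ?_⟩)
      rcases hall l' hl' hcl' with rfl | rfl | rfl
      · rcases h2 with h2 | h2 <;> simp [h2]
      · exact absurd rfl hlu
      · rcases h2 with h2 | h2 <;> simp [h2]

/-- Otherwise at most one leaf is unpaired, so some leaf is paired and `exists_third` gives at least
three leaves. Then either three leaves are paired or the star has exactly two paired leaves and one
unpaired leaf, and each case triggers a rule. -/
theorem exists_unpaired {c : V} (hc : c ∈ B) (hC : Center G B c) :
    ∃ l ∈ B, ∃ l' ∈ B, l ≠ l' ∧ G.Adj c l ∧ G.Adj c l' ∧ ¬ Paired G A B l ∧ ¬ Paired G A B l' := by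
  by_contra! hn
  -- among two leaves one is paired
  have hone : ∀ l ∈ B, ∀ l' ∈ B, l ≠ l' → G.Adj c l → G.Adj c l' →
      Paired G A B l ∨ Paired G A B l' := fun l hl l' hl' hne h1 h2 => by
    by_contra! hnp
    exact hnp.2 (hn l hl l' hl' hne h1 h2 hnp.1)
  have third : ∀ u ∈ B, ∀ l ∈ B, G.Adj c u → G.Adj c l → u ≠ l → Paired G A B u → False := by
    intro u hu l hl hcu hcl hul hup
    obtain ⟨v, hv, hvu, huv⟩ := id hup
    obtain ⟨l', hl', hcl', hlu, hll⟩ := h.exists_third hc hC hu hcu hv huv hl hul.symm hcl hvu.symm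
    have key : ∀ x ∈ B, ∀ y ∈ B, G.Adj c x → G.Adj c y → x ≠ y → x ≠ u → y ≠ u →
        Paired G A B x → False := by
      intro x hx y hy hcx hcy hxy hxu hyu hxp
      have hyp : ∀ w ∈ B, G.Adj c w → w ≠ u → w ≠ x → ¬ Paired G A B w := fun w hw hcw h1 h2 h3 =>
        h.not_three_paired hc hC hu hx hw hcu hcx hcw hxu.symm h1.symm h2.symm hup hxp h3
      refine h.not_two_paired hc hC hu hx hy hcu hcx hcy hxu.symm hyu.symm hxy hup hxp ?_
      intro w hw hcw
      by_contra! hw'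
      rcases hone w hw y hy hw'.2.2 hcw hcy with h1 | h1
      · exact hyp w hw hcw hw'.1 hw'.2.1 h1
      · exact hyp y hy hcy hyu hxy.symm h1
    rcases hone l hl l' hl' hll.symm hcl hcl' with h1 | h1
    · exact key l hl l' hl' hcl hcl' hll.symm hul.symm hlu h1
    · exact key l' hl' l hl hcl' hcl hll hlu hul.symm h1
  obtain ⟨y, hy, z, hz, hyz, hcy, hcz⟩ := id hC
  rcases hone y hy z hz hyz hcy hcz with h1 | h1
  · exact third y hy z hz hcy hcz hyz h1
  · exact third z hz y hy hcz hcy hyz.symm h1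

/-- In an irreducible instance, each center and each paired vertex belongs to an optimal solution. -/
theorem exists_sol_mem [Fintype V] {S : Finset V} (hS : Sol G A B S) {x : V} (hx : x ∈ B)
    (hxF : Center G B x ∨ Paired G A B x) :
    ∃ S' : Finset V, Sol G A B S' ∧ S'.card ≤ S.card ∧ x ∈ S' := by
  classical
  set C : Finset V := Finset.univ.filter fun c => c ∈ B ∧ Center G B c with hCdef
  have memC : ∀ {c}, c ∈ C ↔ c ∈ B ∧ Center G B c := by simp [hCdef]
  set T : Finset V := S.filter fun u => Paired G A B u with hT
  have hnp : ∀ c ∈ B, Center G B c → ¬ Paired G A B c := by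
    rintro c hc hC ⟨v, hv, -, hcv⟩
    obtain ⟨⟨a, ha, hca⟩, -⟩ := h.pair_nbr hc hv hcv
    exact h.center_not_adj hc hC ha hca
  -- A center and two of its unpaired leaves form a conflict, so `S` pays for each star with an
  -- unpaired vertex. Stars are disjoint, so there are at most as many centers as unpaired vertices
  -- in `S`.
  have hex : ∀ c ∈ C, ∃ e, e ∈ S ∧ ¬ Paired G A B e ∧ e ∈ B ∧ (e = c ∨ G.Adj c e) := by
    intro c hcC
    obtain ⟨hc, hC⟩ := memC.1 hcC
    obtain ⟨l, hl, l', hl', hne, hcl, hcl', hlp, hlp'⟩ := h.exists_unpaired hc hC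
    rcases hS.hits hc hl hl' (h.leaf_conf hc hC hl hcl hl' hcl' hne.symm) with h1 | h1 | h1
    · exact ⟨c, h1, hnp c hc hC, hc, Or.inl rfl⟩
    · exact ⟨l, h1, hlp, hl, Or.inr hcl⟩
    · exact ⟨l', h1, hlp', hl', Or.inr hcl'⟩
  choose! f hf using hex
  have hcard : C.card ≤ (S.filter fun u => ¬ Paired G A B u).card := by
    refine Finset.card_le_card_of_injOn f (fun c hc => ?_) ?_
    · have := hf c hc
      simp [this.1, this.2.1]
    · intro c hcC c' hcC' heq
      simp only [Finset.mem_coe] at hcC hcC'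
      obtain ⟨-, -, heB, h1⟩ := hf c hcC
      obtain ⟨-, -, -, h2⟩ := hf c' hcC'
      rw [← heq] at h2
      obtain ⟨hc, hC⟩ := memC.1 hcC
      obtain ⟨hc', hC'⟩ := memC.1 hcC'
      have nadj : ∀ {c c'}, c ∈ B → c' ∈ B → Center G B c → Center G B c' → ¬ G.Adj c c' := by
        rintro c c' hc hc' hC ⟨y, hy, z, hz, hyz, h3, h4⟩ hadj
        exact hyz ((h.leaf_of_center hc hC hc' hadj hy h3).trans
          (h.leaf_of_center hc hC hc' hadj hz h4).symm)
      rcases h1 with h1 | h1 <;> rcases h2 with h2 | h2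
      · exact h1.symm.trans h2
      · rw [h1] at h2; exact absurd h2 (nadj hc' hc hC' hC)
      · rw [h2] at h1; exact absurd h1 (nadj hc hc' hC hC')
      · exact (h.leaf_of_center hc hC heB h1 hc' h2.symm).symm
  have hT' : T.card + (S.filter fun u => ¬ Paired G A B u).card = S.card :=
    Finset.card_filter_add_card_filter_not _
  have hTC : (T ∪ C).card ≤ S.card := by
    have := Finset.card_union_le T C
    omega
  have hpair : ∀ u ∈ B, ∀ v ∈ B, v ≠ u → Conf G A u v v → u ∈ T ∪ C ∨ v ∈ T ∪ C := by
    intro u hu v hv hvu huv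
    have hup : Paired G A B u := ⟨v, hv, hvu, huv⟩
    have hvp : Paired G A B v := ⟨u, hu, hvu.symm, h.pair_symm hu hv huv⟩
    rcases hS.hits hu hv hv huv with h1 | h1 | h1 <;> simp [hT, h1, hup, hvp]
  have hcen : ∀ c ∈ B, Center G B c → c ∈ T ∪ C := fun c hc hC =>
    Finset.mem_union_right _ (memC.2 ⟨hc, hC⟩)
  by_cases hxT : x ∈ T ∪ C
  · exact ⟨T ∪ C, h.sol_of_centers hcen hpair, hTC, hxT⟩
  have hxp : Paired G A B x := hxF.resolve_left fun hC => hxT (hcen x hx hC)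
  obtain ⟨v, hv, hvx, hxv⟩ := id hxp
  have hvT : v ∈ T ∪ C := (hpair x hx v hv hvx hxv).resolve_left hxT
  have hvp : Paired G A B v := ⟨x, hx, hvx.symm, h.pair_symm hx hv hxv⟩
  -- The partner `v` of `x` is traded for `x`. Since pairs form a matching, no other pair is
  -- affected.
  refine ⟨insert x ((T ∪ C).erase v), h.sol_of_centers ?_ ?_, ?_, by simp⟩
  · intro c hc hC
    have hcv : c ≠ v := by rintro rfl; exact hnp c hc hC hvp
    exact Finset.mem_insert_of_mem (Finset.mem_erase.2 ⟨hcv, hcen c hc hC⟩)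
  · intro u hu w hw hwu huw
    have keep : ∀ {y}, y ≠ v → y ∈ T ∪ C → y ∈ insert x ((T ∪ C).erase v) := fun hy hyT =>
      Finset.mem_insert_of_mem (Finset.mem_erase.2 ⟨hy, hyT⟩)
    by_cases huv : u = v
    · subst huv
      obtain rfl := h.pair_unique hu hw hx huw (h.pair_symm hx hu hxv)
      exact Or.inr (by simp)
    by_cases hwv : w = v
    · subst hwv
      obtain rfl := h.pair_unique hw hu hx (h.pair_symm hu hw huw) (h.pair_symm hx hw hxv)
      exact Or.inl (by simp)
    exact (hpair u hu w hw hwu huw).imp (keep huv) (keep hwv)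
  · refine (Finset.card_insert_le _ _).trans ?_
    rw [Finset.card_erase_add_one hvT]
    exact hTC

/-- An instance without centers and pairs is solved. -/
theorem free_of_no_pair (hC : ∀ c ∈ B, ¬ Center G B c) (hp : ∀ u ∈ B, ¬ Paired G A B u) :
    P4Free G {v | v ∈ A ∨ v ∈ B} := by
  have := h.sol_of_centers (S := ∅) (fun c hc hcC => absurd hcC (hC c hc))
    fun u hu v hv hvu huv => absurd ⟨v, hv, hvu, huv⟩ (hp u hu)
  exact this.mono fun v hv => hv.imp_right fun hv => ⟨hv, by simp⟩

end Irreducible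

end FourPath

namespace FourPath

open TreeProg

/-! ### First-order formulas over a labelled graph -/

/-- First-order formulas; variables are de Bruijn indices. -/
inductive Formula : Type
  | ex (φ : Formula) : Formula
  | neg (φ : Formula) : Formula
  | and (φ ψ : Formula) : Formula
  | adj (i j : ℕ) : Formula
  | eq (i j : ℕ) : Formula
  | lab (c i : ℕ) : Formula

/-- The code of a formula. -/
def Formula.enc : Formula → Data
  | .ex φ => .cons (.ofNat 0) φ.enc
  | .neg φ => .cons (.ofNat 1) φ.enc
  | .and φ ψ => .cons (.ofNat 2) (.cons φ.enc ψ.enc)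
  | .adj i j => .cons (.ofNat 3) (.cons (.ofNat i) (.ofNat j))
  | .eq i j => .cons (.ofNat 4) (.cons (.ofNat i) (.ofNat j))
  | .lab c i => .cons (.ofNat 5) (.cons (.ofNat c) (.ofNat i))

/-- A rule: a condition, and the changes of labels that lead to the children. -/
structure Rule where
  cond : Formula
  children : List (List (Fin 4 × ℕ))

def encOps (o : List (Fin 4 × ℕ)) : Data :=
  .ofList (o.map fun p => .cons (.ofNat p.1.val) (.ofNat p.2))

def encChildren (ch : List (List (Fin 4 × ℕ))) : Data := .ofList (ch.map encOps)

def encRule (ρ : Rule) : Data := .cons ρ.cond.enc (encChildren ρ.children)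

def encRules (rs : List Rule) : Data := .ofList (rs.map encRule)

def encEnv (e : List ℕ) : Data := .ofList (e.map .ofNat)

def encLab (L : List (Fin 4)) : Data := .ofList (L.map fun c => .ofNat c.val)

def encRows (M : List (List Bool)) : Data :=
  .ofList (M.map fun r => .ofList (r.map .ofBool))

/-- The adjacency matrix and the list of vertices. -/
def encMat (M : List (List Bool)) : Data :=
  .cons (encRows M) (encEnv (List.range M.length))

def encWit : Option (List ℕ) → Data
  | none => .nil
  | some e => .cons .nil (encEnv e)

def encRes : Option (List (Fin 4)) → Data
  | none => .nil
  | some L => .cons .nil (encLab L)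

def adjB (M : List (List Bool)) (a b : ℕ) : Bool := (M.getD a []).getD b false

/-- Label 0 means deleted, 1 kept (the set A), 2 undecided outside the old cover (the set B), 3
undecided in the old cover or newly added. Positions past the end of the list, the vertices not
added yet, read as deleted, so an initial part of the graph is described by a shorter list with the
full matrix. -/
def label (L : List (Fin 4)) (v : ℕ) : Fin 4 := L.getD v 0

/-- Evaluation of a formula; the result is a witness for the outermost existential quantifiers. -/
def Formula.run (M : List (List Bool)) (L : List (Fin 4)) : Formula → List ℕ → Option (List ℕ)
  | .ex φ, e => (List.range M.length).findSome? fun v => φ.run M L (v :: e)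
  | .neg φ, e => match φ.run M L e with
    | none => some e
    | some _ => none
  | .and φ ψ, e => match φ.run M L e with
    | none => none
    | some _ => ψ.run M L e
  | .adj i j, e => if adjB M (e.getD i 0) (e.getD j 0) then some e else none
  | .eq i j, e => if e.getD i 0 = e.getD j 0 then some e else none
  | .lab c i, e => if c = (label L (e.getD i 0)).val then some e else none

/-- A bound for the number of steps that the evaluation of a formula takes. -/
def Formula.cost : Formula → ℕ → ℕ
  | .ex φ, n => n * (φ.cost n + 40) + 60
  | .neg φ, n => φ.cost n + 60
  | .and φ ψ, n => φ.cost n + ψ.cost n + 60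
  | .adj i j, n => 20 * (i + 1) + 20 * (j + 1) + 40 * (n + 1) + 100
  | .eq i j, n => 20 * (i + 1) + 20 * (j + 1) + 20 * (n + 1) + 100
  | .lab c i, n => 20 * (c + 1) + 20 * (i + 1) + 20 * (n + 1) + 100

/-- Change labels as the operations say; a deletion uses one unit of the budget. -/
def applyOps (e : List ℕ) : List (Fin 4 × ℕ) → List (Fin 4) → ℕ → Option (List (Fin 4) × ℕ)
  | [], L, k => some (L, k)
  | (c, i) :: o, L, k =>
    if c = 0 then
      match k with
      | 0 => none
      | k + 1 => applyOps e o (L.set (e.getD i 0) 0) k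
    else applyOps e o (L.set (e.getD i 0) c) k

/-- All vertices of the old solution, and one more vertex, become undecided. -/
def relabel : List (Fin 4) → List (Fin 4)
  | [] => [3]
  | c :: L => (if c = 0 then 3 else 2) :: relabel L

/-! ### The program -/

/-- The fixed list of rules is written into the procedure bodies as a constant, so reloading it at
each node of the search takes constant time. -/
def quote : Data → Term
  | .nil => .nil
  | .cons a b => .cons (quote a) (quote b)

def qsize : Data → ℕ
  | .nil => 1
  | .cons a b => qsize a + qsize b + 1

/-- Continue with the two components of a pair. -/
abbrev unpair (a c : Term) : Term := .matchOn a .nil c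

abbrev v (i : ℕ) : Term := .var i

/-- Arguments: a list and an index. -/
def nthBody : Term :=
  unpair (v 0) (.matchOn (v 1) (.matchOn (v 0) .nil (v 0))
    (.matchOn (v 2) .nil (.call 0 (.cons (v 1) (v 3)))))

/-- Arguments: two numbers. -/
def eqBody : Term :=
  unpair (v 0) (.matchOn (v 0) (.matchOn (v 1) (.cons .nil .nil) .nil)
    (.matchOn (v 3) .nil (.call 1 (.cons (v 3) (v 1)))))

/-- Arguments: a formula, a labelled graph and an environment. -/
def evalBody : Term :=
  unpair (v 0) <| unpair (v 1) <| unpair (v 2) <|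
  -- The unary tag of the formula is peeled off one unit at a time. Each unit binds two more
  -- variables, which shifts all earlier indices by two.
  .matchOn (v 0)
    (unpair (v 2) <| unpair (v 0) <| .call 3 (.cons (v 1) (.cons (v 5) (.cons (v 6) (v 7))))) <|
  .matchOn (v 1)
    (.matchOn (.call 2 (.cons (v 3) (.cons (v 4) (v 5)))) (.cons .nil (v 5)) .nil) <|
  .matchOn (v 1)
    (unpair (v 5) <| .matchOn (.call 2 (.cons (v 0) (.cons (v 8) (v 9)))) .nil
      (.call 2 (.cons (v 3) (.cons (v 10) (v 11))))) <|
  .matchOn (v 1)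
    (unpair (v 7) <| unpair (v 10) <| unpair (v 0) <|
      .matchOn (.call 0 (.cons (.call 0 (.cons (v 0) (.call 0 (.cons (v 15) (v 4)))))
        (.call 0 (.cons (v 15) (v 5))))) .nil (.cons .nil (v 17))) <|
  .matchOn (v 1)
    (unpair (v 9) <| .matchOn (.call 1 (.cons (.call 0 (.cons (v 13) (v 0)))
      (.call 0 (.cons (v 13) (v 1))))) .nil (.cons .nil (v 15)))
    (unpair (v 11) <| unpair (v 14) <|
      .matchOn (.call 1 (.cons (v 2) (.call 0 (.cons (v 1) (.call 0 (.cons (v 17) (v 3)))))))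
        .nil (.cons .nil (v 19)))

/-- Arguments: a list of vertices, a formula, a labelled graph and an environment. -/
def exBody : Term :=
  unpair (v 0) <| .matchOn (v 0) .nil <| unpair (v 3) <| unpair (v 1) <|
  .matchOn (.call 2 (.cons (v 2) (.cons (v 0) (.cons (v 4) (v 1)))))
    (.call 3 (.cons (v 5) (v 7))) (.cons (v 0) (v 1))

/-- Arguments: a list, an index, and the new value there. -/
def updBody : Term :=
  unpair (v 0) <| unpair (v 1) <| .matchOn (v 2) .nil <|
  .matchOn (v 2) (.cons (v 3) (v 1))
    (.cons (v 2) (.call 4 (.cons (v 3) (.cons (v 1) (v 5)))))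

/-- Arguments: changes of labels, an environment, labels and a budget. -/
def opsBody : Term :=
  unpair (v 0) <| .matchOn (v 0) (unpair (v 1) (v 1)) <|
  unpair (v 3) <| unpair (v 1) <| unpair (v 4) <|
  .matchOn (v 0)
    (.matchOn (v 3) .nil
      (.call 5 (.cons (v 9) (.cons (v 6)
        (.cons (.call 4 (.cons (v 4) (.cons (.call 0 (.cons (v 6) (v 3))) (v 2)))) (v 1))))))
    (.call 5 (.cons (v 9) (.cons (v 6)
      (.cons (.call 4 (.cons (v 4) (.cons (.call 0 (.cons (v 6) (v 3))) (v 2)))) (v 5)))))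

/-- Arguments: the children, a graph, an environment, labels and a budget. -/
def kidsBody (rs : List Rule) : Term :=
  unpair (v 0) <| .matchOn (v 0) .nil <| unpair (v 3) <|
  .matchOn (.call 5 (.cons (v 2) (v 1))) (.call 6 (.cons (v 3) (v 5))) <|
  .matchOn (.call 7 (.cons (quote (encRules rs)) (.cons (v 2) (.cons (v 0) (v 1)))))
    (.call 6 (.cons (v 5) (v 7))) (.cons (v 0) (v 1))

/-- Arguments: rules, a graph, labels and a budget. -/
def rulesBody : Term :=
  unpair (v 0) <| unpair (v 1) <| unpair (v 1) <| .matchOn (v 4) (.cons .nil (v 0)) <|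
  unpair (v 0) <|
  .matchOn (.call 2 (.cons (v 0) (.cons (.cons (v 6) (v 4)) .nil)))
    (.call 7 (.cons (v 3) (v 9))) (.call 6 (.cons (v 3) (.cons (v 8) (.cons (v 1) (v 9)))))

/-- Argument: labels. -/
def relabelBody : Term :=
  .matchOn (v 0) (.cons (quote (.ofNat 3)) .nil) <|
  .matchOn (v 0) (.cons (quote (.ofNat 3)) (.call 8 (v 1)))
    (.cons (quote (.ofNat 2)) (.call 8 (v 3)))

/-- Arguments: a list of vertices, a graph, labels and a budget. -/
def outerBody (rs : List Rule) : Term :=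
  unpair (v 0) <| .matchOn (v 0) (.cons .nil .nil) <| unpair (v 3) <| unpair (v 1) <|
  .matchOn (.call 7 (.cons (quote (encRules rs)) (.cons (v 2) (.cons (.call 8 (v 0)) (v 1)))))
    .nil (.call 9 (.cons (v 7) (.cons (v 4) (.cons (v 1) (v 3)))))

/-- Arguments: a list and the first number. -/
def rangeBody : Term :=
  unpair (v 0) <| .matchOn (v 0) .nil <|
  .cons (v 3) (.call 10 (.cons (v 1) (.cons .nil (v 3))))

def procs (rs : List Rule) : List Term :=
  [nthBody, eqBody, evalBody, exBody, updBody, opsBody, kidsBody rs, rulesBody, relabelBody,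
    outerBody rs, rangeBody]

/-- Argument: a graph and a budget. -/
def mainTerm : Term :=
  unpair (v 0) <| .letIn (.call 10 (.cons (v 0) .nil)) <|
  .call 9 (.cons (v 0) (.cons (.cons (v 1) (v 0)) (.cons .nil (v 2))))

/-! ### The steps of the procedures -/

variable (rs : List Rule)

theorem eval_quote (env : List Data) (d : Data) : Eval (procs rs) env (quote d) d (qsize d) := by
  induction d with
  | nil => exact .nil
  | cons a b iha ihb => exact .cons iha ihb

theorem eval_nth (i : ℕ) : ∀ ds : List Data, ∃ t,
    Eval (procs rs) [.cons (.ofList ds) (.ofNat i)] nthBody (ds.getD i .nil) t ∧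
      t ≤ 12 * (i + 1) := by
  induction i with
  | zero =>
    rintro (_ | ⟨d, ds⟩)
    · exact ⟨_, .matchCons (.var rfl) (.matchNil (.var rfl) (.matchNil (.var rfl) .nil)), by omega⟩
    · exact ⟨_, .matchCons (.var rfl) (.matchNil (.var rfl) (.matchCons (.var rfl) (.var rfl))),
        by omega⟩
  | succ i ih =>
    rintro (_ | ⟨d, ds⟩)
    · exact ⟨_, .matchCons (.var rfl) (.matchCons (.var rfl) (.matchNil (.var rfl) .nil)), by omega⟩
    · obtain ⟨t, h, ht⟩ := ih ds
      exact ⟨_, .matchCons (.var rfl) (.matchCons (.var rfl) (.matchCons (.var rfl)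
        (.call (.cons (.var rfl) (.var rfl)) rfl h))), by omega⟩

theorem eval_eq (a : ℕ) : ∀ b : ℕ, ∃ t,
    Eval (procs rs) [.cons (.ofNat a) (.ofNat b)] eqBody (.ofBool (decide (a = b))) t ∧
      t ≤ 12 * (a + 1) := by
  induction a with
  | zero =>
    rintro (_ | b)
    · exact ⟨_, .matchCons (.var rfl) (.matchNil (.var rfl) (.matchNil (.var rfl)
        (.cons .nil .nil))), by omega⟩
    · exact ⟨_, .matchCons (.var rfl) (.matchNil (.var rfl) (.matchCons (.var rfl) .nil)),
        by omega⟩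
  | succ a ih =>
    rintro (_ | b)
    · exact ⟨_, .matchCons (.var rfl) (.matchCons (.var rfl) (.matchNil (.var rfl) .nil)),
        by omega⟩
    · obtain ⟨t, h, ht⟩ := ih b
      have : decide (a + 1 = b + 1) = decide (a = b) := by simp
      rw [this]
      exact ⟨_, .matchCons (.var rfl) (.matchCons (.var rfl) (.matchCons (.var rfl)
        (.call (.cons (.var rfl) (.var rfl)) rfl h))), by omega⟩

theorem eval_nth_env (e : List ℕ) (i : ℕ) : ∃ t,
    Eval (procs rs) [.cons (encEnv e) (.ofNat i)] nthBody (.ofNat (e.getD i 0)) t ∧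
      t ≤ 12 * (i + 1) := by
  obtain ⟨t, h, ht⟩ := eval_nth rs i (e.map .ofNat)
  refine ⟨t, ?_, ht⟩
  have : (e.map Data.ofNat).getD i .nil = .ofNat (e.getD i 0) :=
    List.getD_map (f := Data.ofNat) (d := 0) ..
  rwa [← this]

theorem eval_nth_lab (L : List (Fin 4)) (i : ℕ) : ∃ t,
    Eval (procs rs) [.cons (encLab L) (.ofNat i)] nthBody (.ofNat (label L i).val) t ∧
      t ≤ 12 * (i + 1) := by
  obtain ⟨t, h, ht⟩ := eval_nth rs i (L.map fun c => .ofNat c.val)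
  refine ⟨t, ?_, ht⟩
  have : (L.map fun c : Fin 4 => Data.ofNat c.val).getD i .nil = .ofNat (label L i).val :=
    List.getD_map (f := fun c : Fin 4 => Data.ofNat c.val) (d := 0) ..
  rwa [← this]

theorem eval_nth_rows (M : List (List Bool)) (i : ℕ) : ∃ t,
    Eval (procs rs) [.cons (encRows M) (.ofNat i)] nthBody
      (.ofList ((M.getD i []).map .ofBool)) t ∧ t ≤ 12 * (i + 1) := by
  obtain ⟨t, h, ht⟩ := eval_nth rs i (M.map fun r => .ofList (r.map .ofBool))
  refine ⟨t, ?_, ht⟩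
  have : (M.map fun r : List Bool => Data.ofList (r.map .ofBool)).getD i .nil =
      .ofList ((M.getD i []).map .ofBool) :=
    List.getD_map (f := fun r : List Bool => Data.ofList (r.map .ofBool)) (d := []) ..
  rwa [← this]

theorem eval_nth_row (r : List Bool) (i : ℕ) : ∃ t,
    Eval (procs rs) [.cons (.ofList (r.map .ofBool)) (.ofNat i)] nthBody
      (.ofBool (r.getD i false)) t ∧ t ≤ 12 * (i + 1) := by
  obtain ⟨t, h, ht⟩ := eval_nth rs i (r.map .ofBool)
  refine ⟨t, ?_, ht⟩
  have : (r.map Data.ofBool).getD i .nil = .ofBool (r.getD i false) :=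
    List.getD_map (f := Data.ofBool) (d := false) ..
  rwa [← this]

theorem getD_le {e : List ℕ} {n : ℕ} (he : ∀ a ∈ e, a < n) (i : ℕ) : e.getD i 0 ≤ n := by
  rw [List.getD_eq_getElem?_getD]
  rcases hi : e[i]? with _ | a
  · simp
  · exact (he a (List.mem_of_getElem? hi)).le

/-- Induction on the formula. A quantifier needs an inner induction over the list of vertices, which
follows the loop of `exBody`. The step counts are read off from the explicit derivations. -/
theorem eval_formula (M : List (List Bool)) (L : List (Fin 4)) (φ : Formula) :
    ∀ e : List ℕ, (∀ a ∈ e, a < M.length) → ∃ t,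
      Eval (procs rs) [.cons φ.enc (.cons (.cons (encMat M) (encLab L)) (encEnv e))] evalBody
        (encWit (φ.run M L e)) t ∧ t ≤ φ.cost M.length := by
  induction φ with
  | ex φ ih =>
    intro e he
    have key : ∀ vs : List ℕ, (∀ a ∈ vs, a < M.length) → ∃ t,
        Eval (procs rs) [.cons (encEnv vs) (.cons φ.enc (.cons (.cons (encMat M) (encLab L))
          (encEnv e)))] exBody (encWit (vs.findSome? fun v => φ.run M L (v :: e))) t ∧
          t ≤ vs.length * (φ.cost M.length + 40) + 20 := by
      intro vs
      induction vs with
      | nil => exact fun _ => ⟨_, .matchCons (.var rfl) (.matchNil (.var rfl) .nil), by omega⟩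
      | cons a vs ihv =>
        intro hvs
        obtain ⟨t₁, h₁, ht₁⟩ := ih (a :: e) (by
          intro b hb
          rcases List.mem_cons.1 hb with rfl | hb
          exacts [hvs _ (by simp), he b hb])
        rw [List.findSome?_cons]
        have hlen : (a :: vs).length * (φ.cost M.length + 40) =
            vs.length * (φ.cost M.length + 40) + (φ.cost M.length + 40) := by
          rw [List.length_cons, Nat.succ_mul]
        rcases hrun : φ.run M L (a :: e) with _ | w
        · obtain ⟨t₂, h₂, ht₂⟩ := ihv fun b hb => hvs b (List.mem_cons_of_mem _ hb)
          rw [hrun] at h₁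
          exact ⟨_, .matchCons (.var rfl) (.matchCons (.var rfl) (.matchCons (.var rfl)
            (.matchCons (.var rfl) (.matchNil (.call (.cons (.var rfl) (.cons (.var rfl)
              (.cons (.var rfl) (.var rfl)))) rfl h₁)
              (.call (.cons (.var rfl) (.var rfl)) rfl h₂))))), by omega⟩
        · rw [hrun] at h₁
          exact ⟨_, .matchCons (.var rfl) (.matchCons (.var rfl) (.matchCons (.var rfl)
            (.matchCons (.var rfl) (.matchCons (.call (.cons (.var rfl) (.cons (.var rfl)
              (.cons (.var rfl) (.var rfl)))) rfl h₁)
              (.cons (.var rfl) (.var rfl)))))), by omega⟩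
    obtain ⟨t, h, ht⟩ := key (List.range M.length) (by simp)
    rw [List.length_range] at ht
    exact ⟨_, .matchCons (.var rfl) (.matchCons (.var rfl) (.matchCons (.var rfl)
      (.matchNil (.var rfl) (.matchCons (.var rfl) (.matchCons (.var rfl)
        (.call (.cons (.var rfl) (.cons (.var rfl) (.cons (.var rfl) (.var rfl)))) rfl h)))))),
      by simp only [Formula.cost]; omega⟩
  | neg φ ih =>
    intro e he
    obtain ⟨t, h, ht⟩ := ih e he
    simp only [Formula.run, Formula.cost]
    rcases hrun : φ.run M L e with _ | w
    · rw [hrun] at h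
      exact ⟨_, .matchCons (.var rfl) (.matchCons (.var rfl) (.matchCons (.var rfl)
        (.matchCons (.var rfl) (.matchNil (.var rfl) (.matchNil
          (.call (.cons (.var rfl) (.cons (.var rfl) (.var rfl))) rfl h)
          (.cons .nil (.var rfl))))))), by omega⟩
    · rw [hrun] at h
      exact ⟨_, .matchCons (.var rfl) (.matchCons (.var rfl) (.matchCons (.var rfl)
        (.matchCons (.var rfl) (.matchNil (.var rfl) (.matchCons
          (.call (.cons (.var rfl) (.cons (.var rfl) (.var rfl))) rfl h) .nil))))), by omega⟩
  | and φ ψ ihφ ihψ =>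
    intro e he
    obtain ⟨t₁, h₁, ht₁⟩ := ihφ e he
    obtain ⟨t₂, h₂, ht₂⟩ := ihψ e he
    simp only [Formula.run, Formula.cost]
    rcases hrun : φ.run M L e with _ | w
    · rw [hrun] at h₁
      exact ⟨_, .matchCons (.var rfl) (.matchCons (.var rfl) (.matchCons (.var rfl)
        (.matchCons (.var rfl) (.matchCons (.var rfl) (.matchNil (.var rfl)
          (.matchCons (.var rfl) (.matchNil
          (.call (.cons (.var rfl) (.cons (.var rfl) (.var rfl))) rfl h₁) .nil))))))), by omega⟩
    · rw [hrun] at h₁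
      exact ⟨_, .matchCons (.var rfl) (.matchCons (.var rfl) (.matchCons (.var rfl)
        (.matchCons (.var rfl) (.matchCons (.var rfl) (.matchNil (.var rfl)
          (.matchCons (.var rfl) (.matchCons
          (.call (.cons (.var rfl) (.cons (.var rfl) (.var rfl))) rfl h₁)
          (.call (.cons (.var rfl) (.cons (.var rfl) (.var rfl))) rfl h₂)))))))), by omega⟩
  | adj i j =>
    intro e he
    obtain ⟨t₁, h₁, ht₁⟩ := eval_nth_env rs e i
    obtain ⟨t₂, h₂, ht₂⟩ := eval_nth_env rs e j
    obtain ⟨t₃, h₃, ht₃⟩ := eval_nth_rows rs M (e.getD i 0)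
    obtain ⟨t₄, h₄, ht₄⟩ := eval_nth_row rs (M.getD (e.getD i 0) []) (e.getD j 0)
    have hi := getD_le he i
    have hj := getD_le he j
    simp only [Formula.run, Formula.cost]
    rw [show (M.getD (e.getD i 0) []).getD (e.getD j 0) false =
      adjB M (e.getD i 0) (e.getD j 0) from rfl] at h₄
    by_cases hb : adjB M (e.getD i 0) (e.getD j 0) = true
    swap
    · rw [if_neg hb]
      rw [Bool.eq_false_iff.2 hb] at h₄
      exact ⟨_, .matchCons (.var rfl) (.matchCons (.var rfl) (.matchCons (.var rfl)
        (.matchCons (.var rfl) (.matchCons (.var rfl) (.matchCons (.var rfl) (.matchNil (.var rfl)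
          (.matchCons (.var rfl) (.matchCons (.var rfl) (.matchCons (.var rfl) (.matchNil
            (.call (.cons (.call (.cons (.var rfl)
              (.call (.cons (.var rfl) (.var rfl)) rfl h₁)) rfl h₃)
              (.call (.cons (.var rfl) (.var rfl)) rfl h₂)) rfl h₄) .nil)))))))))), by omega⟩
    · rw [if_pos hb]
      rw [hb] at h₄
      exact ⟨_, .matchCons (.var rfl) (.matchCons (.var rfl) (.matchCons (.var rfl)
        (.matchCons (.var rfl) (.matchCons (.var rfl) (.matchCons (.var rfl) (.matchNil (.var rfl)
          (.matchCons (.var rfl) (.matchCons (.var rfl) (.matchCons (.var rfl) (.matchCons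
            (.call (.cons (.call (.cons (.var rfl)
              (.call (.cons (.var rfl) (.var rfl)) rfl h₁)) rfl h₃)
              (.call (.cons (.var rfl) (.var rfl)) rfl h₂)) rfl h₄)
              (.cons .nil (.var rfl)))))))))))), by omega⟩
  | eq i j =>
    intro e he
    obtain ⟨t₁, h₁, ht₁⟩ := eval_nth_env rs e i
    obtain ⟨t₂, h₂, ht₂⟩ := eval_nth_env rs e j
    obtain ⟨t₃, h₃, ht₃⟩ := eval_eq rs (e.getD i 0) (e.getD j 0)
    have hi := getD_le he i
    simp only [Formula.run, Formula.cost]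
    by_cases hb : e.getD i 0 = e.getD j 0
    · rw [decide_eq_true hb] at h₃
      rw [if_pos hb]
      exact ⟨_, .matchCons (.var rfl) (.matchCons (.var rfl) (.matchCons (.var rfl)
        (.matchCons (.var rfl) (.matchCons (.var rfl) (.matchCons (.var rfl) (.matchCons (.var rfl)
          (.matchNil (.var rfl) (.matchCons (.var rfl) (.matchCons
            (.call (.cons (.call (.cons (.var rfl) (.var rfl)) rfl h₁)
              (.call (.cons (.var rfl) (.var rfl)) rfl h₂)) rfl h₃)
              (.cons .nil (.var rfl))))))))))), by omega⟩
    · rw [decide_eq_false hb] at h₃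
      rw [if_neg hb]
      exact ⟨_, .matchCons (.var rfl) (.matchCons (.var rfl) (.matchCons (.var rfl)
        (.matchCons (.var rfl) (.matchCons (.var rfl) (.matchCons (.var rfl) (.matchCons (.var rfl)
          (.matchNil (.var rfl) (.matchCons (.var rfl) (.matchNil
            (.call (.cons (.call (.cons (.var rfl) (.var rfl)) rfl h₁)
              (.call (.cons (.var rfl) (.var rfl)) rfl h₂)) rfl h₃) .nil))))))))), by omega⟩
  | lab c i =>
    intro e he
    obtain ⟨t₁, h₁, ht₁⟩ := eval_nth_env rs e i
    obtain ⟨t₂, h₂, ht₂⟩ := eval_nth_lab rs L (e.getD i 0)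
    obtain ⟨t₃, h₃, ht₃⟩ := eval_eq rs c (label L (e.getD i 0)).val
    have hi := getD_le he i
    simp only [Formula.run, Formula.cost]
    by_cases hb : c = (label L (e.getD i 0)).val
    · rw [decide_eq_true hb] at h₃
      rw [if_pos hb]
      exact ⟨_, .matchCons (.var rfl) (.matchCons (.var rfl) (.matchCons (.var rfl)
        (.matchCons (.var rfl) (.matchCons (.var rfl) (.matchCons (.var rfl) (.matchCons (.var rfl)
          (.matchCons (.var rfl) (.matchCons (.var rfl) (.matchCons (.var rfl) (.matchCons
            (.call (.cons (.var rfl) (.call (.cons (.var rfl)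
              (.call (.cons (.var rfl) (.var rfl)) rfl h₁)) rfl h₂)) rfl h₃)
              (.cons .nil (.var rfl)))))))))))), by omega⟩
    · rw [decide_eq_false hb] at h₃
      rw [if_neg hb]
      exact ⟨_, .matchCons (.var rfl) (.matchCons (.var rfl) (.matchCons (.var rfl)
        (.matchCons (.var rfl) (.matchCons (.var rfl) (.matchCons (.var rfl) (.matchCons (.var rfl)
          (.matchCons (.var rfl) (.matchCons (.var rfl) (.matchCons (.var rfl) (.matchNil
            (.call (.cons (.var rfl) (.call (.cons (.var rfl)
              (.call (.cons (.var rfl) (.var rfl)) rfl h₁)) rfl h₂)) rfl h₃) .nil)))))))))),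
        by omega⟩

theorem eval_upd (c : Fin 4) (L : List (Fin 4)) : ∀ i : ℕ, ∃ t,
    Eval (procs rs) [.cons (encLab L) (.cons (.ofNat i) (.ofNat c.val))] updBody
      (encLab (L.set i c)) t ∧ t ≤ 20 * (i + 1) := by
  induction L with
  | nil =>
    intro i
    exact ⟨_, .matchCons (.var rfl) (.matchCons (.var rfl) (.matchNil (.var rfl) .nil)), by omega⟩
  | cons a L ih =>
    rintro (_ | i)
    · exact ⟨_, .matchCons (.var rfl) (.matchCons (.var rfl) (.matchCons (.var rfl)
        (.matchNil (.var rfl) (.cons (.var rfl) (.var rfl))))), by omega⟩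
    · obtain ⟨t, h, ht⟩ := ih i
      exact ⟨_, .matchCons (.var rfl) (.matchCons (.var rfl) (.matchCons (.var rfl)
        (.matchCons (.var rfl) (.cons (.var rfl) (.call (.cons (.var rfl)
          (.cons (.var rfl) (.var rfl))) rfl h))))), by omega⟩

def opsCost : List (Fin 4 × ℕ) → ℕ → ℕ
  | [], _ => 20
  | (_, i) :: o, n => opsCost o n + 20 * (i + 1) + 20 * (n + 1) + 60

def encState : Option (List (Fin 4) × ℕ) → Data
  | none => .nil
  | some (L, k) => .cons (encLab L) (.ofNat k)

theorem eval_ops {n : ℕ} {e : List ℕ} (he : ∀ a ∈ e, a < n) (o : List (Fin 4 × ℕ)) :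
    ∀ (L : List (Fin 4)) (k : ℕ), ∃ t,
      Eval (procs rs) [.cons (encOps o) (.cons (encEnv e) (.cons (encLab L) (.ofNat k)))] opsBody
        (encState (applyOps e o L k)) t ∧ t ≤ opsCost o n := by
  induction o with
  | nil =>
    intro L k
    exact ⟨_, .matchCons (.var rfl) (.matchNil (.var rfl) (.matchCons (.var rfl) (.var rfl))),
      by simp only [opsCost]; omega⟩
  | cons op o ih =>
    obtain ⟨c, i⟩ := op
    intro L k
    have hi := getD_le he i
    obtain ⟨t₁, h₁, ht₁⟩ := eval_nth_env rs e i
    obtain ⟨t₂, h₂, ht₂⟩ := eval_upd rs c L (e.getD i 0)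
    simp only [applyOps, opsCost]
    by_cases hc : c = 0
    · subst hc
      rw [if_pos rfl]
      rcases k with _ | k
      · exact ⟨_, .matchCons (.var rfl) (.matchCons (.var rfl) (.matchCons (.var rfl)
          (.matchCons (.var rfl) (.matchCons (.var rfl) (.matchNil (.var rfl)
            (.matchNil (.var rfl) .nil)))))), by omega⟩
      · obtain ⟨t₃, h₃, ht₃⟩ := ih (L.set (e.getD i 0) 0) k
        exact ⟨_, .matchCons (.var rfl) (.matchCons (.var rfl) (.matchCons (.var rfl)
          (.matchCons (.var rfl) (.matchCons (.var rfl) (.matchNil (.var rfl)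
            (.matchCons (.var rfl) (.call (.cons (.var rfl) (.cons (.var rfl) (.cons
              (.call (.cons (.var rfl) (.cons (.call (.cons (.var rfl) (.var rfl)) rfl h₁)
                (.var rfl))) rfl h₂) (.var rfl)))) rfl h₃))))))), by omega⟩
    · rw [if_neg hc]
      obtain ⟨t₃, h₃, ht₃⟩ := ih (L.set (e.getD i 0) c) k
      -- A nonzero label is coded by a pair, which selects the branch that leaves the budget alone.
      obtain ⟨m, hm⟩ : ∃ m, c.val = m + 1 :=
        Nat.exists_eq_succ_of_ne_zero fun h => hc (Fin.ext h)
      have hc' : encOps ((c, i) :: o) =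
          .cons (.cons (.cons .nil (.ofNat m)) (.ofNat i)) (encOps o) := by
        simp only [encOps, List.map_cons, Data.ofList, hm, Data.ofNat]
      rw [hm] at h₂
      rw [hc']
      exact ⟨_, .matchCons (.var rfl) (.matchCons (.var rfl) (.matchCons (.var rfl)
          (.matchCons (.var rfl) (.matchCons (.var rfl) (.matchCons (.var rfl)
            (.call (.cons (.var rfl) (.cons (.var rfl) (.cons
              (.call (.cons (.var rfl) (.cons (.call (.cons (.var rfl) (.var rfl)) rfl h₁)
                (.var rfl))) rfl h₂) (.var rfl)))) rfl h₃)))))), by omega⟩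

theorem eval_relabel (L : List (Fin 4)) : ∃ t,
    Eval (procs rs) [encLab L] relabelBody (encLab (relabel L)) t ∧
      t ≤ 40 * (L.length + 1) := by
  have hq2 := fun env => eval_quote rs env (.ofNat 2)
  have hq3 := fun env => eval_quote rs env (.ofNat 3)
  simp only [show qsize (.ofNat 2) = 5 from rfl] at hq2
  simp only [show qsize (.ofNat 3) = 7 from rfl] at hq3
  induction L with
  | nil => exact ⟨_, .matchNil (.var rfl) (.cons (hq3 _) .nil), by omega⟩
  | cons c L ih =>
    obtain ⟨t, h, ht⟩ := ih
    rw [List.length_cons]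
    by_cases hc : c = 0
    · subst hc
      exact ⟨_, .matchCons (.var rfl) (.matchNil (.var rfl) (.cons (hq3 _)
        (.call (.var rfl) rfl h))), by omega⟩
    · obtain ⟨m, hm⟩ : ∃ m, c.val = m + 1 :=
        Nat.exists_eq_succ_of_ne_zero fun h => hc (Fin.ext h)
      have h1 : encLab (c :: L) = .cons (.cons .nil (.ofNat m)) (encLab L) := by
        simp only [encLab, List.map_cons, Data.ofList, hm, Data.ofNat]
      have h2 : relabel (c :: L) = 2 :: relabel L := by simp [relabel, hc]
      rw [h1, h2]
      exact ⟨_, .matchCons (.var rfl) (.matchCons (.var rfl) (.cons (hq2 _)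
        (.call (.var rfl) rfl h))), by omega⟩

theorem eval_range (M : List (List Bool)) : ∀ i : ℕ, ∃ t,
    Eval (procs rs) [.cons (encRows M) (.ofNat i)] rangeBody
      (encEnv (List.range' i M.length)) t ∧ t ≤ 20 * (M.length + 1) := by
  induction M with
  | nil => exact fun i => ⟨_, .matchCons (.var rfl) (.matchNil (.var rfl) .nil), by omega⟩
  | cons r M ih =>
    intro i
    obtain ⟨t, h, ht⟩ := ih (i + 1)
    rw [List.length_cons]
    exact ⟨_, .matchCons (.var rfl) (.matchCons (.var rfl) (.cons (.var rfl)
      (.call (.cons (.var rfl) (.cons .nil (.var rfl))) rfl h))), by omega⟩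

end FourPath

namespace FourPath

open TreeProg

/-! ### The search -/

variable (rs : List Rule)

/-- From labels `L` and budget `k`, the rules `rs'` lead to the result `r` in `t` steps. -/
def RulesRun (M : List (List Bool)) (rs' : List Rule) (L : List (Fin 4)) (k : ℕ)
    (r : Option (List (Fin 4))) (t : ℕ) : Prop :=
  Eval (procs rs) [.cons (encRules rs') (.cons (encMat M) (.cons (encLab L) (.ofNat k)))]
    rulesBody (encRes r) t

/-- The children `ch` lead to the result `r` in `t` steps. -/
def KidsRun (M : List (List Bool)) (ch : List (List (Fin 4 × ℕ))) (e : List ℕ) (L : List (Fin 4))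
    (k : ℕ) (r : Option (List (Fin 4))) (t : ℕ) : Prop :=
  Eval (procs rs) [.cons (encChildren ch) (.cons (encMat M)
    (.cons (encEnv e) (.cons (encLab L) (.ofNat k))))] (kidsBody rs) (encRes r) t

def rulesCost : List Rule → ℕ → ℕ
  | [], _ => 60
  | ρ :: rs', n => ρ.cond.cost n + 60 + rulesCost rs' n

def kidsCost : List (List (Fin 4 × ℕ)) → ℕ → ℕ
  | [], _ => 60
  | o :: ch, n => opsCost o n + qsize (encRules rs) + 60 + kidsCost ch n

theorem rules_none (M : List (List Bool)) (L : List (Fin 4)) (k : ℕ) (rs' : List Rule)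
    (h : ∀ ρ ∈ rs', ρ.cond.run M L [] = none) :
    ∃ t, RulesRun rs M rs' L k (some L) t ∧ t ≤ rulesCost rs' M.length := by
  induction rs' with
  | nil =>
    exact ⟨_, .matchCons (.var rfl) (.matchCons (.var rfl) (.matchCons (.var rfl)
      (.matchNil (.var rfl) (.cons .nil (.var rfl))))), by simp only [rulesCost]; omega⟩
  | cons ρ rs' ih =>
    obtain ⟨t₁, h₁, ht₁⟩ := ih fun ρ' hρ' => h ρ' (List.mem_cons_of_mem _ hρ')
    obtain ⟨t₂, h₂, ht₂⟩ := eval_formula rs M L ρ.cond [] (by simp)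
    rw [h ρ (by simp)] at h₂
    exact ⟨_, .matchCons (.var rfl) (.matchCons (.var rfl) (.matchCons (.var rfl)
      (.matchCons (.var rfl) (.matchCons (.var rfl) (.matchNil (.call (.cons (.var rfl)
        (.cons (.cons (.var rfl) (.var rfl)) .nil)) rfl h₂)
        (.call (.cons (.var rfl) (.var rfl)) rfl h₁)))))), by simp only [rulesCost]; omega⟩

theorem rules_some (M : List (List Bool)) (L : List (Fin 4)) (k : ℕ) (pre post : List Rule)
    (ρ : Rule) (h : ∀ ρ' ∈ pre, ρ'.cond.run M L [] = none) {e : List ℕ}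
    (he : ρ.cond.run M L [] = some e) {r : Option (List (Fin 4))} {s : ℕ}
    (hs : KidsRun rs M ρ.children e L k r s) :
    ∃ t, RulesRun rs M (pre ++ ρ :: post) L k r t ∧
      t ≤ rulesCost (pre ++ ρ :: post) M.length + s := by
  induction pre with
  | nil =>
    obtain ⟨t₂, h₂, ht₂⟩ := eval_formula rs M L ρ.cond [] (by simp)
    rw [he] at h₂
    have hpos : 60 ≤ rulesCost post M.length := by
      cases post <;> simp only [rulesCost] <;> omega
    exact ⟨_, .matchCons (.var rfl) (.matchCons (.var rfl) (.matchCons (.var rfl)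
      (.matchCons (.var rfl) (.matchCons (.var rfl) (.matchCons (.call (.cons (.var rfl)
        (.cons (.cons (.var rfl) (.var rfl)) .nil)) rfl h₂)
        (.call (.cons (.var rfl) (.cons (.var rfl) (.cons (.var rfl) (.var rfl)))) rfl hs)))))),
      by simp only [List.nil_append, rulesCost]; omega⟩
  | cons ρ' pre ih =>
    obtain ⟨t₁, h₁, ht₁⟩ := ih fun ρ' hρ' => h ρ' (List.mem_cons_of_mem _ hρ')
    obtain ⟨t₂, h₂, ht₂⟩ := eval_formula rs M L ρ'.cond [] (by simp)
    rw [h ρ' (by simp)] at h₂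
    exact ⟨_, .matchCons (.var rfl) (.matchCons (.var rfl) (.matchCons (.var rfl)
      (.matchCons (.var rfl) (.matchCons (.var rfl) (.matchNil (.call (.cons (.var rfl)
        (.cons (.cons (.var rfl) (.var rfl)) .nil)) rfl h₂)
        (.call (.cons (.var rfl) (.var rfl)) rfl h₁)))))),
      by simp only [List.cons_append, rulesCost]; omega⟩

/-- The runs at the children are hypotheses with an abstract specification and abstract weights, so
the mutual recursion of the procedures can be closed later by induction on the search tree. The loop
stops at the first success; the sum of all weights bounds this case too. -/
theorem kids_run (M : List (List Bool)) {e : List ℕ} (he : ∀ a ∈ e, a < M.length)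
    (L : List (Fin 4)) (k : ℕ) (Spec : List (Fin 4) → ℕ → Option (List (Fin 4)) → Prop)
    (w : List (Fin 4 × ℕ) → ℝ) {P : ℝ} (hP : 0 ≤ P) (ch : List (List (Fin 4 × ℕ)))
    (hch : ∀ o ∈ ch, 0 ≤ w o ∧ ∀ L' k', applyOps e o L k = some (L', k') →
      ∃ r t, RulesRun rs M rs L' k' r t ∧ Spec L' k' r ∧ (t : ℝ) ≤ P * w o) :
    ∃ r t, KidsRun rs M ch e L k r t ∧ (t : ℝ) ≤ kidsCost rs ch M.length + P * (ch.map w).sum ∧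
      (r = none → ∀ o ∈ ch, ∀ L' k', applyOps e o L k = some (L', k') → Spec L' k' none) ∧
      ∀ R, r = some R → ∃ o ∈ ch, ∃ L' k', applyOps e o L k = some (L', k') ∧
        Spec L' k' (some R) := by
  induction ch with
  | nil =>
    refine ⟨none, _, .matchCons (.var rfl) (.matchNil (.var rfl) .nil), ?_, by simp, by simp⟩
    simp only [kidsCost, List.map_nil, List.sum_nil, mul_zero, add_zero]
    norm_num
  | cons o ch ih =>
    obtain ⟨hw, ho⟩ := hch o (by simp)
    obtain ⟨r₁, t₁, h₁, ht₁, hn₁, hs₁⟩ := ih fun o' ho' => hch o' (List.mem_cons_of_mem _ ho')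
    obtain ⟨t₂, h₂, ht₂⟩ := eval_ops rs he o L k
    simp only [List.map_cons, List.sum_cons, kidsCost]
    have hPw : 0 ≤ P * w o := mul_nonneg hP hw
    have hsum : 0 ≤ P * (ch.map w).sum := mul_nonneg hP <| List.sum_nonneg fun x hx => by
      obtain ⟨o', ho', rfl⟩ := List.mem_map.1 hx
      exact (hch o' (List.mem_cons_of_mem _ ho')).1
    have ht₂' : (t₂ : ℝ) ≤ opsCost o M.length := by exact_mod_cast ht₂
    have hk0 : (0 : ℝ) ≤ kidsCost rs ch M.length := Nat.cast_nonneg _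
    have hq0 : (0 : ℝ) ≤ qsize (encRules rs) := Nat.cast_nonneg _
    rcases ha : applyOps e o L k with _ | ⟨L', k'⟩
    · rw [ha] at h₂
      refine ⟨r₁, _, .matchCons (.var rfl) (.matchCons (.var rfl) (.matchCons (.var rfl)
        (.matchNil (.call (.cons (.var rfl) (.var rfl)) rfl h₂)
          (.call (.cons (.var rfl) (.var rfl)) rfl h₁)))), ?_, ?_, ?_⟩
      · push_cast
        linarith
      · intro hr o' ho' L' k' hL'
        rcases List.mem_cons.1 ho' with rfl | ho'
        · rw [ha] at hL'; cases hL'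
        · exact hn₁ hr o' ho' L' k' hL'
      · intro R hR
        obtain ⟨o', ho', hh⟩ := hs₁ R hR
        exact ⟨o', List.mem_cons_of_mem _ ho', hh⟩
    · obtain ⟨r, t, hr, hS, ht⟩ := ho L' k' ha
      rw [ha] at h₂
      rcases r with _ | R
      · refine ⟨r₁, _, .matchCons (.var rfl) (.matchCons (.var rfl) (.matchCons (.var rfl)
          (.matchCons (.call (.cons (.var rfl) (.var rfl)) rfl h₂)
            (.matchNil (.call (.cons (eval_quote rs _ _) (.cons (.var rfl)
              (.cons (.var rfl) (.var rfl)))) rfl hr)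
              (.call (.cons (.var rfl) (.var rfl)) rfl h₁))))), ?_, ?_, ?_⟩
        · push_cast
          linarith
        · intro hr o' ho' L'' k'' hL''
          rcases List.mem_cons.1 ho' with rfl | ho'
          · rw [ha] at hL''; cases hL''; exact hS
          · exact hn₁ hr o' ho' L'' k'' hL''
        · intro R hR
          obtain ⟨o', ho', hh⟩ := hs₁ R hR
          exact ⟨o', List.mem_cons_of_mem _ ho', hh⟩
      · refine ⟨some R, _, .matchCons (.var rfl) (.matchCons (.var rfl) (.matchCons (.var rfl)
          (.matchCons (.call (.cons (.var rfl) (.var rfl)) rfl h₂)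
            (.matchCons (.call (.cons (eval_quote rs _ _) (.cons (.var rfl)
              (.cons (.var rfl) (.var rfl)))) rfl hr)
              (.cons (.var rfl) (.var rfl)))))), ?_, by simp, ?_⟩
        · push_cast
          linarith
        · intro R' hR'
          cases hR'
          exact ⟨o, by simp, L', k', ha, hS⟩

/-! ### Polynomial bounds -/

/-- `f` is given by a polynomial. -/
def IsPoly (f : ℕ → ℕ) : Prop := ∃ p : Polynomial ℕ, ∀ n, f n = p.eval n

theorem isPoly_const (c : ℕ) : IsPoly fun _ => c := ⟨.C c, by simp⟩

theorem isPoly_id : IsPoly fun n => n := ⟨.X, by simp⟩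

theorem IsPoly.add {f g : ℕ → ℕ} (hf : IsPoly f) (hg : IsPoly g) : IsPoly fun n => f n + g n := by
  obtain ⟨p, hp⟩ := hf
  obtain ⟨q, hq⟩ := hg
  exact ⟨p + q, by simp [hp, hq]⟩

theorem IsPoly.mul {f g : ℕ → ℕ} (hf : IsPoly f) (hg : IsPoly g) : IsPoly fun n => f n * g n := by
  obtain ⟨p, hp⟩ := hf
  obtain ⟨q, hq⟩ := hg
  exact ⟨p * q, by simp [hp, hq]⟩

theorem Formula.isPoly_cost (φ : Formula) : IsPoly φ.cost := by
  have lin : ∀ a, IsPoly fun n => a * (n + 1) := fun a =>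
    (isPoly_const a).mul (isPoly_id.add (isPoly_const 1))
  induction φ with
  | ex φ ih => exact (isPoly_id.mul (ih.add (isPoly_const 40))).add (isPoly_const 60)
  | neg φ ih => exact ih.add (isPoly_const 60)
  | and φ ψ ih₁ ih₂ => exact (ih₁.add ih₂).add (isPoly_const 60)
  | adj i j => exact ((isPoly_const _).add (lin 40)).add (isPoly_const 100)
  | eq i j => exact ((isPoly_const _).add (lin 20)).add (isPoly_const 100)
  | lab c i => exact ((isPoly_const _).add (lin 20)).add (isPoly_const 100)

theorem isPoly_opsCost (o : List (Fin 4 × ℕ)) : IsPoly (opsCost o) := by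
  induction o with
  | nil => exact isPoly_const 20
  | cons op o ih =>
    exact ((ih.add (isPoly_const _)).add ((isPoly_const 20).mul
      (isPoly_id.add (isPoly_const 1)))).add (isPoly_const 60)

theorem isPoly_kidsCost (ch : List (List (Fin 4 × ℕ))) : IsPoly (kidsCost rs ch) := by
  induction ch with
  | nil => exact isPoly_const 60
  | cons o ch ih =>
    exact (((isPoly_opsCost o).add (isPoly_const _)).add (isPoly_const 60)).add ih

theorem isPoly_rulesCost (rs' : List Rule) : IsPoly (rulesCost rs') := by
  induction rs' with
  | nil => exact isPoly_const 60
  | cons ρ rs' ih => exact (ρ.cond.isPoly_cost.add (isPoly_const 60)).add ih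

/-- The sum of the costs of the children of all rules. -/
def allKidsCost : List Rule → ℕ → ℕ
  | [], _ => 0
  | ρ :: rs', n => kidsCost rs ρ.children n + allKidsCost rs' n

theorem isPoly_allKidsCost (rs' : List Rule) : IsPoly (allKidsCost rs rs') := by
  induction rs' with
  | nil => exact isPoly_const 0
  | cons ρ rs' ih => exact (isPoly_kidsCost rs _).add ih

theorem kidsCost_le {ρ : Rule} (n : ℕ) {rs' : List Rule} (h : ρ ∈ rs') :
    kidsCost rs ρ.children n ≤ allKidsCost rs rs' n := by
  induction rs' with
  | nil => simp at h
  | cons ρ' rs' ih =>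
    simp only [allKidsCost]
    rcases List.mem_cons.1 h with rfl | h
    · omega
    · have := ih h
      omega

/-- A bound for the steps at a node of the search tree, without those of its descendants. -/
def nodeCost (n : ℕ) : ℕ := rulesCost rs n + allKidsCost rs rs n

theorem isPoly_nodeCost : IsPoly (nodeCost rs) :=
  (isPoly_rulesCost rs).add (isPoly_allKidsCost rs rs)

end FourPath

namespace FourPath

open TreeProg

/-! ### The meaning of formulas -/

section Sat

variable {n : ℕ} (G : SimpleGraph (Fin n)) (L : List (Fin 4))

/-- The vertices with label `c`. -/
def cls (n : ℕ) (L : List (Fin 4)) (c : Fin 4) : Set (Fin n) := {v | label L v.val = c}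

def Formula.Sat : Formula → List ℕ → Prop
  | .ex φ, e => ∃ v : Fin n, φ.Sat (v.val :: e)
  | .neg φ, e => ¬ φ.Sat e
  | .and φ ψ, e => φ.Sat e ∧ ψ.Sat e
  | .adj i j, e => ∃ a b : Fin n, e.getD i 0 = a.val ∧ e.getD j 0 = b.val ∧ G.Adj a b
  | .eq i j, e => e.getD i 0 = e.getD j 0
  | .lab c i, e => c = (label L (e.getD i 0)).val

/-- The rows of the adjacency matrix. -/
def rows [DecidableRel G.Adj] : List (List Bool) :=
  List.ofFn fun i => List.ofFn fun j => decide (G.Adj i j)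

theorem rows_length [DecidableRel G.Adj] : (rows G).length = n := by simp [rows]

theorem encRows_rows [DecidableRel G.Adj] : encRows (rows G) = encodeGraph G := by
  simp only [encRows, rows, encodeGraph, List.map_ofFn, Function.comp_def]

theorem adjB_rows [DecidableRel G.Adj] (a b : ℕ) :
    adjB (rows G) a b = true ↔ ∃ a' b' : Fin n, a = a'.val ∧ b = b'.val ∧ G.Adj a' b' := by
  unfold adjB rows
  by_cases ha : a < n
  · have h1 : (List.ofFn fun i : Fin n => List.ofFn fun j => decide (G.Adj i j)).getD a [] =
        List.ofFn fun j => decide (G.Adj ⟨a, ha⟩ j) := by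
      simp [List.getD_eq_getElem?_getD, ha]
    rw [h1]
    by_cases hb : b < n
    · have h2 : (List.ofFn fun j : Fin n => decide (G.Adj ⟨a, ha⟩ j)).getD b false =
          decide (G.Adj ⟨a, ha⟩ ⟨b, hb⟩) := by
        simp [List.getD_eq_getElem?_getD, hb]
      rw [h2, decide_eq_true_iff]
      constructor
      · exact fun h => ⟨⟨a, ha⟩, ⟨b, hb⟩, rfl, rfl, h⟩
      · rintro ⟨a', b', rfl, rfl, h⟩
        exact h
    · have h2 : (List.ofFn fun j : Fin n => decide (G.Adj ⟨a, ha⟩ j)).getD b false = false := by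
        simp [List.getD_eq_getElem?_getD, hb]
      rw [h2]
      constructor
      · simp
      · rintro ⟨a', b', rfl, rfl, h⟩
        exact absurd b'.isLt hb
  · have h1 : (List.ofFn fun i : Fin n => List.ofFn fun j => decide (G.Adj i j)).getD a [] = [] := by
      simp [List.getD_eq_getElem?_getD, ha]
    rw [h1]
    constructor
    · simp
    · rintro ⟨a', b', rfl, rfl, h⟩
      exact absurd a'.isLt ha

theorem run_isSome [DecidableRel G.Adj] (φ : Formula) : ∀ e : List ℕ,
    (φ.run (rows G) L e).isSome ↔ φ.Sat G L e := by
  induction φ with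
  | ex φ ih =>
    intro e
    simp only [Formula.run, Formula.Sat, List.findSome?_isSome_iff, List.mem_range, rows_length, ih]
    exact ⟨fun ⟨v, hv, h⟩ => ⟨⟨v, hv⟩, h⟩, fun ⟨v, h⟩ => ⟨v.val, v.isLt, h⟩⟩
  | neg φ ih =>
    intro e
    simp only [Formula.run, Formula.Sat, ← ih]
    cases φ.run (rows G) L e <;> simp
  | and φ ψ ihφ ihψ =>
    intro e
    simp only [Formula.run, Formula.Sat, ← ihφ, ← ihψ]
    cases φ.run (rows G) L e <;> simp
  | adj i j =>
    intro e
    simp only [Formula.run, Formula.Sat, ← adjB_rows]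
    split_ifs <;> simp_all
  | eq i j =>
    intro e
    simp only [Formula.run, Formula.Sat]
    split_ifs <;> simp_all
  | lab c i =>
    intro e
    simp only [Formula.run, Formula.Sat]
    split_ifs <;> simp_all

/-- `r` existential quantifiers, whose witnesses are the result of the evaluation. -/
def exs : ℕ → Formula → Formula
  -- A negation returns the environment that it received, so the double negation discards the
  -- witnesses of quantifiers inside `φ`.
  | 0, φ => .neg (.neg φ)
  | r + 1, φ => .ex (exs r φ)

theorem run_exs_some [DecidableRel G.Adj] {φ : Formula} (r : ℕ) : ∀ {e w : List ℕ},
    (exs r φ).run (rows G) L e = some w →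
      ∃ vs : List (Fin n), vs.length = r ∧ w = vs.map Fin.val ++ e ∧ φ.Sat G L w := by
  induction r with
  | zero =>
    intro e w h
    refine ⟨[], rfl, ?_⟩
    simp only [exs, Formula.run] at h
    rw [← run_isSome]
    rcases hr : φ.run (rows G) L e with _ | w'
    · simp [hr] at h
    · simp only [hr, Option.some.injEq] at h
      subst h
      simp [hr]
  | succ r ih =>
    intro e w h
    simp only [exs, Formula.run] at h
    obtain ⟨v, hv, h⟩ := List.exists_of_findSome?_eq_some h
    rw [List.mem_range, rows_length] at hv
    obtain ⟨vs, hlen, hw, hS⟩ := ih h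
    exact ⟨vs ++ [⟨v, hv⟩], by simp [hlen], by simp [hw], hS⟩

theorem run_exs_none [DecidableRel G.Adj] {φ : Formula} (r : ℕ) : ∀ {e : List ℕ},
    (exs r φ).run (rows G) L e = none →
      ∀ vs : List (Fin n), vs.length = r → ¬ φ.Sat G L (vs.map Fin.val ++ e) := by
  induction r with
  | zero =>
    intro e h vs hvs
    obtain rfl := List.length_eq_zero_iff.1 hvs
    simp only [exs, Formula.run] at h
    rw [← run_isSome]
    rcases hr : φ.run (rows G) L e with _ | w'
    · simp [hr]
    · simp [hr] at h
  | succ r ih =>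
    intro e h vs hvs
    simp only [exs, Formula.run, List.findSome?_eq_none_iff, List.mem_range, rows_length] at h
    obtain ⟨vs', v, rfl⟩ : ∃ vs' v, vs = vs' ++ [v] :=
      ⟨vs.dropLast, vs.getLast (List.ne_nil_of_length_eq_add_one hvs),
        (List.dropLast_append_getLast _).symm⟩
    have := ih (h v.val v.isLt) vs' (by simpa using hvs)
    simpa using this

end Sat

/-! ### The formulas of the rules -/

namespace Formula

def or (φ ψ : Formula) : Formula := neg (and (neg φ) (neg ψ))
def imp (φ ψ : Formula) : Formula := neg (and φ (neg ψ))
def all (φ : Formula) : Formula := neg (ex (neg φ))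

/-- `v` is in `A` or one of `i, j, k`. -/
def inside (v i j k : ℕ) : Formula := or (lab 1 v) (or (eq v i) (or (eq v j) (eq v k)))

def p4 (i j k l : ℕ) : Formula :=
  and (adj i j) (and (adj j k) (and (adj k l)
    (and (neg (eq i k)) (and (neg (eq i l)) (neg (eq j l))))))

def conf (i j k : ℕ) : Formula :=
  ex (ex (ex (ex (and (p4 3 2 1 0) (and (inside 3 (i + 4) (j + 4) (k + 4))
    (and (inside 2 (i + 4) (j + 4) (k + 4)) (and (inside 1 (i + 4) (j + 4) (k + 4))
      (inside 0 (i + 4) (j + 4) (k + 4)))))))))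

def ess (z i j : ℕ) : Formula :=
  and (lab 2 i) (and (lab 2 j) (and (neg (eq i z)) (and (neg (eq j z))
    (and (conf z i j) (neg (conf i i j))))))

/-- All essential conflicts of `z` satisfy `φ`. -/
def allEss (z : ℕ) (φ : Formula) : Formula := all (all (imp (ess (z + 2) 1 0) φ))

def dominates (x y : ℕ) : Formula :=
  allEss y (or (eq 1 (x + 2)) (or (eq 0 (x + 2)) (conf (x + 2) 1 0)))

def swap (c u v : ℕ) : Formula :=
  allEss u (or (eq 1 (c + 2)) (or (eq 0 (c + 2)) (or (eq 1 (v + 2)) (eq 0 (v + 2)))))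

/-- All the indices denote vertices of `B`. -/
def inB : List ℕ → Formula → Formula
  | [], φ => φ
  | i :: l, φ => and (lab 2 i) (inB l φ)

/-- `i` differs from all the indices. -/
def differ (i : ℕ) : List ℕ → Formula → Formula
  | [], φ => φ
  | j :: l, φ => and (neg (eq i j)) (differ i l φ)

def distinct : List ℕ → Formula → Formula
  | [], φ => φ
  | i :: l, φ => differ i l (distinct l φ)

def freeA : Formula :=
  ex (ex (ex (ex (and (p4 3 2 1 0) (and (lab 1 3) (and (lab 1 2) (and (lab 1 1) (lab 1 0))))))))

/-- In the following rules the outermost quantifier has the largest index: in `branch`, the indices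
3, 2, 1, 0 stand for `x, y, b₁, b₂`; in `three`, 6 to 0 stand for `c, u₁, u₂, u₃, v₁, v₂, v₃`; in
`two`, for `c, u₁, u₂, l, v₁, v₂, b`. -/
def single : Formula := inB [0] (conf 0 0 0)

def redundant : Formula := inB [1, 0] (allEss 1 (or (eq 1 2) (eq 0 2)))

def branch : Formula :=
  inB [3, 2, 1, 0] (and (neg (eq 1 0)) (and (dominates 3 2) (and (conf 3 2 1) (conf 3 2 0))))

def three : Formula :=
  inB [6, 5, 4, 3, 2, 1, 0] (distinct [6, 5, 4, 3, 2, 1, 0] (and (conf 5 2 2) (and (conf 4 1 1)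
    (and (conf 3 0 0) (and (conf 6 5 4) (and (conf 6 5 3) (and (swap 6 4 1) (swap 6 3 0))))))))

def two : Formula :=
  inB [6, 5, 4, 3, 2, 1, 0] (distinct [6, 5, 4, 3, 2, 1, 0] (and (conf 5 2 2) (and (conf 4 1 1)
    (and (conf 6 3 5) (and (conf 6 3 4) (and (conf 6 3 0) (and (conf 6 5 4) (and (swap 6 5 2)
      -- Under `allEss`, indices 1 and 0 are `p` and `q` and the others are shifted by two: 3 is
      -- `v₂`, 8 is `c`, 7 is `u₁`, 5 is `l`.
      (allEss 4 (or (eq 1 3) (or (eq 0 3) (and (or (eq 1 8) (eq 0 8))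
        (or (eq 1 7) (or (eq 0 7) (or (eq 1 5) (eq 0 5))))))))))))))))

def center : Formula :=
  ex (ex (inB [1, 0] (and (neg (eq 1 0)) (and (adj 2 1) (adj 2 0)))))

def paired : Formula := ex (inB [0] (and (neg (eq 0 1)) (conf 1 0 0)))

def final : Formula := inB [0] (or center paired)

section

variable {n : ℕ} {G : SimpleGraph (Fin n)} {L : List (Fin 4)} {e : List ℕ}

theorem sat_or {φ ψ : Formula} : (or φ ψ).Sat G L e ↔ φ.Sat G L e ∨ ψ.Sat G L e := by
  simp only [or, Sat]; tauto

theorem sat_imp {φ ψ : Formula} : (imp φ ψ).Sat G L e ↔ (φ.Sat G L e → ψ.Sat G L e) := by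
  simp only [imp, Sat]; tauto

theorem sat_all {φ : Formula} : (all φ).Sat G L e ↔ ∀ v : Fin n, φ.Sat G L (v.val :: e) := by
  simp only [all, Sat]; push Not; rfl

theorem sat_adj {i j : ℕ} {x y : Fin n} (hi : e.getD i 0 = x.val) (hj : e.getD j 0 = y.val) :
    (adj i j).Sat G L e ↔ G.Adj x y := by
  simp only [Sat, hi, hj]
  constructor
  · rintro ⟨a, b, ha, hb, h⟩
    rwa [Fin.ext ha, Fin.ext hb]
  · exact fun h => ⟨x, y, rfl, rfl, h⟩

theorem sat_eq {i j : ℕ} {x y : Fin n} (hi : e.getD i 0 = x.val) (hj : e.getD j 0 = y.val) :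
    (eq i j).Sat G L e ↔ x = y := by
  simp only [Sat, hi, hj, Fin.val_inj]

theorem sat_lab (c : Fin 4) {i : ℕ} {x : Fin n} (hi : e.getD i 0 = x.val) :
    (lab c.val i).Sat G L e ↔ x ∈ cls n L c := by
  simp only [Sat, hi, Fin.val_inj, cls, Set.mem_ofPred_eq]
  exact eq_comm

theorem sat_inside {v i j k : ℕ} {w x y z : Fin n} (hv : e.getD v 0 = w.val)
    (hi : e.getD i 0 = x.val) (hj : e.getD j 0 = y.val) (hk : e.getD k 0 = z.val) :
    (inside v i j k).Sat G L e ↔ (w ∈ cls n L 1 ∨ w = x ∨ w = y ∨ w = z) := by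
  simp only [inside, sat_or, sat_eq hv hi, sat_eq hv hj, sat_eq hv hk]
  rw [← sat_lab (G := G) 1 hv]
  rfl

theorem sat_p4 {i j k l : ℕ} {w x y z : Fin n} (hi : e.getD i 0 = w.val)
    (hj : e.getD j 0 = x.val) (hk : e.getD k 0 = y.val) (hl : e.getD l 0 = z.val) :
    (p4 i j k l).Sat G L e ↔ IsP4 G w x y z := by
  rw [p4, IsP4]
  change (adj i j).Sat G L e ∧ (adj j k).Sat G L e ∧ (adj k l).Sat G L e ∧
    ¬ (eq i k).Sat G L e ∧ ¬ (eq i l).Sat G L e ∧ ¬ (eq j l).Sat G L e ↔ _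
  rw [sat_adj hi hj, sat_adj hj hk, sat_adj hk hl, sat_eq hi hk, sat_eq hi hl, sat_eq hj hl]

theorem sat_conf {i j k : ℕ} {x y z : Fin n} (hi : e.getD i 0 = x.val)
    (hj : e.getD j 0 = y.val) (hk : e.getD k 0 = z.val) :
    (conf i j k).Sat G L e ↔ Conf G (cls n L 1) x y z := by
  rw [conf, Conf]
  refine exists_congr fun p => exists_congr fun q => exists_congr fun r => exists_congr fun s => ?_
  exact and_congr (sat_p4 rfl rfl rfl rfl) <| and_congr (sat_inside rfl hi hj hk) <|
    and_congr (sat_inside rfl hi hj hk) <| and_congr (sat_inside rfl hi hj hk)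
      (sat_inside rfl hi hj hk)

theorem sat_ess {i j k : ℕ} {x y z : Fin n} (hi : e.getD i 0 = x.val)
    (hj : e.getD j 0 = y.val) (hk : e.getD k 0 = z.val) :
    (ess i j k).Sat G L e ↔ Ess G (cls n L 1) (cls n L 2) x y z := by
  rw [ess, Ess]
  exact and_congr (sat_lab 2 hj) <| and_congr (sat_lab 2 hk) <|
    and_congr (not_congr (sat_eq hj hi)) <| and_congr (not_congr (sat_eq hk hi)) <|
      and_congr (sat_conf hi hj hk) (not_congr (sat_conf hj hj hk))

theorem sat_allEss {i : ℕ} {x : Fin n} {φ : Formula} {Q : Fin n → Fin n → Prop}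
    (hi : e.getD i 0 = x.val) (hQ : ∀ p q : Fin n, φ.Sat G L (q.val :: p.val :: e) ↔ Q p q) :
    (allEss i φ).Sat G L e ↔ ∀ p q, Ess G (cls n L 1) (cls n L 2) x p q → Q p q := by
  simp only [allEss, sat_all, sat_imp]
  refine forall_congr' fun p => forall_congr' fun q => ?_
  exact imp_congr (sat_ess hi rfl rfl) (hQ p q)

theorem sat_dominates {i j : ℕ} {x y : Fin n} (hi : e.getD i 0 = x.val)
    (hj : e.getD j 0 = y.val) :
    (dominates i j).Sat G L e ↔ Dominates G (cls n L 1) (cls n L 2) x y :=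
  sat_allEss hj fun p q => by
    exact sat_or.trans <| or_congr (sat_eq rfl hi) <| sat_or.trans <| or_congr (sat_eq rfl hi)
      (sat_conf hi rfl rfl)

theorem sat_swap {i j k : ℕ} {c u v : Fin n} (hi : e.getD i 0 = c.val)
    (hj : e.getD j 0 = u.val) (hk : e.getD k 0 = v.val) :
    (swap i j k).Sat G L e ↔ Swap G (cls n L 1) (cls n L 2) c u v :=
  sat_allEss hj fun p q => by
    exact sat_or.trans <| or_congr (sat_eq rfl hi) <| sat_or.trans <| or_congr (sat_eq rfl hi) <|
      sat_or.trans <| or_congr (sat_eq rfl hk) (sat_eq rfl hk)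

theorem sat_freeA : freeA.Sat G L e ↔ ¬ P4Free G (cls n L 1) := by
  rw [P4Free, freeA]
  push Not
  refine exists_congr fun p => exists_congr fun q => exists_congr fun r => exists_congr fun s => ?_
  refine (and_congr (sat_p4 rfl rfl rfl rfl) <| and_congr (sat_lab 1 rfl) <|
    and_congr (sat_lab 1 rfl) <| and_congr (sat_lab 1 rfl) (sat_lab 1 rfl)).trans ?_
  tauto

theorem sat_single {x : Fin n} :
    single.Sat G L [x.val] ↔ x ∈ cls n L 2 ∧ Conf G (cls n L 1) x x x :=
  and_congr (sat_lab 2 rfl) (sat_conf rfl rfl rfl)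

theorem sat_redundant {z t : Fin n} : redundant.Sat G L [t.val, z.val] ↔
    z ∈ cls n L 2 ∧ t ∈ cls n L 2 ∧
      ∀ p q, Ess G (cls n L 1) (cls n L 2) z p q → p = t ∨ q = t := by
  refine and_congr (sat_lab 2 rfl) <| and_congr (sat_lab 2 rfl) (sat_allEss rfl fun p q => ?_)
  rw [sat_or]
  exact or_congr (sat_eq rfl rfl) (sat_eq rfl rfl)

theorem sat_branch {x y b₁ b₂ : Fin n} :
    branch.Sat G L [b₂.val, b₁.val, y.val, x.val] ↔
      x ∈ cls n L 2 ∧ y ∈ cls n L 2 ∧ b₁ ∈ cls n L 2 ∧ b₂ ∈ cls n L 2 ∧ b₁ ≠ b₂ ∧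
        Dominates G (cls n L 1) (cls n L 2) x y ∧ Conf G (cls n L 1) x y b₁ ∧
        Conf G (cls n L 1) x y b₂ :=
  and_congr (sat_lab 2 rfl) <| and_congr (sat_lab 2 rfl) <| and_congr (sat_lab 2 rfl) <|
    and_congr (sat_lab 2 rfl) <| and_congr (not_congr (sat_eq rfl rfl)) <|
    and_congr (sat_dominates rfl rfl) <| and_congr (sat_conf rfl rfl rfl) (sat_conf rfl rfl rfl)

theorem sat_distinct {a b c d x y z : Fin n} {φ : Formula} :
    (distinct [6, 5, 4, 3, 2, 1, 0] φ).Sat G L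
        [z.val, y.val, x.val, d.val, c.val, b.val, a.val] ↔
      [a, b, c, d, x, y, z].Nodup ∧
        φ.Sat G L [z.val, y.val, x.val, d.val, c.val, b.val, a.val] := by
  simp only [distinct, differ, Sat, List.getD_cons_succ, List.getD_cons_zero, Fin.val_inj,
    List.nodup_cons, List.mem_cons, List.not_mem_nil, or_false, not_or, not_false_eq_true,
    List.nodup_nil, and_true, and_assoc]

theorem sat_three {c u₁ u₂ u₃ v₁ v₂ v₃ : Fin n} :
    three.Sat G L [v₃.val, v₂.val, v₁.val, u₃.val, u₂.val, u₁.val, c.val] ↔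
      c ∈ cls n L 2 ∧ u₁ ∈ cls n L 2 ∧ u₂ ∈ cls n L 2 ∧ u₃ ∈ cls n L 2 ∧ v₁ ∈ cls n L 2 ∧
        v₂ ∈ cls n L 2 ∧ v₃ ∈ cls n L 2 ∧
        ThreePaired G (cls n L 1) (cls n L 2) c u₁ u₂ u₃ v₁ v₂ v₃ := by
  refine and_congr (sat_lab 2 rfl) <| and_congr (sat_lab 2 rfl) <| and_congr (sat_lab 2 rfl) <|
    and_congr (sat_lab 2 rfl) <| and_congr (sat_lab 2 rfl) <| and_congr (sat_lab 2 rfl) <|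
    and_congr (sat_lab 2 rfl) <| sat_distinct.trans <| and_congr_right fun _ => ?_
  exact and_congr (sat_conf rfl rfl rfl) <| and_congr (sat_conf rfl rfl rfl) <|
    and_congr (sat_conf rfl rfl rfl) <| and_congr (sat_conf rfl rfl rfl) <|
    and_congr (sat_conf rfl rfl rfl) <| and_congr (sat_swap rfl rfl rfl) (sat_swap rfl rfl rfl)

theorem sat_two {c u₁ u₂ l v₁ v₂ b : Fin n} :
    two.Sat G L [b.val, v₂.val, v₁.val, l.val, u₂.val, u₁.val, c.val] ↔
      c ∈ cls n L 2 ∧ u₁ ∈ cls n L 2 ∧ u₂ ∈ cls n L 2 ∧ l ∈ cls n L 2 ∧ v₁ ∈ cls n L 2 ∧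
        v₂ ∈ cls n L 2 ∧ b ∈ cls n L 2 ∧
        TwoPaired G (cls n L 1) (cls n L 2) c u₁ u₂ l v₁ v₂ b := by
  refine and_congr (sat_lab 2 rfl) <| and_congr (sat_lab 2 rfl) <| and_congr (sat_lab 2 rfl) <|
    and_congr (sat_lab 2 rfl) <| and_congr (sat_lab 2 rfl) <| and_congr (sat_lab 2 rfl) <|
    and_congr (sat_lab 2 rfl) <| sat_distinct.trans <| and_congr_right fun _ => ?_
  refine and_congr (sat_conf rfl rfl rfl) <| and_congr (sat_conf rfl rfl rfl) <|
    and_congr (sat_conf rfl rfl rfl) <| and_congr (sat_conf rfl rfl rfl) <|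
    and_congr (sat_conf rfl rfl rfl) <| and_congr (sat_conf rfl rfl rfl) <|
    and_congr (sat_swap rfl rfl rfl) <| sat_allEss rfl fun p q => ?_
  refine sat_or.trans <| or_congr (sat_eq rfl rfl) <| sat_or.trans <| or_congr (sat_eq rfl rfl) <|
    and_congr (sat_or.trans <| or_congr (sat_eq rfl rfl) (sat_eq rfl rfl)) <|
    sat_or.trans <| or_congr (sat_eq rfl rfl) <| sat_or.trans <| or_congr (sat_eq rfl rfl) <|
    sat_or.trans <| or_congr (sat_eq rfl rfl) (sat_eq rfl rfl)

theorem sat_final {x : Fin n} : final.Sat G L [x.val] ↔ x ∈ cls n L 2 ∧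
    (Center G (cls n L 2) x ∨ Paired G (cls n L 1) (cls n L 2) x) := by
  refine and_congr (sat_lab 2 rfl) (sat_or.trans (or_congr ?_ ?_))
  · have : center.Sat G L [x.val] ↔ ∃ y z, y ∈ cls n L 2 ∧ z ∈ cls n L 2 ∧ y ≠ z ∧ G.Adj x y ∧
        G.Adj x z :=
      exists_congr fun y => exists_congr fun z => and_congr (sat_lab 2 rfl) <|
        and_congr (sat_lab 2 rfl) <| and_congr (not_congr (sat_eq rfl rfl)) <|
        and_congr (sat_adj rfl rfl) (sat_adj rfl rfl)
    rw [this]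
    constructor
    · rintro ⟨y, z, hy, hz, h⟩
      exact ⟨y, hy, z, hz, h⟩
    · rintro ⟨y, hy, z, hz, h⟩
      exact ⟨y, z, hy, hz, h⟩
  · exact exists_congr fun v => and_congr (sat_lab 2 rfl) <|
      and_congr (not_congr (sat_eq rfl rfl)) (sat_conf rfl rfl rfl)

end

end Formula

end FourPath

namespace FourPath

open TreeProg

/-! ### Changes of labels -/

/-- The default label is 0, so a nonzero label certifies that the position exists and that
`List.set` takes effect there. -/
theorem lt_length_of_label {L : List (Fin 4)} {a : ℕ} (h : label L a ≠ 0) : a < L.length := by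
  by_contra hn
  exact h (by simp [label, List.getD_eq_getElem?_getD, List.getElem?_eq_none (not_lt.1 hn)])

theorem label_set {L : List (Fin 4)} {a : ℕ} (c : Fin 4) (h : label L a ≠ 0) (b : ℕ) :
    label (L.set a c) b = if b = a then c else label L b := by
  have ha := lt_length_of_label h
  unfold label
  simp only [List.getD_eq_getElem?_getD, List.getElem?_set]
  by_cases hb : b = a
  · subst hb; simp [ha]
  · simp [hb, Ne.symm hb]

theorem count_set_label {L : List (Fin 4)} {a : ℕ} (c d : Fin 4) (h : label L a ≠ 0) :
    (L.set a c).count d + (if label L a = d then 1 else 0) =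
      L.count d + (if c = d then 1 else 0) := by
  have ha := lt_length_of_label h
  have hl : label L a = L[a] := by simp [label, List.getD_eq_getElem?_getD, ha]
  rw [List.count_set ha, hl]
  have : L[a] = d → 0 < L.count d := fun h => List.count_pos_iff.2 (h ▸ List.getElem_mem ha)
  simp only [beq_iff_eq]
  split_ifs with h1 h2 h2
  · have := this h1; omega
  · have := this h1; omega
  · omega
  · omega

/-- Delete the vertices `xs`. -/
def wipe (L : List (Fin 4)) (xs : List ℕ) : List (Fin 4) := xs.foldl (fun L a => L.set a 0) L

theorem length_wipe (xs : List ℕ) : ∀ L, (wipe L xs).length = L.length := by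
  induction xs with
  | nil => exact fun L => rfl
  | cons a xs ih => exact fun L => (ih _).trans (by simp)

theorem label_wipe {xs : List ℕ} : ∀ {L : List (Fin 4)}, xs.Nodup → (∀ a ∈ xs, label L a ≠ 0) →
    ∀ b, label (wipe L xs) b = if b ∈ xs then 0 else label L b := by
  induction xs with
  | nil => intro L _ _ b; simp [wipe]
  | cons a xs ih =>
    intro L hn hx b
    obtain ⟨ha, hn⟩ := List.nodup_cons.1 hn
    have h0 := hx a (by simp)
    have := ih (L := L.set a 0) hn (fun a' ha' => by
      rw [label_set 0 h0, if_neg (ne_of_mem_of_not_mem ha' ha)]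
      exact hx a' (List.mem_cons_of_mem _ ha')) b
    change label (wipe (L.set a 0) xs) b = _
    rw [this, label_set 0 h0]
    by_cases h1 : b ∈ xs <;> by_cases h2 : b = a <;> simp [h1, h2]

theorem count_wipe {xs : List ℕ} {c : Fin 4} (hc : c ≠ 0) : ∀ {L : List (Fin 4)}, xs.Nodup →
    (∀ a ∈ xs, label L a = c) → ∀ d, (wipe L xs).count d + (if c = d then xs.length else 0) =
      L.count d + (if 0 = d then xs.length else 0) := by
  induction xs with
  | nil => intro L _ _ d; simp [wipe]
  | cons a xs ih =>
    intro L hn hx d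
    obtain ⟨ha, hn⟩ := List.nodup_cons.1 hn
    have h0 := hx a (by simp)
    have h1 : label L a ≠ 0 := h0 ▸ hc
    have h2 := ih (L := L.set a 0) hn (fun a' ha' => by
      rw [label_set 0 h1, if_neg (ne_of_mem_of_not_mem ha' ha)]
      exact hx a' (List.mem_cons_of_mem _ ha')) d
    have h3 := count_set_label 0 d h1
    rw [h0] at h3
    change (wipe (L.set a 0) xs).count d + _ = _
    simp only [List.length_cons]
    split_ifs at * <;> omega

def dels (D : List ℕ) : List (Fin 4 × ℕ) := D.map fun i => (0, i)

theorem applyOps_dels (e : List ℕ) (D : List ℕ) : ∀ L k, applyOps e (dels D) L k =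
    if D.length ≤ k then some (wipe L (D.map (e.getD · 0)), k - D.length) else none := by
  induction D with
  | nil => intro L k; simp [applyOps, dels, wipe]
  | cons i D ih =>
    intro L k
    rcases k with _ | k
    · simp [applyOps, dels]
    · have := ih (L.set (e.getD i 0) 0) k
      change applyOps e (dels D) (L.set (e.getD i 0) 0) k = _
      rw [this]
      simp only [List.length_cons, Nat.add_le_add_iff_right, Nat.add_sub_add_right]
      rfl

theorem applyOps_keep (e : List ℕ) (i : ℕ) (L : List (Fin 4)) (k : ℕ) :
    applyOps e [(1, i)] L k = some (L.set (e.getD i 0) 1, k) := by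
  simp [applyOps]

/-! ### The rules -/

/-- The order matters, since the soundness of a rule uses that the earlier ones fail. The first rule
has no children and rejects. The drops in the measure are (2,1), (1), (0), (1,2), (1+3 in the form
4,1,3), (3,3,3,3) and (1); the last rule needs the full structure theory. -/
def rules : List Rule :=
  [⟨exs 0 .freeA, []⟩,
   ⟨exs 1 (.lab 3 0), [dels [0], [(1, 0)]]⟩,
   ⟨exs 1 .single, [dels [0]]⟩,
   ⟨exs 2 .redundant, [[(1, 1)]]⟩,
   ⟨exs 4 .branch, [dels [3], dels [1, 0]]⟩,
   ⟨exs 7 .three, [dels [6, 2, 1, 0], dels [5], dels [4, 3, 2]]⟩,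
   ⟨exs 7 .two, [dels [6, 2, 1], dels [5, 4, 0], dels [5, 1, 3], dels [2, 4, 3]]⟩,
   ⟨exs 1 .final, [dels [0]]⟩]

section

variable {n : ℕ} (G : SimpleGraph (Fin n))

/-- The labels `L` can be completed to a solution with at most `k` further deletions. -/
def Feasible (L : List (Fin 4)) (k : ℕ) : Prop :=
  ∃ S : Finset (Fin n), S.card ≤ k ∧ Sol G (cls n L 1) (cls n L 2 ∪ cls n L 3) S

/-- `r` is a correct result for the labels `L` and the budget `k`. -/
def Good (L : List (Fin 4)) (k : ℕ) (r : Option (List (Fin 4))) : Prop :=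
  (r = none → ¬ Feasible G L k) ∧ ∀ R, r = some R → R.length = L.length ∧
    P4Free G {v : Fin n | label R v.val ≠ 0} ∧ R.count 0 ≤ L.count 0 + k

theorem feasible_wipe {L : List (Fin 4)} {k : ℕ} {xs : List ℕ} {S : Finset (Fin n)} {c : Fin 4}
    (hc : c ≠ 0) (hn : xs.Nodup) (hx : ∀ a ∈ xs, label L a = c)
    (hlt : ∀ a ∈ xs, a < n) (hk : S.card ≤ k)
    (hS : Sol G (cls n L 1) (cls n L 2 ∪ cls n L 3) S) (hxS : ∀ v : Fin n, v.val ∈ xs → v ∈ S) :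
    xs.length ≤ k ∧ Feasible G (wipe L xs) (k - xs.length) := by
  have hl := label_wipe hn (fun a ha => (hx a ha ▸ hc : label L a ≠ 0))
  set T : Finset (Fin n) := Finset.univ.filter fun v => v.val ∈ xs with hT
  have hTS : T ⊆ S := fun v hv => hxS v (Finset.mem_filter.1 hv).2
  have hTc : T.card = xs.length := by
    rw [← List.toFinset_card_of_nodup hn, ← Finset.card_map Fin.valEmbedding]
    congr 1
    ext a
    simp only [hT, Finset.mem_map, Finset.mem_filter, Finset.mem_univ, true_and,
      Fin.valEmbedding_apply, List.mem_toFinset]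
    exact ⟨fun ⟨v, hv, h⟩ => h ▸ hv, fun h => ⟨⟨a, hlt a h⟩, h, rfl⟩⟩
  have hle := Finset.card_le_card hTS
  refine ⟨by omega, S \ T, by rw [Finset.card_sdiff_of_subset hTS]; omega, hS.mono ?_⟩
  rintro v (hv | ⟨hv, hvS⟩)
  · simp only [cls, Set.mem_ofPred_eq, hl] at hv
    split_ifs at hv
    · exact absurd hv (by decide)
    · exact Or.inl hv
  · have hvx : v.val ∉ xs := by
      intro h
      rcases hv with hv | hv <;> simp only [cls, Set.mem_ofPred_eq, hl, if_pos h] at hv <;>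
        exact absurd hv (by decide)
    refine Or.inr ⟨?_, fun h => hvS ?_⟩
    · rcases hv with hv | hv <;> simp only [cls, Set.mem_ofPred_eq, hl, if_neg hvx] at hv
      exacts [Or.inl hv, Or.inr hv]
    · exact Finset.mem_sdiff.2 ⟨h, fun h' => hvx (Finset.mem_filter.1 h').2⟩

variable {G} in
theorem Feasible.exists_sol {L : List (Fin 4)} {k : ℕ} (h : Feasible G L k)
    (hU : cls n L 3 = ∅) : ∃ S : Finset (Fin n), S.card ≤ k ∧ Sol G (cls n L 1) (cls n L 2) S := by
  rwa [Feasible, hU, Set.union_empty] at h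

/-! ### A node of the search tree -/

/-- The base of the running time. -/
noncomputable def base : ℝ := 1.6183

theorem one_le_base : 1 ≤ base := by norm_num [base]

/-- The number of vertices that are not settled yet. -/
def openCount (L : List (Fin 4)) : ℕ := L.count 2 + L.count 3

/-- The exponent is the measure, budget plus number of vertices with label 3. The factor with
`openCount` accounts for the depth of the search, including steps that leave the measure unchanged,
and `base ^ 4` clears the negative powers in the branching inequalities. -/
noncomputable def bound (L : List (Fin 4)) (k : ℕ) : ℝ :=
  (openCount L + 1) * (2 * base ^ 4 * base ^ (k + L.count 3) - 1)

variable [DecidableRel G.Adj]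

/-- The search solves the instance in the required time. -/
def Solves (L : List (Fin 4)) (k : ℕ) : Prop :=
  ∃ r t, RulesRun rules (rows G) rules L k r t ∧ Good G L k r ∧
    (t : ℝ) ≤ nodeCost rules n * bound L k

variable {G}

/-- The number `m o` is the drop of the measure at the child `o`, and `hm` is the branching
inequality `∑ base ^ (-m o) ≤ 1` multiplied by `base ^ 4`. The decrease of `openCount` by at least
one pays for the work at the node itself. -/
theorem solves_of_node {L : List (Fin 4)} {k : ℕ}
    (ih : ∀ L' k', L'.length = L.length → openCount L' < openCount L → P4Free G (cls n L' 2) →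
      Solves G L' k')
    {pre post : List Rule} {ρ : Rule} (hr : rules = pre ++ ρ :: post)
    (hpre : ∀ ρ' ∈ pre, ρ'.cond.run (rows G) L [] = none) {e : List ℕ}
    (he : ρ.cond.run (rows G) L [] = some e) (hlt : ∀ a ∈ e, a < n)
    (m : List (Fin 4 × ℕ) → ℕ) (hm : (ρ.children.map fun o => base ^ (4 - m o)).sum ≤ base ^ 4)
    (hkids : ∀ o ∈ ρ.children, m o ≤ 4 ∧ ∀ L' k', applyOps e o L k = some (L', k') →
      L'.length = L.length ∧ L'.count 0 + k' ≤ L.count 0 + k ∧ openCount L' < openCount L ∧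
      P4Free G (cls n L' 2) ∧ k' + L'.count 3 + m o ≤ k + L.count 3)
    (hfeas : Feasible G L k → ∃ o ∈ ρ.children, ∃ L' k', applyOps e o L k = some (L', k') ∧
      Feasible G L' k') : Solves G L k := by
  set y := base ^ (k + L.count 3) with hy
  have hy1 : 1 ≤ y := one_le_pow₀ one_le_base
  have hb := one_le_base
  set w : List (Fin 4 × ℕ) → ℝ := fun o => openCount L * (2 * y * base ^ (4 - m o) - 1) with hw
  have hfac : ∀ j : ℕ, 0 ≤ 2 * y * base ^ j - 1 := fun j => by
    have : 1 ≤ base ^ j := one_le_pow₀ hb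
    nlinarith
  have hβ : (0 : ℝ) ≤ openCount L := Nat.cast_nonneg _
  obtain ⟨r, s, hrun, hs, hnone, hsome⟩ := kids_run rules (rows G) (e := e)
    (by rwa [rows_length]) L k (Good G) w (P := nodeCost rules n) (Nat.cast_nonneg _) ρ.children
    (fun o ho => ⟨mul_nonneg hβ (hfac _), fun L' k' hL' => by
      obtain ⟨hm4, hk⟩ := hkids o ho
      obtain ⟨h1, -, h3, h4, h5⟩ := hk L' k' hL'
      obtain ⟨r, t, hR, hG, ht⟩ := ih L' k' h1 h3 h4
      refine ⟨r, t, hR, hG, ht.trans (mul_le_mul_of_nonneg_left ?_ (Nat.cast_nonneg _))⟩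
      have hpow : base ^ 4 * base ^ (k' + L'.count 3) ≤ y * base ^ (4 - m o) := by
        rw [hy, ← pow_add, ← pow_add]
        exact pow_le_pow_right₀ hb (by omega)
      have h6 : ((openCount L' : ℝ) + 1) ≤ openCount L := by exact_mod_cast h3
      exact mul_le_mul h6 (by linarith) (by
        have := mul_nonneg (pow_nonneg (zero_le_one.trans hb) 4)
          (pow_nonneg (zero_le_one.trans hb) (k' + L'.count 3))
        have : 1 ≤ base ^ 4 * base ^ (k' + L'.count 3) := by
          rw [← pow_add]; exact one_le_pow₀ hb
        linarith) hβ⟩)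
  obtain ⟨t, hrun', ht⟩ := rules_some rules (rows G) L k pre post ρ hpre he hrun
  rw [← hr] at hrun' ht
  rw [rows_length] at ht hs
  refine ⟨r, t, hrun', ⟨fun hr0 hF => ?_, fun R hR => ?_⟩, ?_⟩
  · obtain ⟨o, ho, L', k', hL', hF'⟩ := hfeas hF
    exact (hnone hr0 o ho L' k' hL').1 rfl hF'
  · obtain ⟨o, ho, L', k', hL', hG⟩ := hsome R hR
    obtain ⟨h1, h2, -⟩ := (hkids o ho).2 L' k' hL'
    obtain ⟨h3, h4, h5⟩ := hG.2 R rfl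
    exact ⟨h3.trans h1, h4, h5.trans h2⟩
  · have hsum : (ρ.children.map w).sum ≤ openCount L * (2 * y * base ^ 4 - 1) := by
      have : ∀ ch : List (List (Fin 4 × ℕ)), (ch.map w).sum =
          openCount L * (2 * y * (ch.map fun o => base ^ (4 - m o)).sum - ch.length) := by
        intro ch
        induction ch with
        | nil => simp
        | cons o ch ih' =>
          rw [List.map_cons, List.sum_cons, ih', List.map_cons, List.sum_cons, List.length_cons]
          simp only [hw]
          push_cast
          ring
      rcases hch : ρ.children with _ | ⟨o, ch⟩
      · simpa using mul_nonneg hβ (hfac 4)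
      · rw [← hch, this]
        refine mul_le_mul_of_nonneg_left ?_ hβ
        have h1 : (1 : ℝ) ≤ ρ.children.length := by rw [hch]; simp
        have := mul_le_mul_of_nonneg_left hm (by linarith : 0 ≤ 2 * y)
        linarith
    have hP : (0 : ℝ) ≤ nodeCost rules n := Nat.cast_nonneg _
    have hcost : (rulesCost rules n : ℝ) + kidsCost rules ρ.children n ≤ nodeCost rules n := by
      have := kidsCost_le rules n (ρ := ρ) (rs' := rules) (by rw [hr]; simp)
      have h2 : rulesCost rules n + kidsCost rules ρ.children n ≤ nodeCost rules n := by
        unfold nodeCost; omega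
      exact_mod_cast h2
    have ht' : (t : ℝ) ≤ rulesCost rules n + s := by exact_mod_cast ht
    -- The bound is `openCount + 1` times a quantity that is at least 1; the children use only
    -- `openCount` of these shares.
    have h1 : (1 : ℝ) + (ρ.children.map w).sum ≤ bound L k := by
      have h4 : 1 ≤ base ^ 4 := one_le_pow₀ hb
      have h5 : 1 ≤ y * base ^ 4 := by nlinarith
      unfold bound
      rw [← hy]
      nlinarith
    nlinarith [mul_le_mul_of_nonneg_left h1 hP]

theorem solves_of_dels {L : List (Fin 4)} {k : ℕ}
    (ih : ∀ L' k', L'.length = L.length → openCount L' < openCount L → P4Free G (cls n L' 2) →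
      Solves G L' k') (hB : P4Free G (cls n L 2)) (hU : cls n L 3 = ∅)
    {pre post : List Rule} {ρ : Rule} (hr : rules = pre ++ ρ :: post)
    (hpre : ∀ ρ' ∈ pre, ρ'.cond.run (rows G) L [] = none) {vs : List (Fin n)}
    (he : ρ.cond.run (rows G) L [] = some (vs.map Fin.val)) (Ds : List (List ℕ))
    (hch : ρ.children = Ds.map dels)
    (hm : (Ds.map fun D => base ^ (4 - D.length)).sum ≤ base ^ 4)
    (hD : ∀ D ∈ Ds, D ≠ [] ∧ D.length ≤ 4 ∧ (D.map ((vs.map Fin.val).getD · 0)).Nodup ∧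
      ∀ a ∈ D.map ((vs.map Fin.val).getD · 0), ∃ x ∈ cls n L 2, a = x.val)
    (hsol : ∀ S : Finset (Fin n), Sol G (cls n L 1) (cls n L 2) S →
      ∃ S' : Finset (Fin n), Sol G (cls n L 1) (cls n L 2) S' ∧ S'.card ≤ S.card ∧
        ∃ D ∈ Ds, ∀ x : Fin n, x.val ∈ D.map ((vs.map Fin.val).getD · 0) → x ∈ S') :
    Solves G L k := by
  refine solves_of_node ih hr hpre he (by simp) List.length ?_ ?_ ?_
  · rw [hch, List.map_map]
    refine le_of_eq_of_le ?_ hm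
    simp [Function.comp_def, dels]
  · rw [hch]
    intro o ho
    obtain ⟨D, hDs, rfl⟩ := List.mem_map.1 ho
    obtain ⟨hne, h4, hn, hx⟩ := hD D hDs
    refine ⟨by simpa [dels] using h4, fun L' k' hL' => ?_⟩
    rw [applyOps_dels] at hL'
    split_ifs at hL' with hk
    simp only [Option.some.injEq, Prod.mk.injEq] at hL'
    obtain ⟨rfl, rfl⟩ := hL'
    have hx2 : ∀ a ∈ D.map ((vs.map Fin.val).getD · 0), label L a = 2 := fun a ha => by
      obtain ⟨x, hx, rfl⟩ := hx a ha; exact hx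
    have hcount := count_wipe (c := 2) (by decide) hn hx2
    have hc0 := hcount 0
    have hc2 := hcount 2
    have hc3 := hcount 3
    have hpos := List.length_pos_iff.2 hne
    rw [if_neg (by decide), if_pos rfl, List.length_map] at hc0
    rw [if_pos rfl, if_neg (by decide), List.length_map] at hc2
    rw [if_neg (by decide), if_neg (by decide)] at hc3
    have hlen : (dels D).length = D.length := by simp [dels]
    refine ⟨length_wipe _ _, ?_, ?_, hB.mono fun v hv => ?_, ?_⟩
    · omega
    · unfold openCount; omega
    · rw [cls, Set.mem_ofPred_eq, label_wipe hn (fun a ha => by rw [hx2 a ha]; decide)] at hv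
      split_ifs at hv
      · exact absurd hv (by decide)
      · exact hv
    · omega
  · intro hF
    obtain ⟨S, hk, hS⟩ := hF.exists_sol hU
    obtain ⟨S', hS', hk', D, hDs, hDS⟩ := hsol S hS
    obtain ⟨hne, h4, hn, hx⟩ := hD D hDs
    have hx2 : ∀ a ∈ D.map ((vs.map Fin.val).getD · 0), label L a = 2 := fun a ha => by
      obtain ⟨x, hx, rfl⟩ := hx a ha; exact hx
    obtain ⟨h1, h2⟩ := feasible_wipe G (k := k) (c := 2) (by decide) hn hx2
      (fun a ha => by obtain ⟨x, hx, rfl⟩ := hx a ha; exact x.isLt) (hk'.trans hk)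
      (by rwa [hU, Set.union_empty]) hDS
    rw [List.length_map] at h1 h2
    refine ⟨dels D, by rw [hch]; exact List.mem_map_of_mem hDs, _, _, ?_, h2⟩
    rw [applyOps_dels, if_pos h1]

end

end FourPath

namespace FourPath

open TreeProg

section

variable {n : ℕ} {G : SimpleGraph (Fin n)} [DecidableRel G.Adj]

/-! ### The search is correct and fast -/

theorem solves_of_undecided {L : List (Fin 4)} {k : ℕ}
    (ih : ∀ L' k', L'.length = L.length → openCount L' < openCount L → P4Free G (cls n L' 2) →
      Solves G L' k') (hB : P4Free G (cls n L 2))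
    {pre post : List Rule} {ρ : Rule} (hr : rules = pre ++ ρ :: post)
    (hpre : ∀ ρ' ∈ pre, ρ'.cond.run (rows G) L [] = none) {u : Fin n} (hu : u ∈ cls n L 3)
    (he : ρ.cond.run (rows G) L [] = some [u.val]) (hch : ρ.children = [dels [0], [(1, 0)]]) :
    Solves G L k := by
  have hu3 : label L u.val = 3 := hu
  have hu0 : label L u.val ≠ 0 := by rw [hu3]; decide
  have hx : ∀ a ∈ [u.val], label L a = 3 := by simpa using hu3
  have hn : [u.val].Nodup := by simp
  have hdel : applyOps [u.val] (dels [0]) L k =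
      if 1 ≤ k then some (wipe L [u.val], k - 1) else none := applyOps_dels _ _ _ _
  have hkeep : applyOps [u.val] [(1, 0)] L k = some (L.set u.val 1, k) := applyOps_keep _ _ _ _
  -- This is the golden-ratio inequality: deletion lowers both the budget and the number of
  -- 3-labels, keeping lowers only the latter.
  have hb : base ^ 2 + base ^ 3 ≤ base ^ 4 := by norm_num [base]
  have hdk : dels [0] ≠ [(1, 0)] := by decide
  refine solves_of_node ih hr hpre he (by simp) (fun o => if o = dels [0] then 2 else 1) ?_ ?_ ?_
  · rw [hch]
    simpa [hdk.symm] using hb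
  · rw [hch]
    simp only [List.mem_cons, List.not_mem_nil, or_false, forall_eq_or_imp, forall_eq, if_pos,
      if_neg hdk.symm, hdel, hkeep]
    refine ⟨⟨by norm_num, fun L' k' h => ?_⟩, by norm_num, fun L' k' h => ?_⟩
    · split_ifs at h with hk
      simp only [Option.some.injEq, Prod.mk.injEq] at h
      obtain ⟨rfl, rfl⟩ := h
      have hcount := count_wipe (c := 3) (by decide) hn hx
      have hc0 := hcount 0
      have hc2 := hcount 2
      have hc3 := hcount 3
      rw [if_neg (by decide), if_pos rfl, List.length_singleton] at hc0
      rw [if_neg (by decide), if_neg (by decide)] at hc2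
      rw [if_pos rfl, if_neg (by decide), List.length_singleton] at hc3
      refine ⟨length_wipe _ _, by omega, by unfold openCount; omega, hB.mono fun v hv => ?_,
        by omega⟩
      rw [cls, Set.mem_ofPred_eq, label_wipe hn (fun a ha => by rw [hx a ha]; decide)] at hv
      split_ifs at hv
      · exact absurd hv (by decide)
      · exact hv
    · simp only [Option.some.injEq, Prod.mk.injEq] at h
      obtain ⟨rfl, rfl⟩ := h
      have hcount := fun d => count_set_label 1 d hu0
      simp only [hu3] at hcount
      have hc0 := hcount 0
      have hc2 := hcount 2
      have hc3 := hcount 3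
      rw [if_neg (by decide), if_neg (by decide)] at hc0 hc2
      rw [if_pos rfl, if_neg (by decide)] at hc3
      refine ⟨by simp, by omega, by unfold openCount; omega, hB.mono fun v hv => ?_, by omega⟩
      rw [cls, Set.mem_ofPred_eq, label_set 1 hu0] at hv
      split_ifs at hv
      · exact absurd hv (by decide)
      · exact hv
  · rintro ⟨S, hk, hS⟩
    rw [hch]
    by_cases huS : u ∈ S
    · obtain ⟨h1, h2⟩ := feasible_wipe G (by decide) hn hx (by simp) hk hS (by
        simpa [Fin.val_inj] using huS)
      rw [List.length_singleton] at h1 h2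
      exact ⟨dels [0], by simp, _, _, by rw [hdel, if_pos h1], h2⟩
    · refine ⟨[(1, 0)], by simp, _, _, hkeep, S, hk, hS.mono ?_⟩
      rintro v (hv | ⟨hv, hvS⟩)
      · rw [cls, Set.mem_ofPred_eq, label_set 1 hu0] at hv
        split_ifs at hv with h
        · rw [Fin.ext h]
          exact Or.inr ⟨Or.inr hu, huS⟩
        · exact Or.inl hv
      · refine Or.inr ⟨?_, hvS⟩
        simp only [cls, Set.mem_union, Set.mem_ofPred_eq, label_set 1 hu0] at hv ⊢
        split_ifs at hv
        · exact absurd hv (by decide)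
        · exact hv

theorem solves_of_redundant {L : List (Fin 4)} {k : ℕ}
    (ih : ∀ L' k', L'.length = L.length → openCount L' < openCount L → P4Free G (cls n L' 2) →
      Solves G L' k') (hB : P4Free G (cls n L 2)) (hU : cls n L 3 = ∅)
    (h1 : ∀ x ∈ cls n L 2, ¬ Conf G (cls n L 1) x x x)
    {pre post : List Rule} {ρ : Rule} (hr : rules = pre ++ ρ :: post)
    (hpre : ∀ ρ' ∈ pre, ρ'.cond.run (rows G) L [] = none) {z t : Fin n} (hz : z ∈ cls n L 2)
    (hE : ∀ p q, Ess G (cls n L 1) (cls n L 2) z p q → p = t ∨ q = t)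
    (he : ρ.cond.run (rows G) L [] = some [t.val, z.val]) (hch : ρ.children = [[(1, 1)]]) :
    Solves G L k := by
  have hz2 : label L z.val = 2 := hz
  have hz0 : label L z.val ≠ 0 := by rw [hz2]; decide
  have hkeep : applyOps [t.val, z.val] [(1, 1)] L k = some (L.set z.val 1, k) :=
    applyOps_keep _ _ _ _
  -- Keeping a vertex of B does not change the measure; only `openCount` decreases.
  refine solves_of_node ih hr hpre he (by simp) (fun _ => 0) ?_ ?_ ?_
  · rw [hch]
    simp
  · rw [hch]
    simp only [List.mem_cons, List.not_mem_nil, or_false, forall_eq, hkeep]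
    refine ⟨by norm_num, fun L' k' h => ?_⟩
    simp only [Option.some.injEq, Prod.mk.injEq] at h
    obtain ⟨rfl, rfl⟩ := h
    have hcount := fun d => count_set_label 1 d hz0
    simp only [hz2] at hcount
    have hc0 := hcount 0
    have hc2 := hcount 2
    have hc3 := hcount 3
    rw [if_neg (by decide), if_neg (by decide)] at hc0 hc3
    rw [if_pos rfl, if_neg (by decide)] at hc2
    refine ⟨by simp, by omega, by unfold openCount; omega, hB.mono fun v hv => ?_, by omega⟩
    rw [cls, Set.mem_ofPred_eq, label_set 1 hz0] at hv
    split_ifs at hv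
    · exact absurd hv (by decide)
    · exact hv
  · intro hF
    obtain ⟨S, hk, hS⟩ := hF.exists_sol hU
    obtain ⟨S', hS', hk', hzS⟩ := hS.keep hB (h1 z hz) hE
    rw [hch]
    refine ⟨_, by simp, _, _, hkeep, S', hk'.trans hk, hS'.mono ?_⟩
    rintro v (hv | ⟨hv, hvS⟩)
    · rw [cls, Set.mem_ofPred_eq, label_set 1 hz0] at hv
      split_ifs at hv with h
      · rw [Fin.ext h]
        exact Or.inr ⟨hz, hzS⟩
      · exact Or.inl hv
    · refine Or.inr ⟨?_, hvS⟩
      rcases hv with hv | hv <;> rw [cls, Set.mem_ofPred_eq, label_set 1 hz0] at hv <;>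
        split_ifs at hv
      · exact absurd hv (by decide)
      · exact hv
      · exact absurd hv (by decide)
      · exact (hU ▸ hv : v ∈ (∅ : Set (Fin n))).elim

theorem solves_of_final {L : List (Fin 4)} {k : ℕ}
    (hirr : Irreducible G (cls n L 1) (cls n L 2)) (hU : cls n L 3 = ∅)
    (hnone : ∀ ρ ∈ rules, ρ.cond.run (rows G) L [] = none) : Solves G L k := by
  have hfin : ∀ x ∈ cls n L 2, ¬ (Center G (cls n L 2) x ∨ Paired G (cls n L 1) (cls n L 2) x) :=
    fun x hx h => run_exs_none G L 1 (hnone ⟨exs 1 .final, [dels [0]]⟩ (by simp [rules])) [x] rfl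
      (Formula.sat_final.2 ⟨hx, h⟩)
  obtain ⟨t, hrun, ht⟩ := rules_none rules (rows G) L k rules hnone
  rw [rows_length] at ht
  refine ⟨some L, t, hrun, ⟨by simp, fun R hR => ?_⟩, ?_⟩
  · cases hR
    refine ⟨rfl, (hirr.free_of_no_pair (fun c hc h => hfin c hc (.inl h))
      (fun u hu h => hfin u hu (.inr h))).mono fun v hv => ?_, by omega⟩
    have h3 : label L v.val ≠ 3 := fun h => (hU ▸ (h : v ∈ cls n L 3) : v ∈ (∅ : Set _)).elim
    have : ∀ c : Fin 4, c ≠ 0 → c ≠ 3 → c = 1 ∨ c = 2 := by decide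
    exact this _ hv h3
  · have h1 : (t : ℝ) ≤ nodeCost rules n := by
      have : t ≤ nodeCost rules n := by unfold nodeCost; omega
      exact_mod_cast this
    have h2 : 1 ≤ base ^ 4 * base ^ (k + L.count 3) := by
      rw [← pow_add]; exact one_le_pow₀ one_le_base
    have h3 : (0 : ℝ) ≤ openCount L := Nat.cast_nonneg _
    have h4 : 1 ≤ bound L k := by unfold bound; nlinarith
    exact h1.trans (le_mul_of_one_le_right (Nat.cast_nonneg _) h4)

/-- Each rule either has a witness, and its soundness lemma applies, or it fails and contributes a
property to `Irreducible`, on which the last rule rests. -/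
theorem solves_step {L : List (Fin 4)} {k : ℕ}
    (ih : ∀ L' k', L'.length = L.length → openCount L' < openCount L → P4Free G (cls n L' 2) →
      Solves G L' k') (hB : P4Free G (cls n L 2)) : Solves G L k := by
  rcases h0 : (exs 0 Formula.freeA).run (rows G) L [] with _ | e
  swap
  · obtain ⟨vs, hlen, rfl, hsat⟩ := run_exs_some G L 0 h0
    refine solves_of_node ih (pre := []) rfl (by simp) h0 (by simp) List.length
      (by simpa using pow_nonneg (zero_le_one.trans one_le_base) 4) (by simp) ?_
    rintro ⟨S, -, hS⟩
    exact absurd hS.free_left (Formula.sat_freeA.1 hsat)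
  have hA : P4Free G (cls n L 1) := by
    by_contra h
    exact run_exs_none G L 0 h0 [] rfl (Formula.sat_freeA.2 h)
  rcases h1 : (exs 1 (Formula.lab 3 0)).run (rows G) L [] with _ | e
  swap
  · obtain ⟨vs, hlen, rfl, hsat⟩ := run_exs_some G L 1 h1
    obtain ⟨u, rfl⟩ := List.length_eq_one_iff.1 hlen
    exact solves_of_undecided ih hB (pre := [_]) rfl (by simpa using h0)
      ((Formula.sat_lab (G := G) 3 rfl).1 hsat) h1 rfl
  have hU : cls n L 3 = ∅ := Set.eq_empty_of_forall_notMem fun u hu =>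
    run_exs_none G L 1 h1 [u] rfl ((Formula.sat_lab (G := G) 3 rfl).2 hu)
  rcases h2 : (exs 1 Formula.single).run (rows G) L [] with _ | e
  swap
  · obtain ⟨vs, hlen, rfl, hsat⟩ := run_exs_some G L 1 h2
    obtain ⟨x, rfl⟩ := List.length_eq_one_iff.1 hlen
    obtain ⟨hx, hc⟩ := Formula.sat_single.1 hsat
    refine solves_of_dels ih hB hU (pre := [_, _]) (vs := [x]) rfl
      (by simp [h0, h1]) h2 [[0]] rfl
      (by norm_num [base]) (by simpa [Fin.val_inj] using hx) fun S hS => ⟨S, hS, le_rfl, [0], by simp, ?_⟩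
    have := hS.hits hx hx hx hc
    simpa [Fin.val_inj] using this
  have hsingle : ∀ x ∈ cls n L 2, ¬ Conf G (cls n L 1) x x x := fun x hx hc =>
    run_exs_none G L 1 h2 [x] rfl (Formula.sat_single.2 ⟨hx, hc⟩)
  rcases h3 : (exs 2 Formula.redundant).run (rows G) L [] with _ | e
  swap
  · obtain ⟨vs, hlen, rfl, hsat⟩ := run_exs_some G L 2 h3
    obtain ⟨t, z, rfl⟩ := List.length_eq_two.1 hlen
    obtain ⟨hz, -, hE⟩ := Formula.sat_redundant.1 hsat
    exact solves_of_redundant ih hB hU hsingle (pre := [_, _, _]) rfl (by simp [h0, h1, h2]) hz hE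
      h3 rfl
  rcases h4 : (exs 4 Formula.branch).run (rows G) L [] with _ | e
  swap
  · obtain ⟨vs, hlen, rfl, hsat⟩ := run_exs_some G L 4 h4
    obtain ⟨b₂, b₁, y, x, rfl⟩ : ∃ a b c d, vs = [a, b, c, d] :=
      match vs, hlen with
      | [a, b, c, d], _ => ⟨a, b, c, d, rfl⟩
    obtain ⟨hx, hy, hb₁, hb₂, hne, hd, hc₁, hc₂⟩ := Formula.sat_branch.1 hsat
    refine solves_of_dels ih hB hU (pre := [_, _, _, _]) (vs := [b₂, b₁, y, x]) rfl
      (by simp [h0, h1, h2, h3]) h4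
      [[3], [1, 0]] rfl (by norm_num [base]) ?_ fun S hS => ?_
    · simpa [Fin.val_inj, hne] using ⟨hx, hb₁, hb₂⟩
    · obtain ⟨S', hS', hk, hxS | ⟨h₁, h₂⟩⟩ := hS.branch hB hx hy hb₁ hb₂ (hsingle y hy) hd hc₁ hc₂
      · exact ⟨S', hS', hk, [3], by simp, by simpa [Fin.val_inj] using hxS⟩
      · exact ⟨S', hS', hk, [1, 0], by simp, by simpa [Fin.val_inj] using ⟨h₁, h₂⟩⟩
  rcases h5 : (exs 7 Formula.three).run (rows G) L [] with _ | e
  swap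
  · obtain ⟨vs, hlen, rfl, hsat⟩ := run_exs_some G L 7 h5
    obtain ⟨v₃, v₂, v₁, u₃, u₂, u₁, c, rfl⟩ : ∃ a b c d e f g, vs = [a, b, c, d, e, f, g] :=
      match vs, hlen with
      | [a, b, c, d, e, f, g], _ => ⟨a, b, c, d, e, f, g, rfl⟩
    obtain ⟨hc, hu₁, hu₂, hu₃, hv₁, hv₂, hv₃, hT⟩ := Formula.sat_three.1 hsat
    have hN := hT.1
    refine solves_of_dels ih hB hU (pre := [_, _, _, _, _]) (vs := [v₃, v₂, v₁, u₃, u₂, u₁, c]) rfl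
      (by simp [h0, h1, h2, h3, h4]) h5
      [[6, 2, 1, 0], [5], [4, 3, 2]] rfl (by norm_num [base]) ?_ fun S hS => ?_
    · simp only [List.nodup_cons, List.mem_cons, List.not_mem_nil, or_false, not_or] at hN
      simp [Fin.val_inj, hc, hu₁, hu₂, hu₃, hv₁, hv₂, hv₃, hN]
    · obtain ⟨S', hS', hk, hm | hm | hm⟩ :=
        hS.threePaired hB hsingle hc hu₁ hu₂ hu₃ hv₁ hv₂ hv₃ hT
      · exact ⟨S', hS', hk, [6, 2, 1, 0], by simp, by simpa [Fin.val_inj] using hm⟩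
      · exact ⟨S', hS', hk, [5], by simp, by simpa [Fin.val_inj] using hm⟩
      · exact ⟨S', hS', hk, [4, 3, 2], by simp, by simpa [Fin.val_inj] using hm⟩
  rcases h6 : (exs 7 Formula.two).run (rows G) L [] with _ | e
  swap
  · obtain ⟨vs, hlen, rfl, hsat⟩ := run_exs_some G L 7 h6
    obtain ⟨b, v₂, v₁, l, u₂, u₁, c, rfl⟩ : ∃ a b c d e f g, vs = [a, b, c, d, e, f, g] :=
      match vs, hlen with
      | [a, b, c, d, e, f, g], _ => ⟨a, b, c, d, e, f, g, rfl⟩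
    obtain ⟨hc, hu₁, hu₂, hl, hv₁, hv₂, hb, hT⟩ := Formula.sat_two.1 hsat
    have hN := hT.1
    refine solves_of_dels ih hB hU (pre := [_, _, _, _, _, _]) (vs := [b, v₂, v₁, l, u₂, u₁, c]) rfl
      (by simp [h0, h1, h2, h3, h4, h5]) h6 [[6, 2, 1], [5, 4, 0], [5, 1, 3], [2, 4, 3]] rfl
      (by norm_num [base]) ?_ fun S hS => ?_
    · simp only [List.nodup_cons, List.mem_cons, List.not_mem_nil, or_false, not_or] at hN
      simp only [← ne_eq] at hN
      simp [Fin.val_inj, hc, hu₁, hu₂, hl, hv₁, hv₂, hb]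
      grind
    · obtain ⟨S', hS', hk, hm | hm | hm | hm⟩ :=
        hS.twoPaired hB hsingle hc hu₁ hu₂ hl hv₁ hv₂ hb hT
      · exact ⟨S', hS', hk, [6, 2, 1], by simp, by simpa [Fin.val_inj] using hm⟩
      · exact ⟨S', hS', hk, [5, 4, 0], by simp, by simpa [Fin.val_inj] using hm⟩
      · exact ⟨S', hS', hk, [5, 1, 3], by simp, by simpa [Fin.val_inj] using hm⟩
      · exact ⟨S', hS', hk, [2, 4, 3], by simp, by simpa [Fin.val_inj] using hm⟩
  have hirr : Irreducible G (cls n L 1) (cls n L 2) := {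
    disj := fun v (h1 : label L v.val = 1) (h2 : label L v.val = 2) =>
      absurd (h1.symm.trans h2) (by decide)
    freeA := hA
    freeB := hB
    single := hsingle
    avoid := fun z hz t ht => by
      by_contra! h
      refine run_exs_none G L 2 h3 [t, z] rfl (Formula.sat_redundant.2 ⟨hz, ht, fun p q hpq => ?_⟩)
      by_contra! h'
      exact h'.2 (h p q hpq h'.1)
    branch := fun x hx y hy b₁ hb₁ b₂ hb₂ hd hc₁ hc₂ => by
      by_contra hne
      exact run_exs_none G L 4 h4 [b₂, b₁, y, x] rfl
        (Formula.sat_branch.2 ⟨hx, hy, hb₁, hb₂, hne, hd, hc₁, hc₂⟩)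
    noThree := fun c hc u₁ hu₁ u₂ hu₂ u₃ hu₃ v₁ hv₁ v₂ hv₂ v₃ hv₃ hT =>
      run_exs_none G L 7 h5 [v₃, v₂, v₁, u₃, u₂, u₁, c] rfl
        (Formula.sat_three.2 ⟨hc, hu₁, hu₂, hu₃, hv₁, hv₂, hv₃, hT⟩)
    noTwo := fun c hc u₁ hu₁ u₂ hu₂ l hl v₁ hv₁ v₂ hv₂ b hb hT =>
      run_exs_none G L 7 h6 [b, v₂, v₁, l, u₂, u₁, c] rfl
        (Formula.sat_two.2 ⟨hc, hu₁, hu₂, hl, hv₁, hv₂, hb, hT⟩) }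
  rcases h7 : (exs 1 Formula.final).run (rows G) L [] with _ | e
  swap
  · obtain ⟨vs, hlen, rfl, hsat⟩ := run_exs_some G L 1 h7
    obtain ⟨x, rfl⟩ := List.length_eq_one_iff.1 hlen
    obtain ⟨hx, hc⟩ := Formula.sat_final.1 hsat
    refine solves_of_dels ih hB hU (pre := [_, _, _, _, _, _, _]) (vs := [x]) rfl
      (by simp [h0, h1, h2, h3, h4, h5, h6]) h7 [[0]] rfl (by norm_num [base])
      (by simpa [Fin.val_inj] using hx) fun S hS => ?_
    obtain ⟨S', hS', hk, hxS⟩ := hirr.exists_sol_mem hS hx hc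
    exact ⟨S', hS', hk, [0], by simp, by simpa [Fin.val_inj] using hxS⟩
  exact solves_of_final hirr hU (by simp [rules, h0, h1, h2, h3, h4, h5, h6, h7])

theorem solves (m : ℕ) : ∀ (L : List (Fin 4)) (k : ℕ), openCount L = m →
    P4Free G (cls n L 2) → Solves G L k := by
  induction m using Nat.strong_induction_on with
  | _ m ih =>
    rintro L k rfl hB
    exact solves_step (fun L' k' _ h hB' => ih _ h L' k' rfl hB') hB

end

end FourPath

namespace FourPath

open TreeProg

/-! ### Adding the vertices one by one -/

theorem IsP4.of_walk {V : Type*} {G : SimpleGraph V} {u v : V} (w : G.Walk u v) (hw : w.IsPath)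
    (hl : w.support.length = 4) : ∃ p q r s, IsP4 G p q r s ∧ w.support = [p, q, r, s] := by
  match w, hw, hl with
  | .cons (v := q) h₁ (.cons (v := r) h₂ (.cons h₃ .nil)), hw, _ =>
    refine ⟨_, q, r, _, ?_, rfl⟩
    have hn := hw.support_nodup
    simp only [SimpleGraph.Walk.support_cons, SimpleGraph.Walk.support_nil, List.nodup_cons,
      List.mem_cons, List.not_mem_nil, or_false, not_or] at hn
    exact ⟨h₁, h₂, h₃, hn.1.2.1, hn.1.2.2, hn.2.1.2⟩
  | .cons _ (.cons _ (.cons _ (.cons _ w))), _, hl =>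
    have := w.length_support
    simp only [SimpleGraph.Walk.support_cons, List.length_cons] at hl
    omega

theorem isPathVertexCover_four_iff {V : Type*} {G : SimpleGraph V} {S : Finset V} :
    IsPathVertexCover G 4 S ↔ P4Free G {v | v ∉ S} := by
  constructor
  · rintro h p q r s hp hq hr hs ⟨h₁, h₂, h₃, n₁, n₂, n₃⟩
    obtain ⟨x, hx, hxS⟩ := h p s (.cons h₁ (.cons h₂ (.cons h₃ .nil)))
      (by simp [SimpleGraph.Walk.isPath_def, h₁.ne, h₂.ne, h₃.ne, n₁, n₂, n₃]) rfl
    simp only [SimpleGraph.Walk.support_cons, SimpleGraph.Walk.support_nil, List.mem_cons,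
      List.not_mem_nil, or_false] at hx
    rcases hx with rfl | rfl | rfl | rfl
    exacts [hp hxS, hq hxS, hr hxS, hs hxS]
  · intro h u v w hw hl
    obtain ⟨p, q, r, s, hP, hsup⟩ := IsP4.of_walk w hw hl
    by_contra! hn
    exact h p q r s (hn p (by simp [hsup])) (hn q (by simp [hsup])) (hn r (by simp [hsup]))
      (hn s (by simp [hsup])) hP

theorem length_relabel (L : List (Fin 4)) : (relabel L).length = L.length + 1 := by
  induction L with
  | nil => rfl
  | cons c L ih => simp [relabel, ih]

theorem label_relabel (L : List (Fin 4)) : ∀ v, label (relabel L) v =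
    if v < L.length then (if label L v = 0 then 3 else 2) else if v = L.length then 3 else 0 := by
  induction L with
  | nil =>
    rintro (_ | v) <;> simp [relabel, label]
  | cons c L ih =>
    rintro (_ | v)
    · simp [relabel, label]
    · simpa [relabel, label] using ih v

theorem count_relabel (L : List (Fin 4)) : (relabel L).count 0 = 0 ∧
    (relabel L).count 3 = L.count 0 + 1 ∧ openCount (relabel L) = L.length + 1 := by
  unfold openCount
  induction L with
  | nil => decide
  | cons c L ih =>
    by_cases hc : c = 0
    · simp [relabel, hc]; omega
    · simp [relabel, hc]; omega

section

variable {n : ℕ} {G : SimpleGraph (Fin n)}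

theorem card_label_eq (L : List (Fin 4)) (h : L.length = n) (c : Fin 4) :
    (Finset.univ.filter fun v : Fin n => label L v.val = c).card = L.count c := by
  refine Eq.trans ?_ (Fin.card_filter_univ_eq_vector_get_eq_count c ⟨L, h⟩)
  congr 1
  ext v
  have hv : v.val < L.length := h ▸ v.isLt
  simp [label, List.Vector.get, hv, eq_comm]

theorem hasPathVertexCover_of_labels {L : List (Fin 4)} {k : ℕ} (h : L.length = n)
    (hF : P4Free G {v : Fin n | label L v.val ≠ 0}) (hk : L.count 0 ≤ k) :
    HasPathVertexCover G 4 k := by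
  refine ⟨Finset.univ.filter fun v => label L v.val = 0, (card_label_eq L h 0).trans_le hk, ?_⟩
  refine isPathVertexCover_four_iff.2 (hF.mono fun v hv => ?_)
  simpa using hv

theorem feasible_of_hasPathVertexCover {k : ℕ} (h : HasPathVertexCover G 4 k) (L : List (Fin 4)) :
    Feasible G (relabel L) k := by
  obtain ⟨S, hk, hS⟩ := h
  refine ⟨S, hk, (isPathVertexCover_four_iff.1 hS).mono ?_⟩
  rintro v (hv | hv)
  · simp only [cls, Set.mem_ofPred_eq, label_relabel] at hv
    split_ifs at hv <;> exact absurd hv (by decide)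
  · exact hv.2

/-- The old cover has at most `k` vertices, so the measure is at most `2k + 1`. Here `base` is just
above the golden ratio, its square is at most 2.619, and 23 bounds `2 * base ^ 5`. -/
theorem bound_le {L : List (Fin 4)} {k : ℕ} (hL : L.length < n) (hk : L.count 0 ≤ k) :
    bound (relabel L) k ≤ (n + 1) * (23 * 2.619 ^ k) := by
  obtain ⟨-, h3, h2⟩ := count_relabel L
  unfold bound
  rw [h2, h3]
  have h1 : base ^ (k + (L.count 0 + 1)) ≤ base * 2.619 ^ k := by
    calc base ^ (k + (L.count 0 + 1)) ≤ base ^ (2 * k + 1) :=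
          pow_le_pow_right₀ one_le_base (by omega)
      _ = base * (base ^ 2) ^ k := by rw [pow_succ, pow_mul, mul_comm]
      _ ≤ base * 2.619 ^ k := mul_le_mul_of_nonneg_left
          (pow_le_pow_left₀ (sq_nonneg _) (by norm_num [base]) k) (by norm_num [base])
  have h4 : (0 : ℝ) ≤ 2.619 ^ k := by positivity
  have h5 : ((L.length + 1 : ℕ) : ℝ) + 1 ≤ n + 1 := by
    have : ((L.length + 1 : ℕ) : ℝ) ≤ n := by exact_mod_cast hL
    linarith
  have h6 : 2 * base ^ 4 * base ^ (k + (L.count 0 + 1)) - 1 ≤ 23 * 2.619 ^ k := by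
    have : 2 * base ^ 4 * base ≤ 23 := by norm_num [base]
    have h7 : 0 ≤ 2 * base ^ 4 := by norm_num [base]
    nlinarith [mul_le_mul_of_nonneg_left h1 h7, mul_le_mul_of_nonneg_right this h4]
  have h8 : 0 ≤ 23 * (2.619 : ℝ) ^ k := by positivity
  have h9 : (0 : ℝ) ≤ ((L.length + 1 : ℕ) : ℝ) + 1 := by positivity
  exact (mul_le_mul_of_nonneg_left h6 h9).trans (mul_le_mul_of_nonneg_right h5 h8)

variable [DecidableRel G.Adj]

/-- A bound for the steps that adding one vertex takes. -/
noncomputable def roundCost (n k : ℕ) : ℝ :=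
  nodeCost rules n * ((n + 1) * (23 * 2.619 ^ k)) + (40 * (n + 1) + qsize (encRules rules) + 100)

/-- The invariant is that the labels 0 form a cover of size at most `k` for the vertices added so
far; later vertices count as deleted. A failed compression answers "no", because a cover of `G`
would make the current stage feasible. -/
theorem eval_outer (k : ℕ) (vs : List ℕ) : ∀ L : List (Fin 4), vs.length + L.length = n →
    P4Free G {v : Fin n | label L v.val ≠ 0} → L.count 0 ≤ k →
    ∃ answer t, Eval (procs rules) [.cons (encEnv vs) (.cons (encMat (rows G))
        (.cons (encLab L) (.ofNat k)))] (outerBody rules) (.ofBool answer) t ∧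
      (answer = true ↔ HasPathVertexCover G 4 k) ∧ (t : ℝ) ≤ vs.length * roundCost n k + 20 := by
  induction vs with
  | nil =>
    intro L hlen hF hk
    refine ⟨true, _, .matchCons (.var rfl) (.matchNil (.var rfl) (.cons .nil .nil)), ?_, ?_⟩
    · simpa using hasPathVertexCover_of_labels (by simpa using hlen) hF hk
    · norm_num
  | cons a vs ih =>
    intro L hlen hF hk
    rw [List.length_cons] at hlen
    obtain ⟨t₁, h₁, ht₁⟩ := eval_relabel rules L
    obtain ⟨r, t₂, h₂, ⟨hnone, hsome⟩, ht₂⟩ := solves (G := G) _ (relabel L) k rfl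
      (hF.mono fun v hv => by
        simp only [cls, Set.mem_ofPred_eq, label_relabel] at hv ⊢
        split_ifs at hv with h1 h2
        · exact absurd hv (by decide)
        · exact h2
        · exact absurd hv (by decide)
        · exact absurd hv (by decide))
    have hq := eval_quote rules
    have hcost : (t₁ : ℝ) + t₂ + qsize (encRules rules) + 70 ≤ roundCost n k := by
      have h3 : (t₁ : ℝ) ≤ 40 * (n + 1) := by
        have : t₁ ≤ 40 * (n + 1) := by omega
        exact_mod_cast this
      have h4 := ht₂.trans (mul_le_mul_of_nonneg_left (bound_le (n := n) (by omega) hk)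
        (Nat.cast_nonneg _))
      unfold roundCost
      linarith
    have hround : 0 ≤ (vs.length : ℝ) * roundCost n k :=
      by
      have : (0 : ℝ) ≤ qsize (encRules rules) := Nat.cast_nonneg _
      have : (0 : ℝ) ≤ t₁ := Nat.cast_nonneg _
      have : (0 : ℝ) ≤ t₂ := Nat.cast_nonneg _
      exact mul_nonneg (Nat.cast_nonneg _) (by linarith)
    rcases r with _ | R
    · refine ⟨false, _, .matchCons (.var rfl) (.matchCons (.var rfl) (.matchCons (.var rfl)
        (.matchCons (.var rfl) (.matchNil (.call (.cons (hq _ _) (.cons (.var rfl)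
          (.cons (.call (.var rfl) rfl h₁) (.var rfl)))) rfl h₂) .nil)))), ?_, ?_⟩
      · simpa using fun h => hnone rfl (feasible_of_hasPathVertexCover h L)
      · rw [List.length_cons]
        push_cast
        linarith
    · obtain ⟨hR, hRF, hRk⟩ := hsome R rfl
      rw [length_relabel] at hR
      rw [(count_relabel L).1] at hRk
      obtain ⟨answer, t₃, h₃, hans, ht₃⟩ := ih R (by omega) hRF (by omega)
      refine ⟨answer, _, .matchCons (.var rfl) (.matchCons (.var rfl) (.matchCons (.var rfl)
        (.matchCons (.var rfl) (.matchCons (.call (.cons (hq _ _) (.cons (.var rfl)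
          (.cons (.call (.var rfl) rfl h₁) (.var rfl)))) rfl h₂)
          (.call (.cons (.var rfl) (.cons (.var rfl) (.cons (.var rfl) (.var rfl)))) rfl h₃))))),
        hans, ?_⟩
      rw [List.length_cons]
      push_cast
      linarith

theorem halts (k : ℕ) : ∃ answer t,
    Program.HaltsWith ⟨procs rules, mainTerm⟩ (encodeInstance G k) (.ofBool answer) t ∧
      (answer = true ↔ HasPathVertexCover G 4 k) ∧
      (t : ℝ) ≤ n * roundCost n k + (20 * (n + 1) + 60) := by
  obtain ⟨t₁, h₁, ht₁⟩ := eval_range rules (rows G) 0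
  rw [← List.range_eq_range', encRows_rows, rows_length] at h₁
  obtain ⟨answer, t₂, h₂, hans, ht₂⟩ := eval_outer (G := G) k (List.range n) [] (by simp)
    (fun p _ _ _ hp _ _ _ _ => hp (by simp [label])) (by simp)
  rw [encMat, encRows_rows, rows_length] at h₂
  rw [rows_length] at ht₁
  rw [List.length_range] at ht₂
  refine ⟨answer, _, .matchCons (.var rfl) (.letIn (.call (.cons (.var rfl) .nil) rfl h₁)
    (.call (.cons (.var rfl) (.cons (.cons (.var rfl) (.var rfl)) (.cons .nil (.var rfl))))
      rfl h₂)), hans, ?_⟩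
  have : (t₁ : ℝ) ≤ 20 * (n + 1) := by exact_mod_cast ht₁
  push_cast
  linarith

end

/-- The factor in front of `2.619 ^ k` is a polynomial. -/
theorem isPoly_factor : IsPoly fun n => n * (nodeCost rules n * ((n + 1) * 23) +
    (40 * (n + 1) + qsize (encRules rules) + 100)) + (20 * (n + 1) + 60) := by
  have lin : ∀ a, IsPoly fun n => a * (n + 1) := fun a =>
    (isPoly_const a).mul (isPoly_id.add (isPoly_const 1))
  exact (isPoly_id.mul (((isPoly_nodeCost rules).mul ((isPoly_id.add (isPoly_const 1)).mul
    (isPoly_const 23))).add (((lin 40).add (isPoly_const _)).add (isPoly_const 100)))).add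
    ((lin 20).add (isPoly_const 60))

end FourPath

/-- The 4-path vertex cover problem can be decided in `O*(2.619 ^ k)` time: some program decides,
for every graph `G` on `n` vertices and every `k`, whether `G` has a 4-path vertex cover of size
at most `k`, and halts within `p(n) * 2.619 ^ k` steps, for a fixed polynomial `p`. -/
theorem mainTheorem1 :
    ∃ (P : TreeProg.Program) (p : Polynomial ℕ),
      ∀ (n : ℕ) (G : SimpleGraph (Fin n)) [DecidableRel G.Adj] (k : ℕ),
        ∃ (answer : Bool) (t : ℕ),
          P.HaltsWith (TreeProg.encodeInstance G k) (TreeProg.Data.ofBool answer) t ∧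
          (answer = true ↔ HasPathVertexCover G 4 k) ∧
          (t : ℝ) ≤ ((p.eval n : ℕ) : ℝ) * (2.619 : ℝ) ^ k := by
  obtain ⟨p, hp⟩ := FourPath.isPoly_factor
  refine ⟨⟨FourPath.procs FourPath.rules, FourPath.mainTerm⟩, p, fun n G _ k => ?_⟩
  obtain ⟨answer, t, h, hans, ht⟩ := FourPath.halts (G := G) k
  refine ⟨answer, t, h, hans, ht.trans ?_⟩
  rw [← hp, FourPath.roundCost]
  have h1 : (1 : ℝ) ≤ 2.619 ^ k := one_le_pow₀ (by norm_num)
  push_cast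
  generalize (FourPath.nodeCost FourPath.rules n : ℝ) = N
  have hc : (0 : ℝ) ≤ n * (40 * (n + 1) + FourPath.qsize (FourPath.encRules FourPath.rules) + 100) +
      (20 * (n + 1) + 60) := by
    generalize FourPath.qsize (FourPath.encRules FourPath.rules) = q
    positivity
  -- The additive polynomial terms are absorbed by `1 ≤ 2.619 ^ k`.
  nlinarith [mul_le_mul_of_nonneg_left h1 hc]
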